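/- **Model.** The Aztec diamond of size $M\ge1$ consists of the unit cells $[i,i+1]\times[j,j+1]$, $i,j\in\mathbb Z$, contained in $\{|x|+|y|\le M+1\}$; a cell is black if $i+j+1+M$ is even and white otherwise. The black cells form $M+1$ diagonal rows $i+j+1+M=2t$, $t=0,\dots,M$, of $M$ cells each; the positions in a row are numbered $0,\dots,M-1$ from north-west to south-east. Given $b_1,\dots,b_M\in(0,1)$, a random domino tiling is chosen with probability proportional to the product of the weights of its dominoes, where a domino consisting of a black cell of row $t$, $1\le t\le M$, and the cell directly south of it has weight $W_t=b_t/(1-b_t)$, and every other domino has weight $1$. *Height function.* The height function $h_M$ of a tiling is the integer function on the lattice points of the diamond with $h_M(-M,0)=0$ which along a unit segment changes by $+1$ (resp. $-1$) if the cell on the left of the direction of travel is black (resp. white) and the segment does not cut a domino, and by $-3$ (resp. $+3$) if it does cut a domino. *Signatures.* A position of row $N$ carries a particle if its black cell is covered together with its south or west neighbour. For $1\le N\le M$ there are exactly $N$ particles in row $N$. Let $\lambda_i$ be the number of unoccupied positions to the left of the $i$-th particle from the right (that is, of smaller position number). Then $\lambda^{(N)}=(\lambda_1\ge\dots\ge\lambda_N)$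 is a random signature, whose distribution is denoted by $\rho_N$; put $$m[\rho_N]=\frac1N\sum_{i=1}^N\delta\Bigl(\frac{\lambda_i+N-i}{N}\Bigr).$$ **Theorem.** Let $0<\beta<1$. There are a deterministic function $H$ on $\{(u,v)\in\mathbb R^2:|u|+|v|<1\}$ and deterministic probability measures $\mathbf m_\alpha$, $0<\alpha<1$, on $\mathbb R$ with finite moments of all orders, depending only on $\beta$ and related by $$H(u,v)=2(1+u)-2(1+u+v)\,\mathbf m_{\alpha}\Bigl(\bigl(-\infty,\tfrac{1+u-v}{1+u+v}\bigr]\Bigr),\qquad \alpha=\frac{1+u+v}{2},$$ such that (1) and (2) below hold both for the nonrandom parameters $b_i\equiv\beta$, and for random parameters, as follows. For each $M$ the parameters $b_1,\dots,b_M$ are independent and identically distributed with a law $\mathcal B_M$ on $(0,1)$ such that, for $b\sim\mathcal B_M$ and some $\sigma>0$, $$\lim_{M\to\infty}\mathbf E[b]=\beta,\qquad \lim_{M\to\infty}M\operatorname{Var}[b]=\sigma^2,$$ the tiling is chosen as above conditionally on $(b_1,\dots,b_M)$, and convergence in probability is with respect to the joint law of the parameters and the tiling. 1. For all $|u|+|v|<1$,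 $M^{-1}h_M(\lfloor Mu\rfloor,\lfloor Mv\rfloor)\to H(u,v)$ in probability as $M\to\infty$. 2. For every $0<\alpha<1$, every sequence $N=N(M)$ with $N/M\to\alpha$ and every integer $k\ge0$, $\int x^k\,m[\rho_N](dx)\to\int x^k\,\mathbf m_\alpha(dx)$ in probability as $M\to\infty$. In particular, the limit shape for the random parameters is the same as for $b_i\equiv\beta$. -/

import Mathlib

open MeasureTheory Filter Topology ProbabilityTheory

/-- The unit cells of `ℤ²` (a cell `[i, i+1] × [j, j+1]` is recorded as its lower left corner
`(i, j)`) which lie inside `{|x| + |y| ≤ M + 1}`, that is, whose centre satisfies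
`|i + 1/2| + |j + 1/2| ≤ M`: the Aztec diamond of size `M`. -/
noncomputable def aztecCells (M : ℕ) : Finset (ℤ × ℤ) :=
  (Finset.Ico (-(M : ℤ)) M ×ˢ Finset.Ico (-(M : ℤ)) M).filter
    (fun c => |2 * c.1 + 1| + |2 * c.2 + 1| ≤ 2 * (M : ℤ))

/-- Two cells share a side. -/
abbrev CellAdj (c d : ℤ × ℤ) : Prop := |c.1 - d.1| + |c.2 - d.2| = 1

/-- A domino tiling of the Aztec diamond of size `M` (a perfect matching of its cells), given by the
map sending each cell to the other cell of the domino that covers it. -/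
abbrev DominoTiling (M : ℕ) : Type :=
  {mate : aztecCells M → aztecCells M // ∀ c : aztecCells M, CellAdj c (mate c) ∧ mate (mate c) = c}

namespace DominoTiling

variable {M : ℕ}

/-- The cells `c` and `d` form a domino of the tiling `T`. -/
abbrev IsDomino (T : DominoTiling M) (c d : ℤ × ℤ) : Prop :=
  ∃ h : c ∈ aztecCells M, (T.1 ⟨c, h⟩ : ℤ × ℤ) = d

/-- Checkerboard colouring of the cells; the cells along the south-west and north-east
sides of the diamond are black, those along the other two sides are white. -/
abbrev IsBlack (M : ℕ) (c : ℤ × ℤ) : Prop := Even (c.1 + c.2 + 1 + (M : ℤ))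

/-! ### Height function

Along a unit lattice segment which is not in the interior of a domino the height changes by `+1` if
the cell on the left of the direction of travel is black and by `-1` if it is white; across a domino
the change is `-3`, respectively `+3`. -/

/-- Change of height when the cell on the left is `l` and the cell on the right is `r`. -/
noncomputable def heightStep (T : DominoTiling M) (l r : ℤ × ℤ) : ℤ :=
  (if IsBlack M l then 1 else -1) * (if T.IsDomino l r then -3 else 1)

/-- Change of height from the lattice point `(x, y)` to `(x + 1, y)`. -/
noncomputable def heightStepEast (T : DominoTiling M) (x y : ℤ) : ℤ :=
  T.heightStep (x, y) (x, y - 1)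

/-- Change of height from the lattice point `(x, y)` to `(x, y + 1)`. -/
noncomputable def heightStepNorth (T : DominoTiling M) (x y : ℤ) : ℤ :=
  T.heightStep (x - 1, y) (x, y)

/-- The height function `h_M` of a tiling at the lattice points `(x, y)` of the Aztec diamond,
normalized to vanish at the boundary point `(-M, 0)`. It is the sum of the height changes along the
lattice path `(-M, 0) → (x, 0) → (x, y)`, which stays inside the diamond (for `y ≥ 0` the third sum
is empty, for `y ≤ 0` the second one is). -/
noncomputable def height (T : DominoTiling M) (x y : ℤ) : ℤ :=
  ∑ i ∈ Finset.Ico (-(M : ℤ)) x, T.heightStepEast i 0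
    + ∑ j ∈ Finset.Ico 0 y, T.heightStepNorth x j
    - ∑ j ∈ Finset.Ico y 0, T.heightStepNorth x j

/-! ### Particles and signatures

Black cells are arranged in `M + 1` diagonal rows `i + j + 1 + M = 2 t`, `0 ≤ t ≤ M`, of `M` cells
each. Rotating the picture by 45 degrees counterclockwise makes these rows horizontal; the south
and west neighbours of a black cell then lie below it, to the right and to the left respectively. -/

/-- The `p`-th black cell from the left, `0 ≤ p < M`, in the row number `t`. -/
def rowCell (M t p : ℕ) : ℤ × ℤ := ((t : ℤ) + p - M, (t : ℤ) - p - 1)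

/-- The position `p` of row `t` carries a particle: the black cell is covered together with one of
the two cells below it. -/
abbrev HasParticle (T : DominoTiling M) (t p : ℕ) : Prop :=
  T.IsDomino (rowCell M t p) ((rowCell M t p).1 - 1, (rowCell M t p).2) ∨
    T.IsDomino (rowCell M t p) ((rowCell M t p).1, (rowCell M t p).2 - 1)

/-- The signature `λ^{(N)}` read off row `N`, which has exactly `N` particles when `N ≤ M`:
`λ_{i+1}` (with `i = 0, …, N - 1`, starting from the rightmost particle) is the number of unoccupied
positions to the left of the `(i+1)`-st particle from the right. -/
noncomputable def signature (T : DominoTiling M) (N : ℕ) (i : Fin N) : ℕ :=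
  ((Finset.range (Nat.nth (T.HasParticle N) (N - 1 - i))).filter
    (fun q => ¬ T.HasParticle N q)).card

/-- The empirical measure `m[ρ_N] = N⁻¹ ∑_i δ((λ_i + N - i) / N)`, where `λ = λ^{(N)}`
(the index `i` of the sum starts at `0` here). -/
noncomputable def empiricalMeasure (T : DominoTiling M) (N : ℕ) : Measure ℝ :=
  (N : ENNReal)⁻¹ • ∑ i : Fin N,
    Measure.dirac (((T.signature N i : ℝ) + N - ((i : ℕ) + 1)) / N)

/-! ### Random tilings -/

/-- The Boltzmann weight of a tiling in the environment `b = (b_1, …, b_M)`: in row `t`, each domino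
formed by a black cell and its south neighbour has weight `W_t = b_t / (1 - b_t)`;
all other dominos have weight `1`. -/
noncomputable def weight (b : Fin M → ℝ) (T : DominoTiling M) : ℝ :=
  ∏ t : Fin M, ∏ _p ∈ (Finset.range M).filter (fun p => T.IsDomino (rowCell M (t + 1) p)
    ((rowCell M (t + 1) p).1, (rowCell M (t + 1) p).2 - 1)), b t / (1 - b t)

/-- Quenched probability of a set of tilings: each tiling has probability proportional to
its weight in the fixed environment `b`. -/
noncomputable def quenchedProb (b : Fin M → ℝ) (A : Set (DominoTiling M)) : ℝ :=
  ∑ T, A.indicator (fun T => weight b T / ∑ T', weight b T') T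

/-- Annealed probability of a set of tilings: the environment consists of `M` independent variables
with law `B`, and given the environment the tiling has the quenched law. -/
noncomputable def annealedProb (B : Measure ℝ) (A : Set (DominoTiling M)) : ℝ :=
  ∫ b, quenchedProb b A ∂(Measure.pi fun _ : Fin M => B)

/-- Convergence in probability of the random variables `X M`, where `P M` is the law of the random
tiling of the Aztec diamond of size `M`, to the constant `x` as `M → ∞`. -/
def ConvergesInProb (P : ∀ M, Set (DominoTiling M) → ℝ) (X : ∀ M, DominoTiling M → ℝ) (x : ℝ) :
    Prop :=
  ∀ ε : ℝ, 0 < ε → Tendsto (fun M => P M {T | ε ≤ |X M T - x|}) atTop (𝓝 0)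

/-- The rescaled height profile converges in probability to `H`, pointwise in the open rescaled
Aztec diamond and in the sense of moments: for `N ~ α M` the moments of the random measures
`m[ρ_N]` converge in probability to the moments of `m α`. -/
def ConvergesToLimitShape (P : ∀ M, Set (DominoTiling M) → ℝ)
    (H : ℝ → ℝ → ℝ) (m : ℝ → Measure ℝ) : Prop :=
  (∀ u v : ℝ, |u| + |v| < 1 →
    ConvergesInProb P (fun M T => (T.height ⌊M * u⌋ ⌊M * v⌋ : ℝ) / M) (H u v)) ∧
  (∀ α : ℝ, 0 < α → α < 1 → ∀ N : ℕ → ℕ,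
    Tendsto (fun M => (N M : ℝ) / M) atTop (𝓝 α) → ∀ k : ℕ,
      ConvergesInProb P (fun M T => ∫ x, x ^ k ∂(T.empiricalMeasure (N M))) (∫ x, x ^ k ∂(m α)))

end DominoTiling

/-!
The positions of the particles in the rows of black cells turn a tiling into a sequence of sets
`S_0 = ∅, S_1, …, S_M = {0, …, M - 1}`. Neighbouring sets interlace: once the particles of the upper
row have made their jumps (the dominoes pointing south), each gap between two consecutive particles
contains exactly one particle of the lower row, and the remaining dominoes are determined
(`sum_rowCompat`). Hence the weighted number of tilings below a given row is a Slater determinant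
`det f_i(s_j)`, and in the binomial basis `p ↦ ∑ p_i (s choose i)` a step of the transfer operator
replaces the coefficient polynomials `f_i` by `1` and `(X + b) f_i` (`sum_rowKernel_mul_slater`,
`stepFun_newtonEval`). On the full row `S_M` the determinant is that of the lowest coefficients,
inside which a step of the transfer operator amounts to `1 + b Δ` with the shift of coefficients `Δ`.
Conjugating the multiplication by the position with these operators adds
`∑_t b_t (1 + Δ) / (1 + b_t Δ)` to it, and
`𝔼 ∏_{p ∈ S_N} (1 + ε p ^ k) = det (1 + ε A_k)`,
where `A_k` is the upper left `N × N` corner of the `k`-th power of an explicit infinite matrix `L`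
(`rowPartition_eq_det`, `sum_weight_mul_prod`).

The first two coefficients in `ε` give the mean `tr A_k` of the power sum `∑_{p ∈ S_N} p ^ k` and its
variance `tr A_{2k} - tr A_k ^ 2`. Since `L` has finitely many nonzero diagonals above the main one,
the variance comes from boundedly many matrix elements at the corner and is `O(M ^ {2k})`,
negligible against `M ^ {2k + 2}` (`exists_variance_bound`). The mean is a sum of weights of lattice
paths, which converges after rescaling (`tendsto_constMean`), and replacing the parameters `b_t` by
`β` changes it by at most a multiple of `M ^ k ∑ |b_t - β|` (`exists_mean_bound`). All this is
collected in `exists_quenchedExp_bound`: the rescaled power sums have second moments around the limit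
for constant parameters bounded by `C M⁻² + C M⁻¹ ∑ (b_t - β) ^ 2 + o(1)`. For random parameters the
expectation of the middle term is `C 𝔼 (b - β) ^ 2 → 0`, which is why the limits agree.

The limiting measures are limit points of the expected empirical measures, which live on a compact
interval (`exists_limit_measure`). Along a row of black cells the height changes by `-2` at occupied
and by `+2` at unoccupied positions (`height_row`), so that it is an affine function of the number of
particles to the left of a point. Polynomial approximation of step functions, together with the fact
that the particles of a row are distinct, derives the convergence of this number from that of the
moments (`convergesInProb_card`).
-/

/-! ### Interlacing of neighbouring rows -/

/-- For a monotone sequence, `y j < k` holds exactly for the first `#{i | y i < k}` indices. -/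
theorem Monotone.lt_iff_lt_card_filter {m : ℕ} {y : Fin m → ℕ} (hy : Monotone y) (k : ℕ)
    (j : Fin m) : y j < k ↔ (j : ℕ) < (Finset.univ.filter (fun i => y i < k)).card := by
  constructor
  · intro h
    have : Finset.Iic j ⊆ Finset.univ.filter (fun i => y i < k) := by
      intro i hi
      simp only [Finset.mem_filter, Finset.mem_univ, true_and]
      exact lt_of_le_of_lt (hy (Finset.mem_Iic.1 hi)) h
    have := Finset.card_le_card this
    rw [Fin.card_Iic] at this
    omega
  · intro h
    by_contra hk
    have : Finset.univ.filter (fun i => y i < k) ⊆ Finset.Iio j := by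
      intro i hi
      simp only [Finset.mem_filter, Finset.mem_univ, true_and] at hi
      rw [Finset.mem_Iio]
      by_contra hij
      exact hk (lt_of_le_of_lt (hy (not_lt.1 hij)) hi)
    have := Finset.card_le_card this
    rw [Fin.card_Iio] at this
    omega

/-- Compatibility of two neighbouring rows of black cells: `S'` and `S` are the sets of occupied
positions of the lower and of the upper row, `C` is the set of unoccupied positions of the lower row
matched to the upper right, `B` is the set of occupied positions of the upper row matched to the
lower right. The condition says that each of the `M + 1` white cells between the two rows is
covered exactly once. -/
def RowCompat (M : ℕ) (S' S C B : Finset ℕ) : Prop :=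
  C ⊆ Finset.range M \ S' ∧ B ⊆ S ∧ ∀ q ≤ M,
    (if q ∈ S \ B then 1 else 0) + (if q ∈ B.image (· + 1) then 1 else 0)
      + (if q ∈ (Finset.range M \ S') \ C then 1 else 0)
      + (if q ∈ C.image (· + 1) then 1 else 0) = (1 : ℕ)

instance (M : ℕ) (S' S C B : Finset ℕ) : Decidable (RowCompat M S' S C B) :=
  inferInstanceAs (Decidable (_ ∧ _ ∧ _))

/-- The position (among the white cells below the row) to which the `j`-th particle is matched. -/
def shiftPos {n : ℕ} (s : Fin n → ℕ) (B : Finset ℕ) (j : Fin n) : ℕ :=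
  s j + if s j ∈ B then 1 else 0

theorem shiftPos_monotone {n : ℕ} {s : Fin n → ℕ} (hs : StrictMono s) (B : Finset ℕ) :
    Monotone (shiftPos s B) := by
  intro i j hij
  rcases hij.eq_or_lt with rfl | h
  · exact le_rfl
  · have := hs h
    unfold shiftPos
    split_ifs <;> omega

theorem card_filter_lt_succ {n : ℕ} (y : Fin n → ℕ) (k : ℕ) :
    (Finset.univ.filter (fun j => y j < k + 1)).card =
      (Finset.univ.filter (fun j => y j < k)).card +
        (Finset.univ.filter (fun j => y j = k)).card := by
  rw [← Finset.card_union_of_disjoint]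
  · congr 1
    ext j
    simp only [Finset.mem_filter, Finset.mem_univ, true_and, Finset.mem_union]
    omega
  · rw [Finset.disjoint_filter]
    intros; omega

theorem card_filter_eq_of_injective {n : ℕ} {s : Fin n → ℕ} (hs : Function.Injective s) (k : ℕ) :
    (Finset.univ.filter (fun j => s j = k)).card = if k ∈ Finset.univ.image s then 1 else 0 := by
  split_ifs with h
  · obtain ⟨j, -, rfl⟩ := Finset.mem_image.1 h
    rw [Finset.card_eq_one]
    refine ⟨j, ?_⟩
    ext i
    simp [hs.eq_iff]
  · rw [Finset.card_eq_zero, Finset.filter_eq_empty_iff]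
    rintro j - rfl
    exact h (Finset.mem_image_of_mem _ (Finset.mem_univ j))

theorem card_filter_shiftPos_eq {n : ℕ} {s : Fin n → ℕ} (hs : StrictMono s) {B : Finset ℕ}
    (hB : B ⊆ Finset.univ.image s) (k : ℕ) :
    (Finset.univ.filter (fun j => shiftPos s B j = k)).card =
      (if k ∈ Finset.univ.image s \ B then 1 else 0) + (if k ∈ B.image (· + 1) then 1 else 0) := by
  have h1 : Finset.univ.filter (fun j => shiftPos s B j = k) =
      (Finset.univ.filter (fun j => s j = k ∧ s j ∉ B)) ∪
        (Finset.univ.filter (fun j => s j + 1 = k ∧ s j ∈ B)) := by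
    ext j
    simp only [Finset.mem_filter, Finset.mem_univ, true_and, Finset.mem_union]
    by_cases h : s j ∈ B <;> simp [shiftPos, h]
  rw [h1, Finset.card_union_of_disjoint]
  · congr 1
    · split_ifs with h
      · obtain ⟨h1, h2⟩ := Finset.mem_sdiff.1 h
        obtain ⟨j, -, rfl⟩ := Finset.mem_image.1 h1
        rw [Finset.card_eq_one]
        refine ⟨j, ?_⟩
        ext i
        simp only [Finset.mem_filter, Finset.mem_univ, true_and, Finset.mem_singleton]
        constructor
        · rintro ⟨h, -⟩
          exact hs.injective h
        · rintro rfl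
          exact ⟨rfl, h2⟩
      · rw [Finset.card_eq_zero, Finset.filter_eq_empty_iff]
        rintro j - ⟨rfl, h2⟩
        exact h (Finset.mem_sdiff.2 ⟨Finset.mem_image_of_mem _ (Finset.mem_univ j), h2⟩)
    · split_ifs with h
      · obtain ⟨p, hp, rfl⟩ := Finset.mem_image.1 h
        obtain ⟨j, -, rfl⟩ := Finset.mem_image.1 (hB hp)
        rw [Finset.card_eq_one]
        refine ⟨j, ?_⟩
        ext i
        simp only [Finset.mem_filter, Finset.mem_univ, true_and, Finset.mem_singleton,
          add_left_inj]
        constructor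
        · rintro ⟨h, -⟩
          exact hs.injective h
        · rintro rfl
          exact ⟨rfl, hp⟩
      · rw [Finset.card_eq_zero, Finset.filter_eq_empty_iff]
        rintro j - ⟨rfl, h2⟩
        exact h (Finset.mem_image_of_mem _ h2)
  · rw [Finset.disjoint_filter]
    rintro j - ⟨h1, h2⟩ ⟨h3, h4⟩
    exact h2 h4

/-- The counting identity behind the interlacing: below any level `k ≤ M`, the upper row (after
its jumps) has as many particles as the lower one, plus one if a hole jumps across `k`. -/
theorem RowCompat.card_eq {M n : ℕ} {S' C B : Finset ℕ} {s : Fin n → ℕ} (hs : StrictMono s)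
    (h : RowCompat M S' (Finset.univ.image s) C B) (k : ℕ) (hk : k ≤ M) :
    (Finset.univ.filter (fun j => shiftPos s B j < k)).card =
      (S'.filter (· < k)).card + if k ∈ C.image (· + 1) then 1 else 0 := by
  obtain ⟨hC, hB, h⟩ := h
  induction k with
  | zero => simp
  | succ k ih =>
    have hq := h k (by omega)
    rw [← card_filter_shiftPos_eq hs hB] at hq
    have ih := ih (by omega)
    rw [card_filter_lt_succ, ih]
    have hc : (S'.filter (· < k + 1)).card = (S'.filter (· < k)).card +
        if k ∈ S' then 1 else 0 := by
      have : S'.filter (· < k + 1) = S'.filter (· < k) ∪ S'.filter (· = k) := by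
        ext p; simp only [Finset.mem_filter, Finset.mem_union]
        constructor
        · rintro ⟨h1, h2⟩
          rcases Nat.lt_succ_iff_lt_or_eq.1 h2 with h | h
          · exact Or.inl ⟨h1, h⟩
          · exact Or.inr ⟨h1, h⟩
        · rintro (⟨h1, h2⟩ | ⟨h1, h2⟩)
          · exact ⟨h1, by omega⟩
          · exact ⟨h1, by omega⟩
      rw [this, Finset.card_union_of_disjoint, Finset.filter_eq']
      · split_ifs <;> simp
      · rw [Finset.disjoint_filter]; intros; omega
    rw [hc]
    have e1 : (k + 1 ∈ C.image (· + 1)) ↔ k ∈ C := by simp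
    have e2 : k ∈ C → k ∉ S' := fun hkC => (Finset.mem_sdiff.1 (hC hkC)).2
    have e3 : (k ∈ (Finset.range M \ S') \ C) ↔ k ∉ S' ∧ k ∉ C := by
      simp only [Finset.mem_sdiff, Finset.mem_range]
      constructor
      · rintro ⟨⟨_, a⟩, b⟩; exact ⟨a, b⟩
      · rintro ⟨a, b⟩; exact ⟨⟨by omega, a⟩, b⟩
    simp only [e1]
    by_cases hS : k ∈ S' <;> by_cases hkC : k ∈ C <;>
      simp only [e3, hS, hkC, not_true_eq_false, not_false_eq_true, and_true, and_false,
        if_true, if_false] at hq e2 ⊢ <;> first | omega | (simp at e2)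

/-- The counting identity at the right end: the upper row has one more particle than the lower one. -/
theorem RowCompat.card_eq_card_add_one {M n : ℕ} {S' C B : Finset ℕ} {s : Fin n → ℕ}
    (hs : StrictMono s) (hsM : ∀ j, s j < M) (hS' : S' ⊆ Finset.range M)
    (h : RowCompat M S' (Finset.univ.image s) C B) : n = S'.card + 1 := by
  have h1 := h.card_eq hs M le_rfl
  obtain ⟨hC, hB, h⟩ := h
  have hq := h M le_rfl
  rw [← card_filter_shiftPos_eq hs hB] at hq
  have h2 := card_filter_lt_succ (shiftPos s B) M
  have h3 : Finset.univ.filter (fun j => shiftPos s B j < M + 1) = Finset.univ := by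
    rw [Finset.filter_eq_self]
    intro j _
    have := hsM j
    unfold shiftPos; split_ifs <;> omega
  have h4 : S'.filter (· < M) = S' := by
    rw [Finset.filter_eq_self]
    intro j hj
    exact Finset.mem_range.1 (hS' hj)
  rw [h3, Finset.card_univ, Fintype.card_fin] at h2
  rw [h4] at h1
  have h5 : M ∉ (Finset.range M \ S') \ C := by simp
  rw [if_neg h5] at hq
  omega

/-- Given interlacing positions `r` of the lower row, the holes that must be matched to the upper
right. -/
def rightHoles {n : ℕ} (M : ℕ) (y : Fin (n + 1) → ℕ) (r : Fin n → ℕ) : Finset ℕ :=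
  (Finset.range M \ Finset.univ.image r).filter (fun p =>
    (Finset.univ.filter (fun j => y j < p + 1)).card =
      (Finset.univ.filter (fun j => r j < p + 1)).card + 1)

theorem strictMono_of_mem_piFinset {n : ℕ} {y : Fin (n + 1) → ℕ} (hy : Monotone y) {r : Fin n → ℕ}
    (hr : ∀ j : Fin n, y j.castSucc ≤ r j ∧ r j < y j.succ) : StrictMono r := by
  intro i j hij
  refine lt_of_lt_of_le (hr i).2 (le_trans (hy ?_) (hr j).1)
  rw [Fin.le_def]
  simpa using hij

/-- Interlacing positions come from a compatible row. -/
theorem rowCompat_of_interlace {M n : ℕ} {B : Finset ℕ} {s : Fin (n + 1) → ℕ} (hs : StrictMono s)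
    (hsM : ∀ j, s j < M) (hB : B ⊆ Finset.univ.image s) {r : Fin n → ℕ}
    (hr : ∀ j : Fin n, shiftPos s B j.castSucc ≤ r j ∧ r j < shiftPos s B j.succ) :
    RowCompat M (Finset.univ.image r) (Finset.univ.image s)
      (rightHoles M (shiftPos s B) r) B := by
  set y := shiftPos s B with hy_def
  have hy : Monotone y := shiftPos_monotone hs B
  have hrs : StrictMono r := strictMono_of_mem_piFinset hy hr
  have hyM : ∀ j, y j ≤ M := by
    intro j
    have := hsM j
    simp only [hy_def, shiftPos]; split_ifs <;> omega
  have hrM : ∀ j, r j < M := fun j => lt_of_lt_of_le (hr j).2 (hyM _)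
  let a : ℕ → ℕ := fun k => (Finset.univ.filter (fun j => y j < k)).card
  let c : ℕ → ℕ := fun k => (Finset.univ.filter (fun j => r j < k)).card
  have ha : ∀ k (j : Fin (n + 1)), y j < k ↔ (j : ℕ) < a k := hy.lt_iff_lt_card_filter
  have hc : ∀ k (j : Fin n), r j < k ↔ (j : ℕ) < c k := hrs.monotone.lt_iff_lt_card_filter
  have hcn : ∀ k, c k ≤ n := fun k => by
    simpa using Finset.card_filter_le (Finset.univ : Finset (Fin n)) (fun j => r j < k)
  have han : ∀ k, a k ≤ n + 1 := fun k => by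
    simpa using Finset.card_filter_le (Finset.univ : Finset (Fin (n + 1))) (fun j => y j < k)
  -- interlacing in terms of the counting functions
  have hca : ∀ k, c k ≤ a k := by
    intro k
    by_contra hlt
    push Not at hlt
    have hj : a k < n := lt_of_lt_of_le hlt (hcn k)
    have h1 : r ⟨a k, hj⟩ < k := (hc k ⟨a k, hj⟩).2 hlt
    have h2 := lt_of_le_of_lt (hr ⟨a k, hj⟩).1 h1
    have := (ha k _).1 h2
    simp at this
  have hac : ∀ k, a k ≤ c k + 1 := by
    intro k
    by_contra hlt
    push Not at hlt
    have hj : c k < n := by have := han k; omega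
    have h1 : y (Fin.succ ⟨c k, hj⟩) < k := (ha k _).2 (by simpa using hlt)
    have h2 := lt_trans (hr ⟨c k, hj⟩).2 h1
    have := (hc k _).1 h2
    simp at this
  have hat : ∀ k, k ∈ Finset.univ.image r → a (k + 1) = c (k + 1) := by
    intro k hk
    obtain ⟨j, -, rfl⟩ := Finset.mem_image.1 hk
    have h1 : ¬ (y j.succ < r j + 1) := by have := (hr j).2; omega
    rw [ha] at h1
    have h2 : r j < r j + 1 := by omega
    rw [hc] at h2
    have := hca (r j + 1)
    simp only [Fin.val_succ] at h1
    have := hac (r j + 1)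
    have h3 : c (r j + 1) ≤ j + 1 := by
      by_contra h4
      push Not at h4
      have h5 : (j : ℕ) + 1 < n := lt_of_lt_of_le h4 (hcn _)
      have h6 := (hc (r j + 1) ⟨j + 1, h5⟩).2 h4
      have h7 : r j < r ⟨j + 1, h5⟩ := hrs (by rw [Fin.lt_def]; simp)
      omega
    omega
  have hmem : ∀ p, p ∈ rightHoles M y r ↔
      p < M ∧ p ∉ Finset.univ.image r ∧ a (p + 1) = c (p + 1) + 1 := by
    intro p
    simp only [rightHoles, Finset.mem_filter, Finset.mem_sdiff, Finset.mem_range, and_assoc, a, c]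
  -- the holes jumping across level `q` are those where the two counting functions differ
  have hx : ∀ q ≤ M, (if q ∈ (rightHoles M y r).image (· + 1) then 1 else 0) = a q - c q := by
    intro q hq
    cases q with
    | zero => simp [a, c]
    | succ p =>
      have e : p + 1 ∈ (rightHoles M y r).image (· + 1) ↔ p ∈ rightHoles M y r := by simp
      simp only [e, hmem]
      have h1 := hca (p + 1)
      have h2 := hac (p + 1)
      split_ifs with h
      · omega
      · by_cases hp : p ∈ Finset.univ.image r
        · have := hat p hp; omega
        · have : a (p + 1) ≠ c (p + 1) + 1 := fun h3 => h ⟨by omega, hp, h3⟩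
          omega
  refine ⟨Finset.filter_subset _ _, hB, fun q hq => ?_⟩
  rw [hx q hq, ← card_filter_shiftPos_eq hs hB]
  have h1 : a (q + 1) = a q + (Finset.univ.filter (fun j => y j = q)).card :=
    card_filter_lt_succ y q
  have h2 : c (q + 1) = c q + (Finset.univ.filter (fun j => r j = q)).card :=
    card_filter_lt_succ r q
  rw [card_filter_eq_of_injective hrs.injective] at h2
  have h3 := hca q
  have h4 := hac q
  have h5 := hca (q + 1)
  have h6 := hac (q + 1)
  rw [← hy_def]
  rcases hq.eq_or_lt with rfl | hqM
  · -- at the right end there is no black cell to the right of the white one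
    have e1 : a (q + 1) = n + 1 := by
      have : Finset.univ.filter (fun j => y j < q + 1) = Finset.univ := by
        rw [Finset.filter_eq_self]; intro j _; have := hyM j; omega
      simp only [a, this, Finset.card_univ, Fintype.card_fin]
    have e2 : c q = n := by
      have : Finset.univ.filter (fun j => r j < q) = Finset.univ := by
        rw [Finset.filter_eq_self]; intro j _; exact hrM j
      simp only [c, this, Finset.card_univ, Fintype.card_fin]
    rw [if_neg (by simp)]
    omega
  · by_cases hqr : q ∈ Finset.univ.image r
    · have := hat q hqr
      rw [if_pos hqr] at h2
      rw [if_neg (fun h => (Finset.mem_sdiff.1 (Finset.mem_sdiff.1 h).1).2 hqr)]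
      omega
    · rw [if_neg hqr] at h2
      have e : q ∈ (Finset.range M \ Finset.univ.image r) \ rightHoles M y r ↔
          ¬ a (q + 1) = c (q + 1) + 1 := by
        rw [Finset.mem_sdiff, hmem, Finset.mem_sdiff, Finset.mem_range]
        tauto
      simp only [e]
      split_ifs <;> omega

/-- Compatible rows interlace. -/
theorem RowCompat.interlace {M n : ℕ} {S' C B : Finset ℕ} {s : Fin (n + 1) → ℕ} (hs : StrictMono s)
    (hS' : S' ⊆ Finset.range M)
    (h : RowCompat M S' (Finset.univ.image s) C B) {r : Fin n → ℕ} (hr : StrictMono r)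
    (hrS : Finset.univ.image r = S') :
    (∀ j : Fin n, shiftPos s B j.castSucc ≤ r j ∧ r j < shiftPos s B j.succ) ∧
      C = rightHoles M (shiftPos s B) r := by
  have hcard : ∀ k, (S'.filter (· < k)).card =
      (Finset.univ.filter (fun j => r j < k)).card := by
    intro k
    rw [← hrS, Finset.filter_image, Finset.card_image_of_injective _ hr.injective]
  have hy : Monotone (shiftPos s B) := shiftPos_monotone hs B
  have key := h.card_eq hs
  have hC := h.1
  have hCiff : ∀ p, p + 1 ∈ C.image (· + 1) ↔ p ∈ C := by simp
  constructor
  · intro j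
    have hjS : r j ∈ S' := by rw [← hrS]; exact Finset.mem_image_of_mem _ (Finset.mem_univ j)
    have hjM : r j < M := Finset.mem_range.1 (hS' hjS)
    have hjC : r j ∉ C := fun hh => (Finset.mem_sdiff.1 (hC hh)).2 hjS
    have e := key (r j + 1) hjM
    rw [hcard, if_neg (by rw [hCiff]; exact hjC), add_zero] at e
    have hc := hr.monotone.lt_iff_lt_card_filter (r j + 1)
    have ha := hy.lt_iff_lt_card_filter (r j + 1)
    have h1 : (j : ℕ) < (Finset.univ.filter (fun i => r i < r j + 1)).card :=
      (hc j).1 (by omega)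
    constructor
    · have := (ha j.castSucc).2 (by rw [e]; simpa using h1)
      omega
    · by_contra h2
      push Not at h2
      have h3 := (ha j.succ).1 (by omega)
      rw [e] at h3
      have h5 : (j : ℕ) + 1 < n := by
        refine lt_of_lt_of_le (by simpa using h3) ?_
        simpa using Finset.card_filter_le (Finset.univ : Finset (Fin n)) (fun i => r i < r j + 1)
      have h6 := (hc ⟨j + 1, h5⟩).2 (by simpa using h3)
      have h7 : r j < r ⟨j + 1, h5⟩ := hr (by rw [Fin.lt_def]; simp)
      omega
  · ext p
    simp only [rightHoles, Finset.mem_filter, hrS, ← hcard]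
    constructor
    · intro hp
      refine ⟨hC hp, ?_⟩
      have hpM : p < M := Finset.mem_range.1 (Finset.mem_sdiff.1 (hC hp)).1
      rw [key (p + 1) hpM, if_pos ((hCiff p).2 hp)]
    · rintro ⟨h1, h2⟩
      have hpM : p < M := Finset.mem_range.1 (Finset.mem_sdiff.1 h1).1
      rw [key (p + 1) hpM] at h2
      by_contra hp
      rw [if_neg (fun hh => hp ((hCiff p).1 hh))] at h2
      omega

/-- Summing over the rows below a given one amounts to summing over interlacing positions. -/
theorem sum_rowCompat {M n : ℕ} {B : Finset ℕ} {s : Fin (n + 1) → ℕ} (hs : StrictMono s)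
    (hsM : ∀ j, s j < M) (hB : B ⊆ Finset.univ.image s) (F : Finset ℕ → ℝ) :
    ∑ x ∈ ((Finset.range M).powerset ×ˢ (Finset.range M).powerset).filter
        (fun x => RowCompat M x.1 (Finset.univ.image s) x.2 B), F x.1 =
      ∑ r ∈ Fintype.piFinset
        (fun j : Fin n => Finset.Ico (shiftPos s B j.castSucc) (shiftPos s B j.succ)),
        F (Finset.univ.image r) := by
  symm
  have hmem : ∀ r : Fin n → ℕ, r ∈ Fintype.piFinset
        (fun j : Fin n => Finset.Ico (shiftPos s B j.castSucc) (shiftPos s B j.succ)) ↔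
        ∀ j : Fin n, shiftPos s B j.castSucc ≤ r j ∧ r j < shiftPos s B j.succ := by
    intro r; simp only [Fintype.mem_piFinset, Finset.mem_Ico]
  have hy := shiftPos_monotone hs B
  refine Finset.sum_bij (fun r _ => (Finset.univ.image r, rightHoles M (shiftPos s B) r))
    ?_ ?_ ?_ ?_
  · intro r hr
    rw [hmem] at hr
    simp only [Finset.mem_filter, Finset.mem_product, Finset.mem_powerset]
    refine ⟨⟨?_, ?_⟩, rowCompat_of_interlace hs hsM hB hr⟩
    · intro p hp
      obtain ⟨j, -, rfl⟩ := Finset.mem_image.1 hp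
      have h1 := hsM j.succ
      have h2 := (hr j).2
      rw [Finset.mem_range]
      unfold shiftPos at h2; split_ifs at h2 <;> omega
    · exact (Finset.filter_subset _ _).trans Finset.sdiff_subset
  · intro r hr r' hr' h
    rw [hmem] at hr hr'
    have h1 := strictMono_of_mem_piFinset hy hr
    have h2 := strictMono_of_mem_piFinset hy hr'
    have h3 : Finset.univ.image r = Finset.univ.image r' := (Prod.mk.inj h).1
    refine (StrictMono.range_inj h1 h2).1 ?_
    simpa using congrArg (fun A : Finset ℕ => (A : Set ℕ)) h3
  · rintro ⟨S', C⟩ hx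
    simp only [Finset.mem_filter, Finset.mem_product, Finset.mem_powerset] at hx
    obtain ⟨⟨hS', -⟩, hx⟩ := hx
    have hcard : S'.card = n := by
      have := hx.card_eq_card_add_one hs hsM hS'
      omega
    have hr : StrictMono (fun j => (S'.orderEmbOfFin hcard j : ℕ)) :=
      (S'.orderEmbOfFin hcard).strictMono
    have him : Finset.univ.image (fun j => (S'.orderEmbOfFin hcard j : ℕ)) = S' := by
      have := Finset.image_orderEmbOfFin_univ S' hcard
      exact this
    have := hx.interlace hs hS' hr him
    refine ⟨_, (hmem _).2 this.1, ?_⟩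
    rw [him, ← this.2]
  · intro r hr
    rfl

/-! ### The transfer operator acts on Slater determinants -/

/-- The total weight of the ways to place the dominoes between two neighbouring rows of black cells
with occupied positions `S'` (below) and `S` (above). -/
noncomputable def rowKernel (M : ℕ) (W : ℝ) (S' S : Finset ℕ) : ℝ :=
  ∑ x ∈ ((Finset.range M).powerset ×ˢ S.powerset).filter (fun x => RowCompat M S' S x.1 x.2),
    W ^ x.2.card

/-- The determinant `det f_i(s_j)`, where `s_0 < s_1 < ⋯` are the elements of `S`; it is set to
zero if `S` does not have as many elements as there are functions. -/
noncomputable def slater {n : ℕ} (f : Fin n → ℕ → ℝ) (S : Finset ℕ) : ℝ :=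
  if h : S.card = n then Matrix.det (Matrix.of fun j i => f i (S.orderEmbOfFin h j)) else 0

theorem slater_image {n : ℕ} (f : Fin n → ℕ → ℝ) {s : Fin n → ℕ} (hs : StrictMono s) :
    slater f (Finset.univ.image s) = Matrix.det (Matrix.of fun j i => f i (s j)) := by
  have h : (Finset.univ.image s).card = n := by
    rw [Finset.card_image_of_injective _ hs.injective, Finset.card_univ, Fintype.card_fin]
  rw [slater, dif_pos h]
  have : s = (Finset.univ.image s).orderEmbOfFin h :=
    Finset.orderEmbOfFin_unique h (fun x => Finset.mem_image_of_mem _ (Finset.mem_univ x)) hs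
  congr 2
  ext j i
  rw [congrFun this j]

theorem slater_of_card_ne {n : ℕ} (f : Fin n → ℕ → ℝ) {S : Finset ℕ} (h : S.card ≠ n) :
    slater f S = 0 := dif_neg h

/-- The determinant of the differences of consecutive rows is a determinant with a column of ones. -/
theorem det_sub_eq_det_cons {n : ℕ} (Φ : ℕ → Fin n → ℝ) (y : Fin (n + 1) → ℕ) :
    Matrix.det (Matrix.of fun (j : Fin n) i => Φ (y j.succ) i - Φ (y j.castSucc) i) =
      Matrix.det (Matrix.of fun (j : Fin (n + 1)) =>
        (Fin.cons (1 : ℝ) (Φ (y j)) : Fin (n + 1) → ℝ)) := by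
  let A : Matrix (Fin (n + 1)) (Fin (n + 1)) ℝ :=
    Matrix.of fun (j : Fin (n + 1)) => (Fin.cons (1 : ℝ) (Φ (y j)) : Fin (n + 1) → ℝ)
  let B : Matrix (Fin (n + 1)) (Fin (n + 1)) ℝ :=
    Matrix.of fun j => Fin.cases (A 0) (fun j => A j.succ - A j.castSucc) j
  have h1 : A.det = B.det := by
    refine Matrix.det_eq_of_forall_row_eq_smul_add_pred (fun _ => 1) ?_ ?_
    · intro i; simp [B]
    · intro j i; simp [B]
  change _ = A.det
  rw [h1, Matrix.det_succ_column_zero, Fin.sum_univ_succ, Finset.sum_eq_zero, add_zero]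
  · simp only [Fin.val_zero, pow_zero, one_mul]
    have h00 : B 0 0 = 1 := by simp [B, A]
    rw [h00, one_mul]
    congr 1
  · intro j _
    have : B j.succ 0 = 0 := by simp [B, A]
    rw [this]; simp

/-- Partial sums of a function. -/
def partialSum (f : ℕ → ℝ) (s : ℕ) : ℝ := ∑ p ∈ Finset.range s, f p

/-- Summation of a Slater determinant over interlacing positions. -/
theorem sum_interlace_det {n : ℕ} (f : Fin n → ℕ → ℝ) {y : Fin (n + 1) → ℕ} (hy : Monotone y) :
    ∑ r ∈ Fintype.piFinset (fun j : Fin n => Finset.Ico (y j.castSucc) (y j.succ)),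
        slater f (Finset.univ.image r) =
      Matrix.det (Matrix.of fun (j : Fin (n + 1)) =>
        (Fin.cons (1 : ℝ) (fun i => partialSum (f i) (y j)) : Fin (n + 1) → ℝ)) := by
  rw [← det_sub_eq_det_cons (fun p i => partialSum (f i) p) y]
  have h1 : ∀ r ∈ Fintype.piFinset (fun j : Fin n => Finset.Ico (y j.castSucc) (y j.succ)),
      slater f (Finset.univ.image r) = Matrix.det (Matrix.of fun j i => f i (r j)) := by
    intro r hr
    refine slater_image f (strictMono_of_mem_piFinset hy ?_)
    simpa only [Fintype.mem_piFinset, Finset.mem_Ico] using hr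
  rw [Finset.sum_congr rfl h1]
  have h2 := MultilinearMap.map_sum_finset
    (Matrix.detRowAlternating (R := ℝ) (n := Fin n)).toMultilinearMap
    (fun (_ : Fin n) (p : ℕ) => (fun i => f i p : Fin n → ℝ))
    (fun j : Fin n => Finset.Ico (y j.castSucc) (y j.succ))
  refine h2.symm.trans ?_
  change Matrix.det _ = _
  congr 1
  ext j i
  simp only [Finset.sum_apply, Matrix.of_apply, partialSum]
  rw [Finset.sum_Ico_eq_sub _ (hy (Fin.castSucc_lt_succ).le)]

/-- Expansion of a determinant over the possible jumps of the particles. -/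
theorem sum_powerset_det {n : ℕ} (W : ℝ) (g : ℕ → Fin n → ℝ) {s : Fin n → ℕ} (hs : StrictMono s) :
    ∑ B ∈ (Finset.univ.image s).powerset,
        W ^ B.card * Matrix.det (Matrix.of fun j => g (shiftPos s B j)) =
      Matrix.det (Matrix.of fun j => g (s j) + W • g (s j + 1)) := by
  have h := MultilinearMap.map_add_univ
    (Matrix.detRowAlternating (R := ℝ) (n := Fin n)).toMultilinearMap
    (fun j => W • g (s j + 1)) (fun j => g (s j))
  have h' : Matrix.det (Matrix.of fun j => g (s j) + W • g (s j + 1)) =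
    ∑ σ : Finset (Fin n), Matrix.det (Matrix.of
      (σ.piecewise (fun j => W • g (s j + 1)) (fun j => g (s j)))) := by
    refine Eq.trans ?_ h
    change Matrix.det _ = Matrix.det _
    congr 1
    ext j i
    simp [add_comm]
  rw [h']
  symm
  refine Finset.sum_bij (fun σ _ => σ.image s) ?_ ?_ ?_ ?_
  · intro σ _
    exact Finset.mem_powerset.2 (Finset.image_subset_image (Finset.subset_univ _))
  · intro σ _ τ _ hστ
    exact Finset.image_injective hs.injective hστ
  · intro B hB
    obtain ⟨σ, -, rfl⟩ := Finset.subset_image_iff.1 (Finset.mem_powerset.1 hB)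
    exact ⟨σ, Finset.mem_univ _, rfl⟩
  · intro σ _
    have h3 := MultilinearMap.map_piecewise_smul
      (Matrix.detRowAlternating (R := ℝ) (n := Fin n)).toMultilinearMap (fun _ => W)
      (fun j => g (shiftPos s (σ.image s) j)) σ
    rw [Finset.card_image_of_injective _ hs.injective]
    rw [Finset.prod_const, smul_eq_mul] at h3
    refine Eq.trans ?_ h3
    change Matrix.det _ = Matrix.det _
    congr 1
    ext j i
    by_cases hj : j ∈ σ
    · have : s j ∈ σ.image s := Finset.mem_image_of_mem _ hj
      simp only [Matrix.of_apply, Finset.piecewise_eq_of_mem _ _ _ hj, shiftPos, if_pos this]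
    · have : s j ∉ σ.image s := by
        rw [Finset.mem_image]
        rintro ⟨k, hk, hkj⟩
        exact hj (hs.injective hkj ▸ hk)
      simp only [Matrix.of_apply, Finset.piecewise_eq_of_notMem _ _ _ hj, shiftPos, if_neg this,
        add_zero]

/-- The functions by which a step of the transfer operator extends a Slater determinant. -/
noncomputable def stepFun {n : ℕ} (b : ℝ) (f : Fin n → ℕ → ℝ) : Fin (n + 1) → ℕ → ℝ :=
  Fin.cons (fun _ => 1)
    (fun i s => (1 - b) * partialSum (f i) s + b * partialSum (f i) (s + 1))

/-- One step of the transfer operator sends Slater determinants to Slater determinants. The lower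
rows compatible with given jumps of the upper row are the sets interlacing with the shifted
positions, and the sum over those telescopes; the sum over the jumps is an expansion of the
determinant along its rows. -/
theorem sum_rowKernel_mul_slater {M n : ℕ} {b : ℝ} (hb : b ≠ 1) (f : Fin n → ℕ → ℝ) {S : Finset ℕ}
    (hS : S ⊆ Finset.range M) :
    (1 - b) ^ (n + 1) *
      ∑ S' ∈ (Finset.range M).powerset, rowKernel M (b / (1 - b)) S' S * slater f S' =
      slater (stepFun b f) S := by
  have hb' : 1 - b ≠ 0 := sub_ne_zero.2 (Ne.symm hb)
  obtain ⟨m, hm⟩ : ∃ m, S.card = m := ⟨_, rfl⟩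
  have hs : StrictMono (fun j => (S.orderEmbOfFin hm j : ℕ)) := (S.orderEmbOfFin hm).strictMono
  have him : Finset.univ.image (fun j => (S.orderEmbOfFin hm j : ℕ)) = S :=
    Finset.image_orderEmbOfFin_univ S hm
  generalize (fun j => (S.orderEmbOfFin hm j : ℕ)) = s at hs him
  have hsM : ∀ j, s j < M := fun j => Finset.mem_range.1 (hS (by
    rw [← him]; exact Finset.mem_image_of_mem _ (Finset.mem_univ j)))
  set W := b / (1 - b) with hW
  by_cases hmn : m = n + 1
  · subst hmn
    have h1 : ∑ S' ∈ (Finset.range M).powerset, rowKernel M W S' S * slater f S' =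
        ∑ B ∈ S.powerset, W ^ B.card *
          ∑ x ∈ ((Finset.range M).powerset ×ˢ (Finset.range M).powerset).filter
            (fun x => RowCompat M x.1 S x.2 B), slater f x.1 := by
      simp only [rowKernel, Finset.sum_filter, Finset.sum_product, Finset.sum_mul, Finset.mul_sum]
      rw [Finset.sum_congr rfl (fun S' _ => Finset.sum_comm), Finset.sum_comm]
      refine Finset.sum_congr rfl fun B _ => Finset.sum_congr rfl fun S' _ =>
        Finset.sum_congr rfl fun C _ => ?_
      split_ifs <;> simp
    rw [h1]
    have h2 : ∀ B ∈ S.powerset, W ^ B.card *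
          ∑ x ∈ ((Finset.range M).powerset ×ˢ (Finset.range M).powerset).filter
            (fun x => RowCompat M x.1 S x.2 B), slater f x.1 =
        W ^ B.card * Matrix.det (Matrix.of fun j =>
          (fun p => (Fin.cons (1 : ℝ) (fun i => partialSum (f i) p) : Fin (n + 1) → ℝ))
            (shiftPos s B j)) := by
      intro B hB
      have h3 := sum_rowCompat hs hsM (B := B) (by rw [him]; exact Finset.mem_powerset.1 hB)
        (slater f)
      rw [him] at h3
      rw [h3, sum_interlace_det f (shiftPos_monotone hs B)]
    rw [Finset.sum_congr rfl h2, ← him,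
      sum_powerset_det W (fun p => (Fin.cons (1 : ℝ) (fun i => partialSum (f i) p) :
        Fin (n + 1) → ℝ)) hs, slater_image _ hs]
    have h4 := Matrix.det_smul (Matrix.of fun j =>
      (Fin.cons (1 : ℝ) (fun i => partialSum (f i) (s j)) : Fin (n + 1) → ℝ) +
        W • (Fin.cons (1 : ℝ) (fun i => partialSum (f i) (s j + 1)) : Fin (n + 1) → ℝ)) (1 - b)
    rw [Fintype.card_fin] at h4
    rw [← h4]
    congr 1
    ext j i
    refine Fin.cases ?_ (fun i => ?_) i
    · simp only [Matrix.smul_apply, Matrix.of_apply, Pi.add_apply, Fin.cons_zero, Pi.smul_apply,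
        smul_eq_mul, stepFun, hW]
      field_simp
      ring
    · simp only [Matrix.smul_apply, Matrix.of_apply, Pi.add_apply, Fin.cons_succ, Pi.smul_apply,
        smul_eq_mul, stepFun, hW]
      field_simp
  · rw [slater_of_card_ne _ (by rw [hm]; exact hmn), Finset.sum_eq_zero, mul_zero]
    intro S' hS'
    by_cases hc : S'.card = n
    · rw [rowKernel, Finset.filter_false_of_mem, Finset.sum_empty, zero_mul]
      rintro ⟨C, B⟩ - h
      rw [← him] at h
      have := h.card_eq_card_add_one hs hsM (Finset.mem_powerset.1 hS')
      omega
    · rw [slater_of_card_ne _ hc, mul_zero]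

/-! ### Polynomials in the binomial basis -/

/-- The function `s ↦ ∑ i, p_i * (s choose i)` attached to the polynomial `p = ∑ i, p_i X ^ i`. -/
noncomputable def newtonEval : Polynomial ℝ →ₗ[ℝ] (ℕ → ℝ) where
  toFun p s := ∑ i ∈ Finset.range (s + 1), p.coeff i * (s.choose i : ℝ)
  map_add' p q := by
    ext s
    simp only [Polynomial.coeff_add, add_mul, Finset.sum_add_distrib, Pi.add_apply]
  map_smul' c p := by
    ext s
    simp only [Polynomial.coeff_smul, smul_eq_mul, mul_assoc, Finset.mul_sum, Pi.smul_apply,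
      RingHom.id_apply]

theorem newtonEval_apply (p : Polynomial ℝ) (s : ℕ) :
    newtonEval p s = ∑ i ∈ Finset.range (s + 1), p.coeff i * (s.choose i : ℝ) := rfl

theorem newtonEval_eq_sum {p : Polynomial ℝ} {s n : ℕ} (h : s < n) :
    newtonEval p s = ∑ i ∈ Finset.range n, p.coeff i * (s.choose i : ℝ) := by
  rw [newtonEval_apply]
  refine Finset.sum_subset (by intro x; simp only [Finset.mem_range]; omega) ?_
  intro i _ hi
  rw [Finset.mem_range] at hi
  rw [Nat.choose_eq_zero_of_lt (by omega)]
  simp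

theorem newtonEval_X_pow (i s : ℕ) : newtonEval (Polynomial.X ^ i) s = (s.choose i : ℝ) := by
  rw [newtonEval_eq_sum (n := s + i + 1) (by omega)]
  simp only [Polynomial.coeff_X_pow]
  rw [Finset.sum_eq_single i]
  · simp
  · intro j _ hj; simp [hj]
  · intro h; simp at h

theorem newtonEval_one (s : ℕ) : newtonEval 1 s = 1 := by
  have := newtonEval_X_pow 0 s
  simpa using this

/-- The backward shift of coefficients, as a linear map; in the binomial basis it is the forward
difference operator. -/
noncomputable def coeffShift : Module.End ℝ (Polynomial ℝ) where
  toFun := Polynomial.divX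
  map_add' _ _ := Polynomial.divX_add
  map_smul' c p := by
    ext n
    simp [Polynomial.coeff_divX]

@[simp] theorem coeff_coeffShift (p : Polynomial ℝ) (n : ℕ) :
    (coeffShift p).coeff n = p.coeff (n + 1) := Polynomial.coeff_divX

theorem newtonEval_succ (p : Polynomial ℝ) (s : ℕ) :
    newtonEval p (s + 1) = newtonEval p s + newtonEval (coeffShift p) s := by
  rw [newtonEval_apply p, Finset.sum_range_succ', newtonEval_eq_sum (n := s + 1 + 1) (by omega),
    Finset.sum_range_succ' _ (s + 1), newtonEval_apply]
  simp only [coeff_coeffShift, Nat.choose_succ_succ, Nat.cast_add, mul_add,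
    Finset.sum_add_distrib, Nat.choose_zero_right]
  ring

theorem newtonEval_zero (p : Polynomial ℝ) : newtonEval p 0 = p.coeff 0 := by
  simp [newtonEval_apply]

theorem coeffShift_X_mul (p : Polynomial ℝ) : coeffShift (Polynomial.X * p) = p := by
  ext n; simp

theorem partialSum_newtonEval (p : Polynomial ℝ) :
    partialSum (newtonEval p) = newtonEval (Polynomial.X * p) := by
  ext s
  induction s with
  | zero => simp [partialSum, newtonEval_zero]
  | succ s ih =>
    rw [newtonEval_succ, coeffShift_X_mul, ← ih, partialSum, Finset.sum_range_succ, partialSum]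

/-- Multiplication of a function by its variable, in the binomial basis. -/
noncomputable def mulVar : Module.End ℝ (Polynomial ℝ) :=
  LinearMap.mulLeft ℝ Polynomial.X ∘ₗ Polynomial.derivative ∘ₗ
    LinearMap.mulLeft ℝ (Polynomial.X + 1)

theorem mulVar_X_pow (i : ℕ) :
    mulVar (Polynomial.X ^ i) = ((i : ℝ) + 1) • Polynomial.X ^ (i + 1) +
      (i : ℝ) • Polynomial.X ^ i := by
  have : mulVar (Polynomial.X ^ i) =
      Polynomial.X * Polynomial.derivative ((Polynomial.X + 1) * Polynomial.X ^ i) := rfl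
  rw [this, add_mul, one_mul, ← pow_succ', Polynomial.derivative_add,
    Polynomial.derivative_X_pow, Polynomial.derivative_X_pow]
  rw [Polynomial.smul_eq_C_mul, Polynomial.smul_eq_C_mul]
  rcases i with _ | i
  · simp
  · simp only [Nat.add_sub_cancel, Nat.cast_add, Nat.cast_one]
    ring

theorem Polynomial.linearMap_ext_X_pow {V : Type*} [AddCommMonoid V] [Module ℝ V]
    {f g : Polynomial ℝ →ₗ[ℝ] V} (h : ∀ i, f (Polynomial.X ^ i) = g (Polynomial.X ^ i)) : f = g := by
  refine Polynomial.lhom_ext' fun i => LinearMap.ext_ring ?_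
  simpa [Polynomial.monomial_one_right_eq_X_pow] using h i

theorem newtonEval_mulVar (p : Polynomial ℝ) (s : ℕ) :
    newtonEval (mulVar p) s = s * newtonEval p s := by
  have : (LinearMap.proj s ∘ₗ newtonEval ∘ₗ mulVar : Polynomial ℝ →ₗ[ℝ] ℝ) =
      (s : ℝ) • (LinearMap.proj s ∘ₗ newtonEval) := by
    refine Polynomial.linearMap_ext_X_pow fun i => ?_
    simp only [LinearMap.comp_apply, LinearMap.smul_apply, mulVar_X_pow, map_add, map_smul,
      LinearMap.proj_apply, smul_eq_mul, newtonEval_X_pow]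
    have h := Nat.add_one_mul_choose_eq s i
    have h' : (s.succ : ℝ) * (s.choose i : ℝ) = ((s + 1).choose (i + 1) : ℝ) * ((i : ℝ) + 1) := by
      exact_mod_cast h
    rw [Nat.choose_succ_succ] at h'
    push_cast at h'
    linarith
  exact LinearMap.congr_fun this p

theorem newtonEval_mulVar_pow (k : ℕ) (p : Polynomial ℝ) (s : ℕ) :
    newtonEval ((mulVar ^ k) p) s = s ^ k * newtonEval p s := by
  induction k with
  | zero => simp
  | succ k ih =>
    rw [pow_succ', Module.End.mul_apply, newtonEval_mulVar, ih]
    ring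

/-! ### Determinants of coefficients -/

/-- The polynomials by which a step of the transfer operator extends a Slater determinant. -/
noncomputable def stepPoly {n : ℕ} (b : ℝ) (f : Fin n → Polynomial ℝ) :
    Fin (n + 1) → Polynomial ℝ :=
  Fin.cons 1 (fun i => (Polynomial.X + Polynomial.C b) * f i)

theorem stepFun_newtonEval {n : ℕ} (b : ℝ) (f : Fin n → Polynomial ℝ) :
    stepFun b (fun i => newtonEval (f i)) = fun i => newtonEval (stepPoly b f i) := by
  ext i s
  refine Fin.cases ?_ (fun i => ?_) i
  · simp [stepFun, stepPoly, newtonEval_one]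
  · simp only [stepFun, stepPoly, Fin.cons_succ, partialSum_newtonEval, newtonEval_succ,
      coeffShift_X_mul, add_mul, map_add, Pi.add_apply]
    rw [← Polynomial.smul_eq_C_mul, map_smul, Pi.smul_apply, smul_eq_mul]
    ring

/-- The determinant of the lowest coefficients of a family of polynomials. -/
noncomputable def coeffDet {n : ℕ} (f : Fin n → Polynomial ℝ) : ℝ :=
  Matrix.det (Matrix.of fun i j : Fin n => (f i).coeff j)

theorem coeffDet_cons_one {n : ℕ} (f : Fin n → Polynomial ℝ) :
    coeffDet (Fin.cons 1 f : Fin (n + 1) → Polynomial ℝ) = coeffDet (fun i => coeffShift (f i)) := by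
  rw [coeffDet, Matrix.det_succ_row_zero, Fin.sum_univ_succ, Finset.sum_eq_zero, add_zero]
  · simp only [Matrix.of_apply, Fin.cons_zero, Fin.val_zero, Polynomial.coeff_one_zero, pow_zero,
      one_mul]
    rw [coeffDet]
    congr 1
    ext i j
    simp [Matrix.submatrix]
  · intro j _
    simp [Polynomial.coeff_one]

/-- On the fully packed row the Slater determinant is the determinant of the coefficients, because
the matrix of binomial coefficients is unitriangular. -/
theorem slater_range {M : ℕ} (f : Fin M → Polynomial ℝ) :
    slater (fun i => newtonEval (f i)) (Finset.range M) = coeffDet f := by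
  have hs : StrictMono (fun j : Fin M => (j : ℕ)) := fun i j h => h
  have him : Finset.univ.image (fun j : Fin M => (j : ℕ)) = Finset.range M := by
    ext x
    simp only [Finset.mem_image, Finset.mem_univ, true_and, Finset.mem_range]
    exact ⟨fun ⟨a, h⟩ => h ▸ a.2, fun h => ⟨⟨x, h⟩, rfl⟩⟩
  rw [← him, slater_image _ hs]
  let P : Matrix (Fin M) (Fin M) ℝ := Matrix.of fun s j => ((s : ℕ).choose j : ℝ)
  have h1 : (Matrix.of fun (j i : Fin M) => newtonEval (f i) j) =
      P * (Matrix.of fun i j : Fin M => (f i).coeff j).transpose := by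
    ext s i
    rw [Matrix.mul_apply, Matrix.of_apply, newtonEval_eq_sum s.2, Finset.sum_range]
    refine Finset.sum_congr rfl fun j _ => ?_
    simp only [P, Matrix.of_apply, Matrix.transpose_apply]
    ring
  have h2 : P.det = 1 := by
    rw [Matrix.det_of_isLowerTriangular]
    · refine Finset.prod_eq_one fun i _ => ?_
      simp [P]
    · intro i j hij
      have : (i : ℕ) < j := hij
      simp [P, Nat.choose_eq_zero_of_lt this]
  rw [h1, Matrix.det_mul, h2, one_mul, Matrix.det_transpose]
  rfl

/-- A family of polynomials whose `i`-th member is monic of degree `i`. -/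
def IsUnitri {n : ℕ} (f : Fin n → Polynomial ℝ) : Prop :=
  ∀ i : Fin n, (f i).coeff i = 1 ∧ ∀ j : ℕ, (i : ℕ) < j → (f i).coeff j = 0

theorem IsUnitri.stepPoly {n : ℕ} {f : Fin n → Polynomial ℝ} (hf : IsUnitri f) (b : ℝ) :
    IsUnitri (stepPoly b f) := by
  intro i
  refine Fin.cases ?_ (fun i => ?_) i
  · refine ⟨by simp [_root_.stepPoly], fun j hj => ?_⟩
    have : j ≠ 0 := by simp at hj; omega
    simp [_root_.stepPoly, Polynomial.coeff_one, this]
  · obtain ⟨h1, h2⟩ := hf i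
    simp only [_root_.stepPoly, Fin.cons_succ, add_mul, Polynomial.coeff_add, Fin.val_succ,
      Polynomial.coeff_X_mul, Polynomial.coeff_C_mul]
    refine ⟨by rw [h1, h2 _ (Nat.lt_succ_self _)]; simp, fun j hj => ?_⟩
    cases j with
    | zero => omega
    | succ j => rw [Polynomial.coeff_X_mul, h2 _ (by omega), h2 _ (by omega)]; simp

/-- The operator `1 + b Δ`, where `Δ` is the backward shift of coefficients. -/
noncomputable def tauOp (b : ℝ) : Module.End ℝ (Polynomial ℝ) := 1 + b • coeffShift

theorem tauOp_apply (b : ℝ) (p : Polynomial ℝ) : tauOp b p = p + b • coeffShift p := rfl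

theorem IsUnitri.tauOp {n : ℕ} {f : Fin n → Polynomial ℝ} (hf : IsUnitri f) (b : ℝ) :
    IsUnitri (fun i => tauOp b (f i)) := by
  intro i
  obtain ⟨h1, h2⟩ := hf i
  simp only [tauOp_apply, Polynomial.coeff_add, Polynomial.coeff_smul, coeff_coeffShift]
  exact ⟨by rw [h1, h2 _ (Nat.lt_succ_self _)]; simp,
    fun j hj => by rw [h2 _ hj, h2 _ (by omega)]; simp⟩

theorem coeffShift_one : coeffShift 1 = 0 := by
  ext n; simp [Polynomial.coeff_one]

theorem coeffShift_stepPoly {b : ℝ} (p : Polynomial ℝ) :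
    coeffShift ((Polynomial.X + Polynomial.C b) * p) = tauOp b p := by
  ext n
  simp [tauOp_apply, add_mul]

/-- The product of the operators `1 + b t Δ` over `N ≤ t < N + r`. -/
noncomputable def tauProd (b : ℕ → ℝ) (N : ℕ) : ℕ → Module.End ℝ (Polynomial ℝ)
  | 0 => 1
  | r + 1 => tauProd b N r * tauOp (b (N + r))

theorem tauOp_commute (b : ℝ) : Commute (tauOp b) coeffShift := by
  unfold tauOp
  exact (Commute.one_left _).add_left ((Commute.refl _).smul_left b)

theorem tauProd_commute (b : ℕ → ℝ) (N r : ℕ) : Commute (tauProd b N r) coeffShift := by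
  induction r with
  | zero => exact Commute.one_left _
  | succ r ih => exact ih.mul_left (tauOp_commute _)

theorem IsUnitri.tauProd {n : ℕ} (b : ℕ → ℝ) (N r : ℕ) {f : Fin n → Polynomial ℝ}
    (hf : IsUnitri f) : IsUnitri (fun i => tauProd b N r (f i)) := by
  induction r generalizing f with
  | zero => exact hf
  | succ r ih => exact ih (hf.tauOp (b (N + r)))

/-- Inside a determinant of lowest coefficients, a step of the transfer operator amounts to applying
`1 + b Δ`: expanding along the new row `1` deletes the constant coefficients, which is the shift `Δ`,
and `Δ ((X + b) p) = (1 + b Δ) p`. -/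
theorem coeffDet_commute_stepPoly {n : ℕ} {Q : Module.End ℝ (Polynomial ℝ)}
    (hQ : Commute Q coeffShift) (hQ1 : Q 1 = 1) (b : ℝ) (f : Fin n → Polynomial ℝ) :
    coeffDet (fun i => Q (stepPoly b f i)) = coeffDet (fun i => (Q * tauOp b) (f i)) := by
  have : (fun i => Q (stepPoly b f i)) =
      Fin.cons 1 (fun i => Q ((Polynomial.X + Polynomial.C b) * f i)) := by
    ext1 i
    refine Fin.cases ?_ (fun i => ?_) i
    · simp [stepPoly, hQ1]
    · simp [stepPoly]
  rw [this, coeffDet_cons_one]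
  congr 1
  ext1 i
  have := LinearMap.congr_fun hQ.eq ((Polynomial.X + Polynomial.C b) * f i)
  simp only [Module.End.mul_apply] at this ⊢
  rw [← this, coeffShift_stepPoly]

/-- A unitriangular family may be replaced by the monomials. -/
theorem IsUnitri.coeffDet_comp {n : ℕ} {e : Fin n → Polynomial ℝ} (he : IsUnitri e)
    (T : Module.End ℝ (Polynomial ℝ)) :
    coeffDet (fun i => T (e i)) =
      Matrix.det (Matrix.of fun i j : Fin n => (T (Polynomial.X ^ (i : ℕ))).coeff j) := by
  let U : Matrix (Fin n) (Fin n) ℝ := Matrix.of fun i m => (e i).coeff m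
  have hU : U.det = 1 := by
    rw [Matrix.det_of_isLowerTriangular]
    · exact Finset.prod_eq_one fun i _ => (he i).1
    · intro i j hij
      exact (he i).2 j hij
  have h1 : (Matrix.of fun i j : Fin n => (T (e i)).coeff j) =
      U * (Matrix.of fun i j : Fin n => (T (Polynomial.X ^ (i : ℕ))).coeff j) := by
    ext i j
    have : e i = ∑ m : Fin n, (e i).coeff m • Polynomial.X ^ (m : ℕ) := by
      rw [← Finset.sum_range (fun m => (e i).coeff m • (Polynomial.X : Polynomial ℝ) ^ m)]
      ext m
      rw [Polynomial.finsetSum_coeff]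
      simp only [Polynomial.coeff_smul, Polynomial.coeff_X_pow, smul_eq_mul, mul_ite, mul_one,
        mul_zero, Finset.sum_ite_eq, Finset.mem_range]
      split_ifs with h
      · rfl
      · exact (he i).2 m (by omega)
    rw [Matrix.of_apply, Matrix.mul_apply]
    conv_lhs => rw [this]
    simp only [map_sum, map_smul, Polynomial.finsetSum_coeff, Polynomial.coeff_smul, smul_eq_mul,
      U, Matrix.of_apply]
  rw [coeffDet, h1, Matrix.det_mul, hU, one_mul]

/-! ### The conjugated multiplication operator -/

/-- The coefficients of the power series `b (1 + y) / (1 + b y)`. -/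
noncomputable def jumpCoeff (b : ℝ) : ℕ → ℝ
  | 0 => b
  | m + 1 => b * (1 - b) * (-b) ^ m

/-- The operator `b (1 + Δ) / (1 + b Δ)`, where `Δ` is the backward shift of coefficients,
given by its values on the monomials. -/
noncomputable def jumpOp (b : ℝ) : Module.End ℝ (Polynomial ℝ) :=
  (Polynomial.basisMonomials ℝ).constr ℝ
    (fun i => ∑ j ∈ Finset.range (i + 1), jumpCoeff b (i - j) • Polynomial.X ^ j)

theorem jumpOp_X_pow (b : ℝ) (i : ℕ) : jumpOp b (Polynomial.X ^ i) =
    ∑ j ∈ Finset.range (i + 1), jumpCoeff b (i - j) • Polynomial.X ^ j := by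
  have := (Polynomial.basisMonomials ℝ).constr_basis ℝ
    (fun i => ∑ j ∈ Finset.range (i + 1),
      jumpCoeff b (i - j) • (Polynomial.X : Polynomial ℝ) ^ j) i
  rw [Polynomial.coe_basisMonomials] at this
  simp only [Polynomial.monomial_one_right_eq_X_pow] at this
  exact this

theorem coeff_jumpOp_X_pow (b : ℝ) (i j : ℕ) : (jumpOp b (Polynomial.X ^ i)).coeff j =
    if j ≤ i then jumpCoeff b (i - j) else 0 := by
  rw [jumpOp_X_pow, Polynomial.finsetSum_coeff]
  simp only [Polynomial.coeff_smul, Polynomial.coeff_X_pow, smul_eq_mul, mul_ite, mul_one,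
    mul_zero, Finset.sum_ite_eq, Finset.mem_range, Nat.lt_succ_iff]

theorem coeffShift_X_pow_succ (i : ℕ) :
    coeffShift (Polynomial.X ^ (i + 1)) = (Polynomial.X : Polynomial ℝ) ^ i := by
  rw [pow_succ', coeffShift_X_mul]

theorem jumpOp_commute (b : ℝ) : Commute (jumpOp b) coeffShift := by
  refine Polynomial.linearMap_ext_X_pow fun i => ?_
  ext j
  simp only [Module.End.mul_apply, coeff_coeffShift, coeff_jumpOp_X_pow]
  cases i with
  | zero => simp [coeffShift_one]
  | succ i =>
    rw [coeffShift_X_pow_succ, coeff_jumpOp_X_pow]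
    simp

theorem jumpOp_mul_tauOp (b : ℝ) : jumpOp b * tauOp b = b • (1 + coeffShift) := by
  refine Polynomial.linearMap_ext_X_pow fun i => ?_
  ext j
  simp only [Module.End.mul_apply, tauOp_apply, LinearMap.smul_apply, LinearMap.add_apply,
    Module.End.one_apply, map_add, map_smul, Polynomial.coeff_add, Polynomial.coeff_smul,
    smul_eq_mul, coeff_jumpOp_X_pow]
  cases i with
  | zero =>
    simp only [pow_zero, coeffShift_one, map_zero, Polynomial.coeff_zero, Polynomial.coeff_one]
    by_cases hj : j = 0 <;> simp [hj, jumpCoeff]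
  | succ i =>
    simp only [coeffShift_X_pow_succ, coeff_jumpOp_X_pow, Polynomial.coeff_X_pow]
    rcases lt_trichotomy j (i + 1) with h | h | h
    · rw [if_pos h.le, if_pos (Nat.lt_succ_iff.1 h), if_neg h.ne]
      obtain ⟨m, rfl⟩ := Nat.exists_eq_add_of_le (Nat.lt_succ_iff.1 h)
      rw [show j + m + 1 - j = m + 1 by omega, show j + m - j = m by omega]
      cases m with
      | zero => simp [jumpCoeff]; ring
      | succ m => simp [jumpCoeff, pow_succ]; ring
    · subst h
      simp [jumpCoeff]
    · rw [if_neg (by omega), if_neg (by omega), if_neg (by omega), if_neg (by omega)]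
      simp

/-- The product rule for the difference operator, `Δ (s f) = s Δ f + (1 + Δ) f`. -/
theorem coeffShift_mul_mulVar :
    coeffShift * mulVar = mulVar * coeffShift + (1 + coeffShift) := by
  refine Polynomial.linearMap_ext_X_pow fun i => ?_
  simp only [Module.End.mul_apply, LinearMap.add_apply, Module.End.one_apply, mulVar_X_pow,
    map_add, map_smul]
  cases i with
  | zero =>
    simp only [pow_zero, coeffShift_one, map_zero, Nat.cast_zero, coeffShift_X_pow_succ]
    simp
  | succ i =>
    simp only [coeffShift_X_pow_succ, mulVar_X_pow, Nat.cast_add, Nat.cast_one]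
    module

/-- Conjugation by `1 + b Δ` adds `b (1 + Δ) / (1 + b Δ)` to the multiplication by the variable. -/
theorem tauOp_mul_mulVar (b : ℝ) : tauOp b * mulVar = (mulVar + jumpOp b) * tauOp b := by
  rw [add_mul, jumpOp_mul_tauOp, tauOp, add_mul, mul_add, one_mul, mul_one, smul_mul_assoc,
    coeffShift_mul_mulVar, mul_smul_comm, smul_add, ← add_assoc]

/-- Multiplication by the variable, conjugated by the operators `1 + b t Δ`, `N ≤ t < N + r`. -/
noncomputable def conjVar (b : ℕ → ℝ) (N r : ℕ) : Module.End ℝ (Polynomial ℝ) :=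
  mulVar + ∑ t ∈ Finset.range r, jumpOp (b (N + t))

theorem commute_tauOp {Q : Module.End ℝ (Polynomial ℝ)} (hQ : Commute Q coeffShift) (b : ℝ) :
    Commute Q (tauOp b) := by
  unfold tauOp
  exact (Commute.one_right _).add_right (hQ.smul_right b)

theorem jumpOp_commute_tauProd (c : ℝ) (b : ℕ → ℝ) (N r : ℕ) :
    Commute (jumpOp c) (tauProd b N r) := by
  induction r with
  | zero => exact Commute.one_right _
  | succ r ih => exact ih.mul_right (commute_tauOp (jumpOp_commute c) _)

theorem tauProd_mul_mulVar (b : ℕ → ℝ) (N r : ℕ) :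
    tauProd b N r * mulVar = conjVar b N r * tauProd b N r := by
  induction r with
  | zero => simp [tauProd, conjVar]
  | succ r ih =>
    rw [tauProd, mul_assoc, tauOp_mul_mulVar, ← mul_assoc, mul_add, ih,
      ← (jumpOp_commute_tauProd _ b N r).eq, ← add_mul, mul_assoc]
    congr 1
    rw [conjVar, conjVar, Finset.sum_range_succ, add_assoc]

theorem tauProd_mul_mulVar_pow (b : ℕ → ℝ) (N r k : ℕ) :
    tauProd b N r * mulVar ^ k = conjVar b N r ^ k * tauProd b N r := by
  induction k with
  | zero => simp
  | succ k ih => rw [pow_succ, ← mul_assoc, ih, mul_assoc, tauProd_mul_mulVar, ← mul_assoc,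
      ← pow_succ]

/-- The matrix of `conjVar b N r ^ k` on the span of `1, X, …, X ^ (n - 1)`, with rows and columns
interchanged. -/
noncomputable def momentMatrix (b : ℕ → ℝ) (N r k n : ℕ) : Matrix (Fin n) (Fin n) ℝ :=
  Matrix.of fun i j => ((conjVar b N r ^ k) (Polynomial.X ^ (i : ℕ))).coeff j

/-! ### The partition function as a determinant -/

/-- The partition function of the part of the diamond below the `n`-th row of black cells, as a
function of the set of occupied positions in that row; `W t` is the weight of the dominoes pointing
south from row `t + 1`, and every particle at `p` in row `t` contributes an additional
factor `h t p`. -/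
noncomputable def rowPartition (M : ℕ) (W : ℕ → ℝ) (h : ℕ → ℕ → ℝ) : ℕ → Finset ℕ → ℝ
  | 0, S => if S = ∅ then 1 else 0
  | n + 1, S => (∏ p ∈ S, h (n + 1) p) *
      ∑ S' ∈ (Finset.range M).powerset, rowPartition M W h n S' * rowKernel M (W n) S' S

theorem slater_mul {n : ℕ} (f : Fin n → ℕ → ℝ) (h : ℕ → ℝ) (S : Finset ℕ) :
    slater (fun i s => h s * f i s) S = (∏ p ∈ S, h p) * slater f S := by
  unfold slater
  split_ifs with hS
  · have := Matrix.det_mul_column (fun j => h (S.orderEmbOfFin hS j))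
      (Matrix.of fun j i => f i (S.orderEmbOfFin hS j))
    refine Eq.trans ?_ (this.trans ?_)
    · rfl
    · congr 1
      have him : Finset.univ.image (fun j => (S.orderEmbOfFin hS j : ℕ)) = S :=
        Finset.image_orderEmbOfFin_univ S hS
      conv_rhs => rw [← him]
      rw [Finset.prod_image]
      intro i _ j _ hij
      exact (S.orderEmbOfFin hS).injective hij
  · simp

/-- The factor relating the weights `b / (1 - b)` and `1` to the weights `b` and `1 - b`, one for
each of the `t + 1` particles of row `t + 1`. -/
noncomputable def normFactor (b : ℕ → ℝ) (n : ℕ) : ℝ := ∏ t ∈ Finset.range n, (1 - b t) ^ (t + 1)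

/-- The normalized partition function below row `n` is the Slater determinant of the functions with
Newton coefficients `f`. -/
def IsSlater (M : ℕ) (b : ℕ → ℝ) (h : ℕ → ℕ → ℝ) (n : ℕ) (f : Fin n → Polynomial ℝ) : Prop :=
  ∀ S ⊆ Finset.range M, normFactor b n * rowPartition M (fun t => b t / (1 - b t)) h n S =
    slater (fun i => newtonEval (f i)) S

theorem isSlater_zero (M : ℕ) (b : ℕ → ℝ) (h : ℕ → ℕ → ℝ) (f : Fin 0 → Polynomial ℝ) :
    IsSlater M b h 0 f := by
  intro S _
  simp only [normFactor, Finset.range_zero, Finset.prod_empty, one_mul, rowPartition, slater,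
    Finset.card_eq_zero]
  split_ifs <;> simp

/-- Passing to the next row; `O` is the operator on Newton coefficients that multiplies functions
by the additional weights of the new row. -/
theorem IsSlater.step {M : ℕ} {b : ℕ → ℝ} {h : ℕ → ℕ → ℝ} {n : ℕ} {f : Fin n → Polynomial ℝ}
    (hf : IsSlater M b h n f) (hb : b n ≠ 1) (O : Module.End ℝ (Polynomial ℝ))
    (hO : ∀ p s, newtonEval (O p) s = h (n + 1) s * newtonEval p s) :
    IsSlater M b h (n + 1) (fun i => O (stepPoly (b n) f i)) := by
  intro S hS
  have h1 : (fun i => newtonEval (O (stepPoly (b n) f i))) =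
      fun i s => h (n + 1) s * newtonEval (stepPoly (b n) f i) s := by
    ext i s; exact hO _ _
  rw [h1, slater_mul, ← stepFun_newtonEval, ← sum_rowKernel_mul_slater hb _ hS, rowPartition,
    normFactor, Finset.prod_range_succ, ← normFactor]
  simp only [Finset.mul_sum]
  refine Finset.sum_congr rfl fun S' hS' => ?_
  rw [← hf S' (Finset.mem_powerset.1 hS')]
  ring

/-- The weights `1 + ε p ^ k` of the particles of row `N`; the particles of the other rows have
weight `1`. -/
noncomputable def rowTest (N k : ℕ) (ε : ℝ) (t p : ℕ) : ℝ :=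
  if t = N then 1 + ε * (p : ℝ) ^ k else 1

/-- Below row `N` the weights `rowTest` are trivial, and the family stays unitriangular. -/
theorem exists_isSlater_of_lt {M N k : ℕ} {b : ℕ → ℝ} {ε : ℝ} (hb : ∀ t < M, b t ≠ 1) (n : ℕ)
    (hn : n < N) (hN : N ≤ M) :
    ∃ f : Fin n → Polynomial ℝ, IsUnitri f ∧ IsSlater M b (rowTest N k ε) n f := by
  induction n with
  | zero => exact ⟨Fin.elim0, fun i => i.elim0, isSlater_zero _ _ _ _⟩
  | succ n ih =>
    obtain ⟨f, hf1, hf2⟩ := ih (by omega)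
    refine ⟨_, hf1.stepPoly (b n), hf2.step (hb n (by omega)) 1 ?_⟩
    intro p s
    simp [rowTest, hn.ne]

/-- Above row `N` only determinants of lowest coefficients matter, and in those the steps of the
transfer operator act as the product `tauProd b N r`. The auxiliary operator `Q` collects the steps
still to come in the induction. -/
theorem exists_isSlater_of_le {M N k : ℕ} {b : ℕ → ℝ} {ε : ℝ} (hb : ∀ t < M, b t ≠ 1)
    (hN0 : 0 < N) (r : ℕ) (hr : N + r ≤ M) :
    ∃ (f : Fin N → Polynomial ℝ) (F : Fin (N + r) → Polynomial ℝ), IsUnitri f ∧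
      IsSlater M b (rowTest N k ε) (N + r) F ∧
      ∀ Q : Module.End ℝ (Polynomial ℝ), Commute Q coeffShift → Q 1 = 1 →
        coeffDet (fun i => Q (F i)) =
          coeffDet (fun i => (Q * tauProd b N r) ((1 + ε • mulVar ^ k) (f i))) := by
  induction r with
  | zero =>
    obtain ⟨n, rfl⟩ := Nat.exists_eq_succ_of_ne_zero hN0.ne'
    obtain ⟨f, hf1, hf2⟩ := exists_isSlater_of_lt (k := k) (ε := ε) hb n (Nat.lt_succ_self n)
      (by omega)
    refine ⟨_, _, hf1.stepPoly (b n), hf2.step (hb n (by omega)) (1 + ε • mulVar ^ k) ?_, ?_⟩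
    · intro p s
      simp only [LinearMap.add_apply, LinearMap.smul_apply, Module.End.one_apply, map_add, map_smul,
        Pi.add_apply, Pi.smul_apply, newtonEval_mulVar_pow, smul_eq_mul, rowTest, if_true,
        Nat.succ_eq_add_one]
      ring
    · intro Q _ _
      rw [tauProd, mul_one]
  | succ r ih =>
    obtain ⟨f, F, h1, h2, h3⟩ := ih (by omega)
    refine ⟨f, _, h1, h2.step (hb (N + r) (by omega)) 1 ?_, ?_⟩
    · intro p s
      have : ¬ (N + r + 1 = N) := by omega
      simp [rowTest, this]
    · intro Q hQ hQ1
      have h4 := coeffDet_commute_stepPoly hQ hQ1 (b (N + r)) F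
      have h5 := h3 (Q * tauOp (b (N + r))) (hQ.mul_left (tauOp_commute _)) (by
        rw [Module.End.mul_apply, tauOp_apply, coeffShift_one, smul_zero, add_zero, hQ1])
      refine h4.trans (h5.trans ?_)
      rw [tauProd, mul_assoc, (commute_tauOp (tauProd_commute b N r) (b (N + r))).eq]

/-- The generating function of the particle positions of row `N` is a determinant. -/
theorem rowPartition_eq_det {M N k : ℕ} {b : ℕ → ℝ} {ε : ℝ} (hb : ∀ t < M, b t ≠ 1)
    (hN0 : 0 < N) (hN : N ≤ M) :
    normFactor b M *
      rowPartition M (fun t => b t / (1 - b t)) (rowTest N k ε) M (Finset.range M) =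
      Matrix.det (1 + ε • momentMatrix b N (M - N) k N) := by
  obtain ⟨r, rfl⟩ := Nat.exists_eq_add_of_le hN
  obtain ⟨f, F, h1, h2, h3⟩ := exists_isSlater_of_le (k := k) (ε := ε) hb hN0 r le_rfl
  rw [h2 _ subset_rfl, slater_range, Nat.add_sub_cancel_left]
  have h4 := h3 1 (Commute.one_left _) rfl
  refine h4.trans ?_
  have h5 : ∀ i, (1 * tauProd b N r) ((1 + ε • mulVar ^ k) (f i)) =
      (1 + ε • conjVar b N r ^ k) (tauProd b N r (f i)) := by
    intro i
    have := LinearMap.congr_fun (tauProd_mul_mulVar_pow b N r k) (f i)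
    simp only [Module.End.mul_apply] at this
    simp only [one_mul, LinearMap.add_apply, Module.End.one_apply, LinearMap.smul_apply, map_add,
      map_smul, this]
  simp only [h5]
  rw [(h1.tauProd b N r).coeffDet_comp (1 + ε • conjVar b N r ^ k)]
  congr 1
  ext i j
  simp only [Matrix.of_apply, Matrix.add_apply, Matrix.smul_apply, momentMatrix,
    LinearMap.add_apply, LinearMap.smul_apply, Module.End.one_apply, Polynomial.coeff_add,
    Polynomial.coeff_smul, Polynomial.coeff_X_pow, Matrix.one_apply, Fin.ext_iff]
  congr 1
  by_cases h : (i : ℕ) = j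
  · simp [h]
  · simp [h, Ne.symm h]

/-! ### Tilings as sequences of particle configurations -/

/-- The `q`-th white cell from the left, `0 ≤ q ≤ M`, between the rows `t` and `t + 1` of black
cells. -/
def whiteCell (M t q : ℕ) : ℤ × ℤ := ((t : ℤ) + q - M, (t : ℤ) - q)

open DominoTiling

theorem mem_aztecCells {M : ℕ} {c : ℤ × ℤ} :
    c ∈ aztecCells M ↔ |2 * c.1 + 1| + |2 * c.2 + 1| ≤ 2 * (M : ℤ) := by
  unfold aztecCells
  simp only [Finset.mem_filter, Finset.mem_product, Finset.mem_Ico, and_iff_right_iff_imp]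
  intro h
  rcases abs_cases (2 * c.1 + 1) with ⟨h1, h2⟩ | ⟨h1, h2⟩ <;>
  rcases abs_cases (2 * c.2 + 1) with ⟨h3, h4⟩ | ⟨h3, h4⟩ <;> omega

theorem rowCell_mem {M t p : ℕ} : rowCell M t p ∈ aztecCells M ↔ t ≤ M ∧ p < M := by
  rw [mem_aztecCells, rowCell]
  dsimp only
  rcases abs_cases (2 * ((t : ℤ) + p - M) + 1) with ⟨h1, h2⟩ | ⟨h1, h2⟩ <;>
  rcases abs_cases (2 * ((t : ℤ) - p - 1) + 1) with ⟨h3, h4⟩ | ⟨h3, h4⟩ <;> omega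

theorem whiteCell_mem {M t q : ℕ} : whiteCell M t q ∈ aztecCells M ↔ t < M ∧ q ≤ M := by
  rw [mem_aztecCells, whiteCell]
  dsimp only
  rcases abs_cases (2 * ((t : ℤ) + q - M) + 1) with ⟨h1, h2⟩ | ⟨h1, h2⟩ <;>
  rcases abs_cases (2 * ((t : ℤ) - q) + 1) with ⟨h3, h4⟩ | ⟨h3, h4⟩ <;> omega

theorem rowCell_inj {M t p t' p' : ℕ} : rowCell M t p = rowCell M t' p' ↔ t = t' ∧ p = p' := by
  simp only [rowCell, Prod.mk.injEq]; omega

theorem whiteCell_inj {M t q t' q' : ℕ} :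
    whiteCell M t q = whiteCell M t' q' ↔ t = t' ∧ q = q' := by
  simp only [whiteCell, Prod.mk.injEq]; omega

theorem rowCell_ne_whiteCell {M t p t' q : ℕ} : rowCell M t p ≠ whiteCell M t' q := by
  simp only [rowCell, whiteCell, ne_eq, Prod.mk.injEq]; omega

theorem exists_cell {M : ℕ} {c : ℤ × ℤ} (hc : c ∈ aztecCells M) :
    (∃ t p, t ≤ M ∧ p < M ∧ c = rowCell M t p) ∨ (∃ t q, t < M ∧ q ≤ M ∧ c = whiteCell M t q) := by
  obtain ⟨i, j⟩ := c
  have hc' := hc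
  rw [mem_aztecCells] at hc'
  dsimp only at hc'
  have hb : -(2 * (M : ℤ)) ≤ 2 * i + 2 * j + 2 ∧ 2 * i + 2 * j + 2 ≤ 2 * M ∧
      -(2 * (M : ℤ)) ≤ 2 * i - 2 * j ∧ 2 * i - 2 * j ≤ 2 * M := by
    rcases abs_cases (2 * i + 1) with ⟨h1, h2⟩ | ⟨h1, h2⟩ <;>
    rcases abs_cases (2 * j + 1) with ⟨h3, h4⟩ | ⟨h3, h4⟩ <;> omega
  rcases Int.even_or_odd (i + j + 1 + M) with ⟨s, hs⟩ | ⟨s, hs⟩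
  · left
    have e : (i, j) = rowCell M s.toNat (s - j - 1).toNat := by
      simp only [rowCell, Prod.mk.injEq]; omega
    rw [e, rowCell_mem] at hc
    exact ⟨_, _, hc.1, hc.2, e⟩
  · right
    have e : (i, j) = whiteCell M s.toNat (s - j).toNat := by
      simp only [whiteCell, Prod.mk.injEq]; omega
    rw [e, whiteCell_mem] at hc
    exact ⟨_, _, hc.1, hc.2, e⟩

theorem cellAdj_iff {c d : ℤ × ℤ} : CellAdj c d ↔
    d = (c.1 + 1, c.2) ∨ d = (c.1 - 1, c.2) ∨ d = (c.1, c.2 + 1) ∨ d = (c.1, c.2 - 1) := by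
  obtain ⟨a, b⟩ := c
  obtain ⟨x, y⟩ := d
  simp only [CellAdj, Prod.mk.injEq]
  rcases abs_cases (a - x) with ⟨h1, h2⟩ | ⟨h1, h2⟩ <;>
  rcases abs_cases (b - y) with ⟨h3, h4⟩ | ⟨h3, h4⟩ <;> omega

theorem rowCell_succ_west (M t p : ℕ) :
    ((rowCell M (t + 1) p).1 - 1, (rowCell M (t + 1) p).2) = whiteCell M t p := by
  simp only [rowCell, whiteCell, Prod.mk.injEq]; omega

theorem rowCell_succ_south (M t p : ℕ) :
    ((rowCell M (t + 1) p).1, (rowCell M (t + 1) p).2 - 1) = whiteCell M t (p + 1) := by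
  simp only [rowCell, whiteCell, Prod.mk.injEq]; push_cast; omega

theorem rowCell_north (M t p : ℕ) :
    ((rowCell M t p).1, (rowCell M t p).2 + 1) = whiteCell M t p := by
  simp only [rowCell, whiteCell, sub_add_cancel]

theorem rowCell_east (M t p : ℕ) :
    ((rowCell M t p).1 + 1, (rowCell M t p).2) = whiteCell M t (p + 1) := by
  simp only [rowCell, whiteCell, Prod.mk.injEq]; omega

namespace DominoTiling

variable {M : ℕ}

theorem IsDomino.symm {T : DominoTiling M} {c d : ℤ × ℤ} (h : T.IsDomino c d) :
    T.IsDomino d c := by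
  obtain ⟨hc, rfl⟩ := h
  exact ⟨(T.1 ⟨c, hc⟩).2, congrArg Subtype.val (T.2 ⟨c, hc⟩).2⟩

theorem isDomino_comm {T : DominoTiling M} {c d : ℤ × ℤ} : T.IsDomino c d ↔ T.IsDomino d c :=
  ⟨IsDomino.symm, IsDomino.symm⟩

theorem IsDomino.eq_right {T : DominoTiling M} {c d d' : ℤ × ℤ} (h : T.IsDomino c d)
    (h' : T.IsDomino c d') : d = d' := by
  obtain ⟨hc, rfl⟩ := h
  obtain ⟨_, rfl⟩ := h'
  rfl

theorem IsDomino.mem {T : DominoTiling M} {c d : ℤ × ℤ} (h : T.IsDomino c d) :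
    c ∈ aztecCells M := h.1

theorem exists_isDomino (T : DominoTiling M) {c : ℤ × ℤ} (hc : c ∈ aztecCells M) :
    ∃ d, T.IsDomino c d ∧ CellAdj c d :=
  ⟨_, ⟨hc, rfl⟩, (T.2 ⟨c, hc⟩).1⟩

/-- The set of occupied positions in row `t`. -/
noncomputable def particles (T : DominoTiling M) (t : ℕ) : Finset ℕ :=
  (Finset.range M).filter (fun p => T.HasParticle t p)

/-- The positions of row `t + 1` whose cell is matched to its south neighbour. -/
noncomputable def southMatched (T : DominoTiling M) (t : ℕ) : Finset ℕ :=
  (Finset.range M).filter (fun p => T.IsDomino (rowCell M (t + 1) p) (whiteCell M t (p + 1)))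

/-- The positions of row `t` whose cell is matched to its east neighbour. -/
noncomputable def eastMatched (T : DominoTiling M) (t : ℕ) : Finset ℕ :=
  (Finset.range M).filter (fun p => T.IsDomino (rowCell M t p) (whiteCell M t (p + 1)))

variable (T : DominoTiling M)

theorem hasParticle_succ_iff {t p : ℕ} : T.HasParticle (t + 1) p ↔
    T.IsDomino (rowCell M (t + 1) p) (whiteCell M t p) ∨
      T.IsDomino (rowCell M (t + 1) p) (whiteCell M t (p + 1)) := by
  unfold HasParticle
  rw [rowCell_succ_west, rowCell_succ_south]

theorem not_hasParticle_zero {p : ℕ} : ¬ T.HasParticle 0 p := by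
  have h : ∀ x y : ℤ, T.IsDomino (rowCell M 0 p) (x, y) → x + y = -1 - M - 1 → False := by
    intro x y h hxy
    have h1 := h.symm.mem
    rw [mem_aztecCells] at h1
    dsimp only at h1
    rcases abs_cases (2 * x + 1) with ⟨h1, h2⟩ | ⟨h1, h2⟩ <;>
    rcases abs_cases (2 * y + 1) with ⟨h3, h4⟩ | ⟨h3, h4⟩ <;> omega
  rintro (h1 | h1)
  · exact h _ _ h1 (by simp only [rowCell]; push_cast; ring)
  · exact h _ _ h1 (by simp only [rowCell]; push_cast; ring)

theorem HasParticle.lt {T : DominoTiling M} {t p : ℕ} (h : T.HasParticle t p) : t ≤ M ∧ p < M := by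
  rcases h with h | h <;> exact rowCell_mem.1 h.mem

theorem mem_particles {t p : ℕ} : p ∈ T.particles t ↔ T.HasParticle t p := by
  rw [particles, Finset.mem_filter, Finset.mem_range]
  exact ⟨fun h => h.2, fun h => ⟨h.lt.2, h⟩⟩

theorem particles_zero : T.particles 0 = ∅ := by
  ext p
  simp only [mem_particles, T.not_hasParticle_zero, Finset.notMem_empty]

theorem mem_southMatched {t p : ℕ} : p ∈ T.southMatched t ↔
    T.IsDomino (rowCell M (t + 1) p) (whiteCell M t (p + 1)) := by
  rw [southMatched, Finset.mem_filter, Finset.mem_range]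
  exact ⟨fun h => h.2, fun h => ⟨(rowCell_mem.1 h.mem).2, h⟩⟩

theorem mem_eastMatched {t p : ℕ} : p ∈ T.eastMatched t ↔
    T.IsDomino (rowCell M t p) (whiteCell M t (p + 1)) := by
  rw [eastMatched, Finset.mem_filter, Finset.mem_range]
  exact ⟨fun h => h.2, fun h => ⟨(rowCell_mem.1 h.mem).2, h⟩⟩

theorem mem_particles_sdiff {t p : ℕ} : p ∈ T.particles (t + 1) \ T.southMatched t ↔
    T.IsDomino (rowCell M (t + 1) p) (whiteCell M t p) := by
  rw [Finset.mem_sdiff, mem_particles, mem_southMatched, hasParticle_succ_iff]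
  constructor
  · rintro ⟨h | h, h'⟩
    · exact h
    · exact absurd h h'
  · intro h
    refine ⟨Or.inl h, fun h' => ?_⟩
    have := h.eq_right h'
    rw [whiteCell_inj] at this
    omega

theorem isDomino_rowCell_cases {t p : ℕ} (ht : t ≤ M) (hp : p < M) :
    T.HasParticle t p ∨ T.IsDomino (rowCell M t p) (whiteCell M t p) ∨
      T.IsDomino (rowCell M t p) (whiteCell M t (p + 1)) := by
  obtain ⟨d, h, hadj⟩ := T.exists_isDomino (rowCell_mem.2 ⟨ht, hp⟩)
  rw [← rowCell_north, ← rowCell_east]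
  rcases cellAdj_iff.1 hadj with rfl | rfl | rfl | rfl
  · exact Or.inr (Or.inr h)
  · exact Or.inl (Or.inl h)
  · exact Or.inr (Or.inl h)
  · exact Or.inl (Or.inr h)

theorem HasParticle.not_isDomino {T : DominoTiling M} {t p q : ℕ} (h : T.HasParticle t p) :
    ¬ T.IsDomino (rowCell M t p) (whiteCell M t q) := by
  intro h'
  cases t with
  | zero => exact T.not_hasParticle_zero h
  | succ t =>
    rw [hasParticle_succ_iff] at h
    rcases h with h | h
    · have := h.eq_right h'; rw [whiteCell_inj] at this; omega
    · have := h.eq_right h'; rw [whiteCell_inj] at this; omega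

theorem mem_range_sdiff_sdiff {t p : ℕ} :
    p ∈ (Finset.range M \ T.particles t) \ T.eastMatched t ↔
      T.IsDomino (rowCell M t p) (whiteCell M t p) ∨
        (p < M ∧ M < t) := by
  rw [Finset.mem_sdiff, Finset.mem_sdiff, mem_particles, mem_eastMatched, Finset.mem_range]
  constructor
  · rintro ⟨⟨h1, h2⟩, h3⟩
    by_cases ht : t ≤ M
    · rcases T.isDomino_rowCell_cases ht h1 with h | h | h
      · exact absurd h h2
      · exact Or.inl h
      · exact absurd h h3
    · exact Or.inr ⟨h1, by omega⟩
  · rintro (h | h)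
    · refine ⟨⟨(rowCell_mem.1 h.mem).2, fun h' => h'.not_isDomino h⟩, fun h' => ?_⟩
      have := h.eq_right h'
      rw [whiteCell_inj] at this
      omega
    · refine ⟨⟨h.1, fun h' => ?_⟩, fun h' => ?_⟩
      · have := h'.lt; omega
      · have := rowCell_mem.1 h'.mem; omega

theorem particles_subset (t : ℕ) : T.particles t ⊆ Finset.range M := Finset.filter_subset _ _

/-- The configurations of a tiling in neighbouring rows are compatible. -/
theorem rowCompat {t : ℕ} (ht : t < M) :
    RowCompat M (T.particles t) (T.particles (t + 1)) (T.eastMatched t) (T.southMatched t) := by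
  refine ⟨fun p hp => ?_, fun p hp => ?_, fun q hq => ?_⟩
  · rw [mem_eastMatched] at hp
    rw [Finset.mem_sdiff, Finset.mem_range, mem_particles]
    exact ⟨(rowCell_mem.1 hp.mem).2, fun h => h.not_isDomino hp⟩
  · rw [mem_southMatched] at hp
    rw [mem_particles, hasParticle_succ_iff]
    exact Or.inr hp
  · obtain ⟨d, h, hadj⟩ := T.exists_isDomino (whiteCell_mem.2 ⟨ht, hq⟩)
    have hd : ∀ c, T.IsDomino c (whiteCell M t q) ↔ c = d := by
      intro c
      constructor
      · intro h'; exact h'.symm.eq_right h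
      · rintro rfl; exact h.symm
    have e1 : q ∈ T.particles (t + 1) \ T.southMatched t ↔ d = ((t : ℤ) + q - M + 1, (t : ℤ) - q) := by
      rw [mem_particles_sdiff, hd, eq_comm]
      simp only [rowCell, Prod.ext_iff]; omega
    have e2 : q ∈ (T.southMatched t).image (· + 1) ↔ d = ((t : ℤ) + q - M, (t : ℤ) - q + 1) := by
      rw [Finset.mem_image]
      constructor
      · rintro ⟨p, hp, rfl⟩
        rw [mem_southMatched, hd] at hp
        subst hp
        simp only [rowCell, Prod.ext_iff]; omega
      · intro hd'
        have hdm := h.symm.mem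
        have hq0 : q ≠ 0 := by
          rintro rfl
          rw [hd', mem_aztecCells] at hdm
          dsimp only at hdm
          rcases abs_cases (2 * ((t : ℤ) + (0 : ℕ) - M) + 1) with ⟨h1, h2⟩ | ⟨h1, h2⟩ <;>
          rcases abs_cases (2 * ((t : ℤ) - (0 : ℕ) + 1) + 1) with ⟨h3, h4⟩ | ⟨h3, h4⟩ <;> omega
        refine ⟨q - 1, ?_, by omega⟩
        rw [mem_southMatched, Nat.sub_add_cancel (by omega), hd, hd']
        simp only [rowCell, Prod.ext_iff]; omega
    have e3 : q ∈ (Finset.range M \ T.particles t) \ T.eastMatched t ↔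
        d = ((t : ℤ) + q - M, (t : ℤ) - q - 1) := by
      rw [mem_range_sdiff_sdiff, hd, eq_comm]
      simp only [rowCell, Prod.ext_iff]; omega
    have e4 : q ∈ (T.eastMatched t).image (· + 1) ↔ d = ((t : ℤ) + q - M - 1, (t : ℤ) - q) := by
      rw [Finset.mem_image]
      constructor
      · rintro ⟨p, hp, rfl⟩
        rw [mem_eastMatched, hd] at hp
        subst hp
        simp only [rowCell, Prod.ext_iff]; omega
      · intro hd'
        have hdm := h.symm.mem
        have hq0 : q ≠ 0 := by
          rintro rfl
          rw [hd', mem_aztecCells] at hdm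
          dsimp only at hdm
          rcases abs_cases (2 * ((t : ℤ) + (0 : ℕ) - M - 1) + 1) with ⟨h1, h2⟩ | ⟨h1, h2⟩ <;>
          rcases abs_cases (2 * ((t : ℤ) - (0 : ℕ)) + 1) with ⟨h3, h4⟩ | ⟨h3, h4⟩ <;> omega
        refine ⟨q - 1, ?_, by omega⟩
        rw [mem_eastMatched, Nat.sub_add_cancel (by omega), hd, hd']
        simp only [rowCell, Prod.ext_iff]; omega
    simp only [e1, e2, e3, e4]
    rcases cellAdj_iff.1 hadj with h' | h' | h' | h' <;> subst h' <;>
      simp [whiteCell] <;> omega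

theorem card_particles {t : ℕ} (ht : t ≤ M) : (T.particles t).card = t := by
  induction t with
  | zero => rw [particles_zero, Finset.card_empty]
  | succ t ih =>
    have h := T.rowCompat (t := t) (by omega)
    have him := Finset.image_orderEmbOfFin_univ (T.particles (t + 1)) rfl
    have hs : StrictMono ((T.particles (t + 1)).orderEmbOfFin rfl) := OrderEmbedding.strictMono _
    rw [← him] at h
    have := h.card_eq_card_add_one hs (fun j => Finset.mem_range.1
      (T.particles_subset _ (Finset.orderEmbOfFin_mem _ rfl j))) (T.particles_subset t)
    rw [ih (by omega)] at this
    exact this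

theorem particles_last : T.particles M = Finset.range M :=
  Finset.eq_of_subset_of_card_le (T.particles_subset M)
    (by rw [Finset.card_range, T.card_particles le_rfl])

end DominoTiling

/-- The black cell `c` and the white cell `d` are matched in the tiling with occupied positions
`S t`, right-moving holes `C t` and right-moving particles `B t`. -/
def CodeEdge (M : ℕ) (S C B : ℕ → Finset ℕ) (c d : ℤ × ℤ) : Prop :=
  ∃ t < M, ∃ p,
    (c = rowCell M (t + 1) p ∧ d = whiteCell M t p ∧ p ∈ S (t + 1) \ B t) ∨
    (c = rowCell M (t + 1) p ∧ d = whiteCell M t (p + 1) ∧ p ∈ B t) ∨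
    (c = rowCell M t p ∧ d = whiteCell M t p ∧ p ∈ (Finset.range M \ S t) \ C t) ∨
    (c = rowCell M t p ∧ d = whiteCell M t (p + 1) ∧ p ∈ C t)

theorem DominoTiling.isDomino_rowCell_iff {M : ℕ} (T : DominoTiling M) {t p : ℕ} {d : ℤ × ℤ} :
    T.IsDomino (rowCell M t p) d ↔
      CodeEdge M T.particles T.eastMatched T.southMatched (rowCell M t p) d := by
  constructor
  · intro h
    obtain ⟨ht, hp⟩ := rowCell_mem.1 h.mem
    rcases T.isDomino_rowCell_cases ht hp with h1 | h1 | h1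
    · cases t with
      | zero => exact absurd h1 T.not_hasParticle_zero
      | succ t =>
        rcases T.hasParticle_succ_iff.1 h1 with h2 | h2
        · exact ⟨t, ht, p, Or.inl ⟨rfl, h.eq_right h2, T.mem_particles_sdiff.2 h2⟩⟩
        · exact ⟨t, ht, p, Or.inr (Or.inl ⟨rfl, h.eq_right h2, T.mem_southMatched.2 h2⟩)⟩
    · exact ⟨t, (whiteCell_mem.1 h1.symm.mem).1, p, Or.inr (Or.inr (Or.inl
        ⟨rfl, h.eq_right h1, T.mem_range_sdiff_sdiff.2 (Or.inl h1)⟩))⟩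
    · exact ⟨t, (whiteCell_mem.1 h1.symm.mem).1, p, Or.inr (Or.inr (Or.inr
        ⟨rfl, h.eq_right h1, T.mem_eastMatched.2 h1⟩))⟩
  · rintro ⟨t', ht', p', ⟨hc, hd, h⟩ | ⟨hc, hd, h⟩ | ⟨hc, hd, h⟩ | ⟨hc, hd, h⟩⟩
    · rw [hc, hd]; exact T.mem_particles_sdiff.1 h
    · rw [hc, hd]; exact T.mem_southMatched.1 h
    · rw [hc, hd]
      rcases T.mem_range_sdiff_sdiff.1 h with h | h
      · exact h
      · omega
    · rw [hc, hd]; exact T.mem_eastMatched.1 h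

/-- A tiling is determined by its configurations. -/
theorem DominoTiling.ext_of_code {M : ℕ} {T T' : DominoTiling M}
    (h1 : ∀ t ≤ M, T.particles t = T'.particles t)
    (h2 : ∀ t < M, T.eastMatched t = T'.eastMatched t)
    (h3 : ∀ t < M, T.southMatched t = T'.southMatched t) : T = T' := by
  have hcode : ∀ c d, CodeEdge M T.particles T.eastMatched T.southMatched c d ↔
      CodeEdge M T'.particles T'.eastMatched T'.southMatched c d := by
    intro c d
    unfold CodeEdge
    refine exists_congr fun t => and_congr_right fun ht => ?_
    rw [h1 t ht.le, h1 (t + 1) ht, h2 t ht, h3 t ht]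
  have hdom : ∀ c d, T.IsDomino c d → T'.IsDomino c d := by
    have hblack : ∀ t p d, T.IsDomino (rowCell M t p) d → T'.IsDomino (rowCell M t p) d := by
      intro t p d h
      rw [isDomino_rowCell_iff] at h ⊢
      exact (hcode _ _).1 h
    intro c d h
    rcases exists_cell h.mem with ⟨t, p, -, -, rfl⟩ | ⟨t, q, -, -, rfl⟩
    · exact hblack _ _ _ h
    · rcases exists_cell h.symm.mem with ⟨t', p, -, -, rfl⟩ | ⟨t', q', -, -, rfl⟩
      · exact (hblack _ _ _ h.symm).symm
      · exfalso
        -- two white cells are never adjacent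
        have hadj : CellAdj (whiteCell M t q) (whiteCell M t' q') := by
          obtain ⟨d', h', hadj⟩ := T.exists_isDomino h.mem
          rwa [h.eq_right h']
        rw [cellAdj_iff] at hadj
        simp only [whiteCell, Prod.mk.injEq] at hadj
        omega
  refine Subtype.ext (funext fun c => Subtype.ext ?_)
  obtain ⟨_, h⟩ := hdom c _ ⟨c.2, rfl⟩
  exact h.symm

/-- Every sequence of compatible configurations comes from a tiling. -/
theorem DominoTiling.exists_of_code {M : ℕ} {S C B : ℕ → Finset ℕ} (h0 : S 0 = ∅)
    (hM : S M = Finset.range M) (hS : ∀ t ≤ M, S t ⊆ Finset.range M)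
    (hcompat : ∀ t < M, RowCompat M (S t) (S (t + 1)) (C t) (B t)) :
    ∃ T : DominoTiling M, (∀ t ≤ M, T.particles t = S t) ∧ (∀ t < M, T.eastMatched t = C t) ∧
      ∀ t < M, T.southMatched t = B t := by
  have hCS : ∀ t < M, C t ⊆ Finset.range M \ S t := fun t ht => (hcompat t ht).1
  have hBS : ∀ t < M, B t ⊆ S (t + 1) := fun t ht => (hcompat t ht).2.1
  have hBM : ∀ t < M, ∀ p ∈ B t, p < M := fun t ht p hp =>
    Finset.mem_range.1 (hS (t + 1) ht (hBS t ht hp))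
  -- edges join neighbouring cells of the diamond
  have hedge : ∀ c d, CodeEdge M S C B c d → c ∈ aztecCells M ∧ d ∈ aztecCells M ∧
      CellAdj c d ∧ (∃ t p, c = rowCell M t p) ∧ ∃ t q, d = whiteCell M t q := by
    rintro c d ⟨t, ht, p, ⟨hc, hd, h⟩ | ⟨hc, hd, h⟩ | ⟨hc, hd, h⟩ | ⟨hc, hd, h⟩⟩
    · have hp : p < M := Finset.mem_range.1 (hS (t + 1) ht (Finset.mem_sdiff.1 h).1)
      refine ⟨hc ▸ rowCell_mem.2 ⟨ht, hp⟩, hd ▸ whiteCell_mem.2 ⟨ht, hp.le⟩, ?_, ⟨_, _, hc⟩,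
        ⟨_, _, hd⟩⟩
      rw [hd, hc, ← rowCell_succ_west, cellAdj_iff]; tauto
    · have hp : p < M := hBM t ht p h
      refine ⟨hc ▸ rowCell_mem.2 ⟨ht, hp⟩, hd ▸ whiteCell_mem.2 ⟨ht, hp⟩, ?_, ⟨_, _, hc⟩,
        ⟨_, _, hd⟩⟩
      rw [hd, hc, ← rowCell_succ_south, cellAdj_iff]; tauto
    · have hp : p < M := Finset.mem_range.1 (Finset.mem_sdiff.1 (Finset.mem_sdiff.1 h).1).1
      refine ⟨hc ▸ rowCell_mem.2 ⟨ht.le, hp⟩, hd ▸ whiteCell_mem.2 ⟨ht, hp.le⟩, ?_, ⟨_, _, hc⟩,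
        ⟨_, _, hd⟩⟩
      rw [hd, hc, ← rowCell_north, cellAdj_iff]; tauto
    · have hp : p < M := Finset.mem_range.1 (Finset.mem_sdiff.1 (hCS t ht h)).1
      refine ⟨hc ▸ rowCell_mem.2 ⟨ht.le, hp⟩, hd ▸ whiteCell_mem.2 ⟨ht, hp⟩, ?_, ⟨_, _, hc⟩,
        ⟨_, _, hd⟩⟩
      rw [hd, hc, ← rowCell_east, cellAdj_iff]; tauto
  -- every black cell has exactly one edge
  have hblack : ∀ t p, t ≤ M → p < M → ∃! d, CodeEdge M S C B (rowCell M t p) d := by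
    intro t p ht hp
    have hex : ∃ d, CodeEdge M S C B (rowCell M t p) d := by
      by_cases hpS : p ∈ S t
      · cases t with
        | zero => rw [h0] at hpS; simp at hpS
        | succ t =>
          by_cases hpB : p ∈ B t
          · exact ⟨_, t, ht, p, Or.inr (Or.inl ⟨rfl, rfl, hpB⟩)⟩
          · exact ⟨_, t, ht, p, Or.inl ⟨rfl, rfl, Finset.mem_sdiff.2 ⟨hpS, hpB⟩⟩⟩
      · have htM : t < M := by
          refine lt_of_le_of_ne ht ?_
          rintro rfl
          rw [hM, Finset.mem_range] at hpS
          exact hpS hp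
        have hpc : p ∈ Finset.range M \ S t :=
          Finset.mem_sdiff.2 ⟨Finset.mem_range.2 hp, hpS⟩
        by_cases hpC : p ∈ C t
        · exact ⟨_, t, htM, p, Or.inr (Or.inr (Or.inr ⟨rfl, rfl, hpC⟩))⟩
        · exact ⟨_, t, htM, p, Or.inr (Or.inr (Or.inl ⟨rfl, rfl, Finset.mem_sdiff.2 ⟨hpc, hpC⟩⟩))⟩
    -- the four kinds of edges exclude each other
    have hkind : ∀ d, CodeEdge M S C B (rowCell M t p) d →
        (p ∈ S t ∧ ∃ t', t = t' + 1 ∧ (p ∉ B t' ∧ d = whiteCell M t' p ∨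
          p ∈ B t' ∧ d = whiteCell M t' (p + 1))) ∨
        (p ∉ S t ∧ (p ∉ C t ∧ d = whiteCell M t p ∨ p ∈ C t ∧ d = whiteCell M t (p + 1))) := by
      rintro d ⟨t', ht', p', ⟨hc, hd, h⟩ | ⟨hc, hd, h⟩ | ⟨hc, hd, h⟩ | ⟨hc, hd, h⟩⟩
      · obtain ⟨rfl, rfl⟩ := rowCell_inj.1 hc
        rw [Finset.mem_sdiff] at h
        exact Or.inl ⟨h.1, t', rfl, Or.inl ⟨h.2, hd⟩⟩
      · obtain ⟨rfl, rfl⟩ := rowCell_inj.1 hc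
        exact Or.inl ⟨hBS t' ht' h, t', rfl, Or.inr ⟨h, hd⟩⟩
      · obtain ⟨rfl, rfl⟩ := rowCell_inj.1 hc
        rw [Finset.mem_sdiff, Finset.mem_sdiff] at h
        exact Or.inr ⟨h.1.2, Or.inl ⟨h.2, hd⟩⟩
      · obtain ⟨rfl, rfl⟩ := rowCell_inj.1 hc
        exact Or.inr ⟨(Finset.mem_sdiff.1 (hCS t ht' h)).2, Or.inr ⟨h, hd⟩⟩
    obtain ⟨d, hd⟩ := hex
    refine ⟨d, hd, fun d' hd' => ?_⟩
    rcases hkind d hd with ⟨h1, t1, e1, h3⟩ | ⟨h1, h3⟩ <;>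
    rcases hkind d' hd' with ⟨h2, t2, e2, h4⟩ | ⟨h2, h4⟩
    · obtain rfl : t1 = t2 := by omega
      rcases h3 with ⟨h5, rfl⟩ | ⟨h5, rfl⟩ <;> rcases h4 with ⟨h6, rfl⟩ | ⟨h6, rfl⟩ <;>
        first | rfl | contradiction
    · contradiction
    · contradiction
    · rcases h3 with ⟨h5, rfl⟩ | ⟨h5, rfl⟩ <;> rcases h4 with ⟨h6, rfl⟩ | ⟨h6, rfl⟩ <;>
        first | rfl | contradiction
  -- every white cell has exactly one edge
  have hwhite : ∀ t q, t < M → q ≤ M → ∃! c, CodeEdge M S C B c (whiteCell M t q) := by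
    intro t q ht hq
    have hsum := (hcompat t ht).2.2 q hq
    have hiff : ∀ c, CodeEdge M S C B c (whiteCell M t q) ↔
        (q ∈ S (t + 1) \ B t ∧ c = rowCell M (t + 1) q) ∨
        (q ∈ (B t).image (· + 1) ∧ c = rowCell M (t + 1) (q - 1)) ∨
        (q ∈ (Finset.range M \ S t) \ C t ∧ c = rowCell M t q) ∨
        (q ∈ (C t).image (· + 1) ∧ c = rowCell M t (q - 1)) := by
      intro c
      constructor
      · rintro ⟨t', ht', p', ⟨hc, hd, h⟩ | ⟨hc, hd, h⟩ | ⟨hc, hd, h⟩ | ⟨hc, hd, h⟩⟩ <;>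
        obtain ⟨rfl, rfl⟩ := whiteCell_inj.1 hd
        · exact Or.inl ⟨h, hc⟩
        · exact Or.inr (Or.inl ⟨Finset.mem_image_of_mem _ h, hc⟩)
        · exact Or.inr (Or.inr (Or.inl ⟨h, hc⟩))
        · exact Or.inr (Or.inr (Or.inr ⟨Finset.mem_image_of_mem _ h, hc⟩))
      · rintro (⟨h, hc⟩ | ⟨h, hc⟩ | ⟨h, hc⟩ | ⟨h, hc⟩)
        · exact ⟨t, ht, q, Or.inl ⟨hc, rfl, h⟩⟩
        · obtain ⟨p, hp, rfl⟩ := Finset.mem_image.1 h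
          exact ⟨t, ht, p, Or.inr (Or.inl ⟨hc, rfl, hp⟩)⟩
        · exact ⟨t, ht, q, Or.inr (Or.inr (Or.inl ⟨hc, rfl, h⟩))⟩
        · obtain ⟨p, hp, rfl⟩ := Finset.mem_image.1 h
          exact ⟨t, ht, p, Or.inr (Or.inr (Or.inr ⟨hc, rfl, hp⟩))⟩
    simp only [hiff]
    by_cases a1 : q ∈ S (t + 1) \ B t <;> by_cases a2 : q ∈ (B t).image (· + 1) <;>
    by_cases a3 : q ∈ (Finset.range M \ S t) \ C t <;> by_cases a4 : q ∈ (C t).image (· + 1) <;>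
    simp only [a1, a2, a3, a4, if_true, if_false, true_and, false_and, or_false, false_or,
      existsUnique_eq] at hsum ⊢ <;> omega
  let R : ℤ × ℤ → ℤ × ℤ → Prop := fun c d => CodeEdge M S C B c d ∨ CodeEdge M S C B d c
  have hR : ∀ c : aztecCells M, ∃ d : aztecCells M, R c d ∧ ∀ d', R c d' → d' = d := by
    rintro ⟨c, hc⟩
    rcases exists_cell hc with ⟨t, p, ht, hp, rfl⟩ | ⟨t, q, ht, hq, rfl⟩
    · obtain ⟨d, hd, hd'⟩ := hblack t p ht hp
      refine ⟨⟨d, (hedge _ _ hd).2.1⟩, Or.inl hd, ?_⟩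
      rintro d' (h | h)
      · exact hd' _ h
      · obtain ⟨-, -, -, -, t', q, he⟩ := hedge _ _ h
        exact absurd he rowCell_ne_whiteCell
    · obtain ⟨d, hd, hd'⟩ := hwhite t q ht hq
      refine ⟨⟨d, (hedge _ _ hd).1⟩, Or.inr hd, ?_⟩
      rintro d' (h | h)
      · obtain ⟨-, -, -, ⟨t', q, he⟩, -⟩ := hedge _ _ h
        exact absurd he.symm rowCell_ne_whiteCell
      · exact hd' _ h
  choose mate hmate hmate' using hR
  have hRsymm : ∀ c d, R c d → R d c := fun c d h => h.symm
  let T : DominoTiling M := ⟨mate, fun c => by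
    refine ⟨?_, Subtype.ext (hmate' (mate c) c (hRsymm _ _ (hmate c))).symm⟩
    rcases hmate c with h | h
    · exact (hedge _ _ h).2.2.1
    · have h1 := (hedge _ _ h).2.2.1
      unfold CellAdj at h1 ⊢
      rw [abs_sub_comm, abs_sub_comm (c : ℤ × ℤ).2]
      exact h1⟩
  have hT : ∀ t p d, T.IsDomino (rowCell M t p) d ↔ CodeEdge M S C B (rowCell M t p) d := by
    intro t p d
    constructor
    · rintro ⟨h, rfl⟩
      rcases hmate ⟨_, h⟩ with h' | h'
      · exact h'
      · obtain ⟨-, -, -, -, t', q, he⟩ := hedge _ _ h'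
        exact absurd he rowCell_ne_whiteCell
    · intro h
      have hc := (hedge _ _ h).1
      exact ⟨hc, (hmate' ⟨_, hc⟩ d (Or.inl h)).symm⟩
  have hB : ∀ t < M, T.southMatched t = B t := by
    intro t ht
    ext p
    rw [T.mem_southMatched, hT]
    constructor
    · rintro ⟨t', ht', p', ⟨hc, hd, h⟩ | ⟨hc, hd, h⟩ | ⟨hc, hd, h⟩ | ⟨hc, hd, h⟩⟩ <;>
      rw [rowCell_inj] at hc <;> rw [whiteCell_inj] at hd
      · omega
      · obtain ⟨rfl, -⟩ := hd
        obtain ⟨-, rfl⟩ := hc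
        exact h
      · omega
      · omega
    · intro h
      exact ⟨t, ht, p, Or.inr (Or.inl ⟨rfl, rfl, h⟩)⟩
  have hC : ∀ t < M, T.eastMatched t = C t := by
    intro t ht
    ext p
    rw [T.mem_eastMatched, hT]
    constructor
    · rintro ⟨t', ht', p', ⟨hc, hd, h⟩ | ⟨hc, hd, h⟩ | ⟨hc, hd, h⟩ | ⟨hc, hd, h⟩⟩ <;>
      rw [rowCell_inj] at hc <;> rw [whiteCell_inj] at hd
      · omega
      · omega
      · omega
      · obtain ⟨rfl, rfl⟩ := hc
        exact h
    · intro h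
      exact ⟨t, ht, p, Or.inr (Or.inr (Or.inr ⟨rfl, rfl, h⟩))⟩
  refine ⟨T, fun t ht => ?_, hC, hB⟩
  cases t with
  | zero => rw [T.particles_zero, h0]
  | succ t =>
    ext p
    by_cases hpB : p ∈ B t
    · have : p ∈ T.southMatched t := by rw [hB t ht]; exact hpB
      exact ⟨fun _ => hBS t ht hpB, fun _ => (T.rowCompat ht).2.1 this⟩
    · have h1 : p ∈ S (t + 1) ↔ p ∈ S (t + 1) \ B t := by rw [Finset.mem_sdiff]; tauto
      have h2 : p ∈ T.particles (t + 1) ↔ p ∈ T.particles (t + 1) \ T.southMatched t := by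
        rw [Finset.mem_sdiff, hB t ht]; tauto
      rw [h1, h2, T.mem_particles_sdiff, hT]
      constructor
      · rintro ⟨t', ht', p', ⟨hc, hd, h⟩ | ⟨hc, hd, h⟩ | ⟨hc, hd, h⟩ | ⟨hc, hd, h⟩⟩ <;>
        rw [rowCell_inj] at hc <;> rw [whiteCell_inj] at hd
        · obtain ⟨rfl, rfl⟩ := hd
          exact h
        · omega
        · omega
        · omega
      · intro h
        exact ⟨t, ht, p, Or.inl ⟨rfl, rfl, h⟩⟩

/-- A sum over sequences of a product of transition weights is computed by a recursion. -/
theorem sum_chain_eq {α : Type*} [Fintype α] (a : α → ℝ) (K : ℕ → α → α → ℝ) (Z : ℕ → α → ℝ)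
    (hZ0 : ∀ x, Z 0 x = a x) (hZ : ∀ n x, Z (n + 1) x = ∑ x', Z n x' * K n x' x) (n : ℕ)
    (h : α → ℝ) :
    ∑ σ : Fin (n + 1) → α, a (σ 0) * (∏ t : Fin n, K t (σ t.castSucc) (σ t.succ)) *
      h (σ (Fin.last n)) = ∑ x, Z n x * h x := by
  induction n generalizing h with
  | zero =>
    rw [← (Equiv.funUnique (Fin 1) α).symm.sum_comp]
    refine Finset.sum_congr rfl fun x _ => ?_
    simp [hZ0]
  | succ n ih =>
    rw [← (Fin.snocEquiv (fun _ : Fin (n + 2) => α)).sum_comp, Fintype.sum_prod_type,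
      Finset.sum_comm]
    have h1 : ∀ τ : Fin (n + 1) → α, ∑ x : α,
        a ((Fin.snocEquiv (fun _ : Fin (n + 2) => α)) (x, τ) 0) *
          (∏ t : Fin (n + 1), K t ((Fin.snocEquiv (fun _ : Fin (n + 2) => α)) (x, τ) t.castSucc)
            ((Fin.snocEquiv (fun _ : Fin (n + 2) => α)) (x, τ) t.succ)) *
          h ((Fin.snocEquiv (fun _ : Fin (n + 2) => α)) (x, τ) (Fin.last (n + 1))) =
        a (τ 0) * (∏ t : Fin n, K t (τ t.castSucc) (τ t.succ)) *
          (fun y => ∑ x, K n y x * h x) (τ (Fin.last n)) := by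
      intro τ
      simp only [Finset.mul_sum]
      refine Finset.sum_congr rfl fun x _ => ?_
      have e0 : (Fin.snocEquiv (fun _ : Fin (n + 2) => α)) (x, τ) 0 = τ 0 :=
        Fin.snoc_castSucc (α := fun _ => α) x τ 0
      have e1 : ∀ t : Fin (n + 1),
          (Fin.snocEquiv (fun _ : Fin (n + 2) => α)) (x, τ) t.castSucc = τ t :=
        fun t => Fin.snoc_castSucc (α := fun _ => α) x τ t
      have e2 : (Fin.snocEquiv (fun _ : Fin (n + 2) => α)) (x, τ) (Fin.last (n + 1)) = x :=
        Fin.snoc_last (α := fun _ => α) x τ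
      rw [Fin.prod_univ_castSucc, e0, e2]
      simp only [e1, Fin.succ_last, Fin.succ_castSucc, e2, Fin.val_castSucc, Fin.val_last]
      ring
    refine (Finset.sum_congr rfl fun τ _ => h1 τ).trans ((ih fun y => ∑ x, K n y x * h x).trans ?_)
    simp only [hZ, Finset.sum_mul, Finset.mul_sum]
    rw [Finset.sum_comm]
    refine Finset.sum_congr rfl fun x _ => Finset.sum_congr rfl fun y _ => ?_
    ring

/-- The weighted sum over all tilings is computed row by row. -/
theorem sum_tilings_eq_rowPartition (M : ℕ) (W : ℕ → ℝ) (h : ℕ → ℕ → ℝ) :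
    ∑ T : DominoTiling M, ∏ t : Fin M,
        ((∏ p ∈ T.particles (t + 1), h (t + 1) p) * W t ^ (T.southMatched t).card) =
      rowPartition M W h M (Finset.range M) := by
  classical
  let α : Type := ↥(Finset.range M).powerset
  let full : α := ⟨Finset.range M, Finset.mem_powerset.2 subset_rfl⟩
  have h1 := sum_chain_eq (fun x : α => if (x : Finset ℕ) = ∅ then 1 else 0)
    (fun t x' x => (∏ p ∈ (x : Finset ℕ), h (t + 1) p) * rowKernel M (W t) x' x)
    (fun n x => rowPartition M W h n x) (fun x => rfl) (fun n x => by
      rw [rowPartition, Finset.mul_sum]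
      rw [← Finset.sum_coe_sort (Finset.range M).powerset]
      refine Finset.sum_congr rfl fun x' _ => ?_
      ring) M (fun x => if x = full then 1 else 0)
  have h2 : ∑ x : α, rowPartition M W h M x * (if x = full then 1 else 0) =
      rowPartition M W h M (Finset.range M) := by
    rw [Finset.sum_eq_single full]
    · rw [if_pos rfl, mul_one]
    · intro x _ hx; rw [if_neg hx, mul_zero]
    · intro h; exact absurd (Finset.mem_univ _) h
  rw [h2] at h1
  rw [← h1]
  -- expand the kernels
  let V : (Fin (M + 1) → α) → Fin M → Finset (Finset ℕ × Finset ℕ) := fun σ t =>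
    ((Finset.range M).powerset ×ˢ (σ t.succ : Finset ℕ).powerset).filter
      (fun x => RowCompat M (σ t.castSucc) (σ t.succ) x.1 x.2)
  have h3 : ∀ σ : Fin (M + 1) → α,
      (if ((σ 0 : α) : Finset ℕ) = ∅ then 1 else 0) *
        (∏ t : Fin M, (∏ p ∈ (σ t.succ : Finset ℕ), h (t + 1) p) *
          rowKernel M (W t) (σ t.castSucc) (σ t.succ)) *
        (if σ (Fin.last M) = full then 1 else 0) =
      if ((σ 0 : α) : Finset ℕ) = ∅ ∧ σ (Fin.last M) = full then
        ∑ x ∈ Fintype.piFinset (V σ),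
          ∏ t : Fin M, ((∏ p ∈ (σ t.succ : Finset ℕ), h (t + 1) p) * W t ^ (x t).2.card)
      else 0 := by
    intro σ
    have : ∏ t : Fin M, (∏ p ∈ (σ t.succ : Finset ℕ), h (t + 1) p) *
          rowKernel M (W t) (σ t.castSucc) (σ t.succ) =
        ∑ x ∈ Fintype.piFinset (V σ),
          ∏ t : Fin M, ((∏ p ∈ (σ t.succ : Finset ℕ), h (t + 1) p) * W t ^ (x t).2.card) := by
      rw [← Finset.prod_univ_sum (V σ) (fun t (x : Finset ℕ × Finset ℕ) =>
        (∏ p ∈ (σ t.succ : Finset ℕ), h (t + 1) p) * W t ^ x.2.card)]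
      refine Finset.prod_congr rfl fun t _ => ?_
      rw [rowKernel, Finset.mul_sum]
    rw [this]
    by_cases c1 : ((σ 0 : α) : Finset ℕ) = ∅ <;> by_cases c2 : σ (Fin.last M) = full <;>
      simp [c1, c2]
  rw [Finset.sum_congr rfl fun σ _ => h3 σ, ← Finset.sum_filter, Finset.sum_sigma']
  refine Finset.sum_bij (fun T _ => ⟨fun t => ⟨T.particles t,
      Finset.mem_powerset.2 (T.particles_subset t)⟩,
      fun t => (T.eastMatched t, T.southMatched t)⟩) ?_ ?_ ?_ ?_
  · intro T _
    simp only [Finset.mem_sigma, Finset.mem_filter, Finset.mem_univ, true_and,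
      Fintype.mem_piFinset, V, Finset.mem_product, Finset.mem_powerset]
    refine ⟨⟨T.particles_zero, Subtype.ext T.particles_last⟩, fun t => ?_⟩
    have hc := T.rowCompat t.2
    exact ⟨⟨hc.1.trans Finset.sdiff_subset, hc.2.1⟩, hc⟩
  · intro T _ T' _ hTT
    rw [Sigma.mk.injEq, heq_eq_eq] at hTT
    obtain ⟨h4, h5⟩ := hTT
    refine DominoTiling.ext_of_code (fun t ht => ?_) (fun t ht => ?_) (fun t ht => ?_)
    · exact congrArg Subtype.val (congrFun h4 ⟨t, Nat.lt_succ_of_le ht⟩)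
    · exact congrArg Prod.fst (congrFun h5 ⟨t, ht⟩)
    · exact congrArg Prod.snd (congrFun h5 ⟨t, ht⟩)
  · rintro ⟨σ, x⟩ hx
    simp only [Finset.mem_sigma, Finset.mem_filter, Finset.mem_univ, true_and,
      Fintype.mem_piFinset, V, Finset.mem_product, Finset.mem_powerset] at hx
    obtain ⟨⟨h0, hM⟩, hx⟩ := hx
    obtain ⟨T, hT1, hT2, hT3⟩ := DominoTiling.exists_of_code (M := M)
      (S := fun t => if ht : t < M + 1 then σ ⟨t, ht⟩ else ∅)
      (C := fun t => if ht : t < M then (x ⟨t, ht⟩).1 else ∅)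
      (B := fun t => if ht : t < M then (x ⟨t, ht⟩).2 else ∅)
      (by simpa using h0)
      (by
        simp only [Nat.lt_succ_self, dif_pos]
        exact congrArg Subtype.val hM)
      (fun t ht => by
        simp only [Nat.lt_succ_of_le ht, dif_pos]
        exact Finset.mem_powerset.1 (σ ⟨t, Nat.lt_succ_of_le ht⟩).2)
      (fun t ht => by
        simp only [ht, dif_pos, Nat.lt_succ_of_lt ht, Nat.succ_lt_succ ht]
        exact (hx ⟨t, ht⟩).2)
    refine ⟨T, Finset.mem_univ _, ?_⟩
    rw [Sigma.mk.injEq, heq_eq_eq]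
    constructor
    · funext t
      refine Subtype.ext ((hT1 t (Nat.lt_succ_iff.1 t.2)).trans ?_)
      simp only [t.2, dif_pos]
    · funext t
      refine Prod.ext ((hT2 t t.2).trans ?_) ((hT3 t t.2).trans ?_)
      · simp only [t.2, dif_pos]
      · simp only [t.2, dif_pos]
  · intro T _
    rfl

namespace DominoTiling

variable {M : ℕ}

theorem weight_eq (b : Fin M → ℝ) (T : DominoTiling M) :
    weight b T = ∏ t : Fin M, (b t / (1 - b t)) ^ (T.southMatched t).card := by
  unfold weight southMatched
  refine Finset.prod_congr rfl fun t _ => ?_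
  rw [Finset.prod_const]
  congr 2
  ext p
  simp only [Finset.mem_filter, rowCell_succ_south]

/-- The parameters `b`, extended by zero to all natural numbers. -/
noncomputable def extendParam (b : Fin M → ℝ) (t : ℕ) : ℝ := if h : t < M then b ⟨t, h⟩ else 0

theorem extendParam_val (b : Fin M → ℝ) (t : Fin M) : extendParam b t = b t := by
  simp [extendParam]

/-- The joint generating function of the particle positions in row `N`. -/
theorem sum_weight_mul_prod {b : Fin M → ℝ} (hb : ∀ t, b t ≠ 1) {N : ℕ} (hN0 : 0 < N) (hN : N ≤ M)
    (k : ℕ) (ε : ℝ) :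
    normFactor (extendParam b) M *
      ∑ T : DominoTiling M, weight b T * ∏ p ∈ T.particles N, (1 + ε * (p : ℝ) ^ k) =
      Matrix.det (1 + ε • momentMatrix (extendParam b) N (M - N) k N) := by
  have hb' : ∀ t < M, extendParam b t ≠ 1 := by
    intro t ht
    rw [extendParam, dif_pos ht]
    exact hb _
  rw [← rowPartition_eq_det hb' hN0 hN, ← sum_tilings_eq_rowPartition]
  refine congrArg _ (Finset.sum_congr rfl fun T _ => ?_)
  rw [Finset.prod_mul_distrib, weight_eq, mul_comm]
  refine congrArg₂ _ ?_ ?_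
  · rw [Finset.prod_eq_single (⟨N - 1, by omega⟩ : Fin M)]
    · simp only [Nat.sub_add_cancel hN0, rowTest, if_true]
    · intro t _ ht
      refine Finset.prod_eq_one fun p _ => ?_
      have : ¬ ((t : ℕ) + 1 = N) := fun h => ht (Fin.ext (by simp; omega))
      simp [rowTest, this]
    · intro h; exact absurd (Finset.mem_univ _) h
  · refine Finset.prod_congr rfl fun t _ => ?_
    rw [extendParam_val]

end DominoTiling

/-! ### Mean and variance of linear statistics -/

theorem coeff_prod_one_add_C_mul_X (S : Finset ℕ) (c : ℕ → ℝ) :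
    (∏ p ∈ S, (1 + Polynomial.C (c p) * Polynomial.X)).coeff 0 = 1 ∧
    (∏ p ∈ S, (1 + Polynomial.C (c p) * Polynomial.X)).coeff 1 = ∑ p ∈ S, c p ∧
    2 * (∏ p ∈ S, (1 + Polynomial.C (c p) * Polynomial.X)).coeff 2 =
      (∑ p ∈ S, c p) ^ 2 - ∑ p ∈ S, c p ^ 2 := by
  classical
  induction S using Finset.induction_on with
  | empty => simp [Polynomial.coeff_one]
  | insert a S ha ih =>
    obtain ⟨h0, h1, h2⟩ := ih
    have e : ∀ (P : Polynomial ℝ) (x : ℝ) (m : ℕ),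
        ((1 + Polynomial.C x * Polynomial.X) * P).coeff (m + 1) =
          P.coeff (m + 1) + x * P.coeff m := by
      intro P x m
      rw [add_mul, one_mul, mul_assoc, Polynomial.coeff_add, Polynomial.coeff_C_mul,
        Polynomial.coeff_X_mul]
    rw [Finset.prod_insert ha, Finset.sum_insert ha, Finset.sum_insert ha, e _ _ 0, e _ _ 1]
    simp only [zero_add, Nat.reduceAdd]
    refine ⟨by simp [h0, Polynomial.mul_coeff_zero], by rw [h0, h1]; ring, ?_⟩
    rw [h1]
    linear_combination h2

/-- The polynomial `det (1 + X A)`. -/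
noncomputable def detPoly {n : ℕ} (A : Matrix (Fin n) (Fin n) ℝ) : Polynomial ℝ :=
  Matrix.det (1 + (Polynomial.X : Polynomial ℝ) • A.map Polynomial.C)

theorem eval_detPoly {n : ℕ} (A : Matrix (Fin n) (Fin n) ℝ) (x : ℝ) :
    (detPoly A).eval x = Matrix.det (1 + x • A) := by
  rw [detPoly, ← Polynomial.coe_evalRingHom, RingHom.map_det]
  congr 1
  ext i j
  simp [Matrix.one_apply, apply_ite (Polynomial.eval x)]
  ring

theorem coeff_zero_detPoly {n : ℕ} (A : Matrix (Fin n) (Fin n) ℝ) : (detPoly A).coeff 0 = 1 := by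
  rw [Polynomial.coeff_zero_eq_eval_zero, eval_detPoly, zero_smul, add_zero, Matrix.det_one]

theorem coeff_one_detPoly {n : ℕ} (A : Matrix (Fin n) (Fin n) ℝ) :
    (detPoly A).coeff 1 = A.trace := by
  have h := Matrix.derivative_det_one_add_X_smul A
  rw [← Polynomial.coeff_zero_eq_eval_zero, Polynomial.coeff_derivative] at h
  simpa [detPoly] using h

/-- The second coefficient, from `det (1 + x A) det (1 - x A) = det (1 - x ^ 2 A ^ 2)`. -/
theorem coeff_two_detPoly {n : ℕ} (A : Matrix (Fin n) (Fin n) ℝ) :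
    2 * (detPoly A).coeff 2 = A.trace ^ 2 - (A * A).trace := by
  have h1 : detPoly (-A) = (detPoly A).comp (Polynomial.C (-1) * Polynomial.X) := by
    refine Polynomial.funext fun x => ?_
    rw [Polynomial.eval_comp, eval_detPoly, eval_detPoly]
    simp
  have h2 : detPoly A * detPoly (-A) = Polynomial.expand ℝ 2 (detPoly (-(A * A))) := by
    refine Polynomial.funext fun x => ?_
    rw [Polynomial.eval_mul, Polynomial.expand_eval, eval_detPoly, eval_detPoly, eval_detPoly,
      ← Matrix.det_mul]
    congr 1
    simp only [smul_neg, mul_add, add_mul, mul_neg, one_mul, mul_one, smul_mul_smul_comm]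
    rw [pow_two]
    abel
  have h3 := congrArg (fun p => Polynomial.coeff p 2) h2
  have h4 : (Polynomial.expand ℝ 2 (detPoly (-(A * A)))).coeff 2 = (detPoly (-(A * A))).coeff 1 := by
    have := Polynomial.coeff_expand_mul (R := ℝ) (p := 2) (by norm_num) (detPoly (-(A * A))) 1
    simpa using this
  simp only [h4, coeff_one_detPoly, Polynomial.coeff_mul, h1,
    Finset.Nat.antidiagonal_succ, Finset.Nat.antidiagonal_zero] at h3
  simp only [Polynomial.comp_C_mul_X_coeff] at h3
  simp [coeff_zero_detPoly, coeff_one_detPoly] at h3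
  linear_combination h3

namespace DominoTiling

variable {M : ℕ}

/-- Quenched expectation of a function of the tiling. -/
noncomputable def quenchedExp (b : Fin M → ℝ) (X : DominoTiling M → ℝ) : ℝ :=
  ∑ T, weight b T / (∑ T', weight b T') * X T

/-- The power sums of the particle positions in a row. -/
noncomputable def rowSum (N k : ℕ) (T : DominoTiling M) : ℝ := ∑ p ∈ T.particles N, (p : ℝ) ^ k

theorem weight_pos {b : Fin M → ℝ} (hb : ∀ t, 0 < b t ∧ b t < 1) (T : DominoTiling M) :
    0 < weight b T := by
  rw [weight_eq]
  refine Finset.prod_pos fun t _ => pow_pos (div_pos (hb t).1 (by linarith [(hb t).2])) _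

/-- The normalized weights have the determinantal generating function. -/
theorem quenchedExp_prod {b : Fin M → ℝ} (hb : ∀ t, 0 < b t ∧ b t < 1) {N : ℕ} (hN0 : 0 < N)
    (hN : N ≤ M) (k : ℕ) (ε : ℝ) :
    quenchedExp b (fun T => ∏ p ∈ T.particles N, (1 + ε * (p : ℝ) ^ k)) =
      Matrix.det (1 + ε • momentMatrix (extendParam b) N (M - N) k N) ∧
    0 < ∑ T, weight b T := by
  have hb1 : ∀ t, b t ≠ 1 := fun t => (hb t).2.ne
  have h0 := sum_weight_mul_prod hb1 hN0 hN k 0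
  have h1 := sum_weight_mul_prod hb1 hN0 hN k ε
  simp only [zero_mul, add_zero, Finset.prod_const_one, mul_one, zero_smul, Matrix.det_one] at h0
  have hpos : (∑ T, weight b T) ≠ 0 := by
    intro h; rw [h, mul_zero] at h0; exact zero_ne_one h0
  have hinv : normFactor (extendParam b) M = 1 / ∑ T, weight b T := by
    field_simp; exact h0
  refine ⟨?_, lt_of_le_of_ne (Finset.sum_nonneg fun T _ => (weight_pos hb T).le) hpos.symm⟩
  rw [← h1, quenchedExp, hinv, Finset.mul_sum]
  refine Finset.sum_congr rfl fun T _ => ?_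
  ring

theorem quenchedExp_add (b : Fin M → ℝ) (X Y : DominoTiling M → ℝ) :
    quenchedExp b (fun T => X T + Y T) = quenchedExp b X + quenchedExp b Y := by
  simp only [quenchedExp, mul_add, Finset.sum_add_distrib]

theorem quenchedExp_const_mul (b : Fin M → ℝ) (c : ℝ) (X : DominoTiling M → ℝ) :
    quenchedExp b (fun T => c * X T) = c * quenchedExp b X := by
  simp only [quenchedExp, Finset.mul_sum]
  refine Finset.sum_congr rfl fun T _ => by ring

theorem quenchedExp_coeff {b : Fin M → ℝ} (hb : ∀ t, 0 < b t ∧ b t < 1) {N : ℕ} (hN0 : 0 < N)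
    (hN : N ≤ M) (k m : ℕ) :
    quenchedExp b (fun T =>
      (∏ p ∈ T.particles N, (1 + Polynomial.C ((p : ℝ) ^ k) * Polynomial.X)).coeff m) =
      (detPoly (momentMatrix (extendParam b) N (M - N) k N)).coeff m := by
  have : ∑ T, (weight b T / (∑ T', weight b T')) •
        (∏ p ∈ T.particles N, (1 + Polynomial.C ((p : ℝ) ^ k) * Polynomial.X)) =
      detPoly (momentMatrix (extendParam b) N (M - N) k N) := by
    refine Polynomial.funext fun x => ?_
    rw [eval_detPoly, ← (quenchedExp_prod hb hN0 hN k x).1, Polynomial.eval_finsetSum, quenchedExp]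
    refine Finset.sum_congr rfl fun T _ => ?_
    rw [Polynomial.eval_smul, Polynomial.eval_prod, smul_eq_mul]
    congr 1
    refine Finset.prod_congr rfl fun p _ => ?_
    simp only [Polynomial.eval_add, Polynomial.eval_one, Polynomial.eval_mul, Polynomial.eval_C,
      Polynomial.eval_X]
    ring
  rw [← this, Polynomial.finsetSum_coeff, quenchedExp]
  simp only [Polynomial.coeff_smul, smul_eq_mul]

theorem quenchedExp_rowSum {b : Fin M → ℝ} (hb : ∀ t, 0 < b t ∧ b t < 1) {N : ℕ} (hN0 : 0 < N)
    (hN : N ≤ M) (k : ℕ) :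
    quenchedExp b (rowSum N k) = (momentMatrix (extendParam b) N (M - N) k N).trace := by
  rw [← coeff_one_detPoly, ← quenchedExp_coeff hb hN0 hN k 1]
  congr 1
  ext T
  exact (coeff_prod_one_add_C_mul_X _ _).2.1.symm

theorem quenchedExp_rowSum_sq {b : Fin M → ℝ} (hb : ∀ t, 0 < b t ∧ b t < 1) {N : ℕ} (hN0 : 0 < N)
    (hN : N ≤ M) (k : ℕ) :
    quenchedExp b (fun T => rowSum N k T ^ 2) =
      (momentMatrix (extendParam b) N (M - N) k N).trace ^ 2
      - (momentMatrix (extendParam b) N (M - N) k N *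
          momentMatrix (extendParam b) N (M - N) k N).trace
      + (momentMatrix (extendParam b) N (M - N) (2 * k) N).trace := by
  rw [← coeff_two_detPoly, ← quenchedExp_coeff hb hN0 hN k 2, ← quenchedExp_rowSum hb hN0 hN,
    ← quenchedExp_const_mul, ← quenchedExp_add]
  congr 1
  ext T
  rw [(coeff_prod_one_add_C_mul_X _ _).2.2, rowSum, rowSum]
  have : ∑ p ∈ T.particles N, (p : ℝ) ^ (2 * k) = ∑ p ∈ T.particles N, ((p : ℝ) ^ k) ^ 2 :=
    Finset.sum_congr rfl fun p _ => by rw [mul_comm 2 k, pow_mul]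
  rw [this]; ring

end DominoTiling

/-! ### Matrix elements of powers as path sums -/

/-- The sum over lattice paths of length `k` from `i` to `i + d` with steps at most `1`; the weight of
a step from `i` is `i + 1` if it is upward, `i + c 0` if it is level, and `c m` if it goes down
by `m`. -/
noncomputable def pathSum (c : ℕ → ℝ) : ℕ → ℤ → ℤ → ℝ
  | 0, d, _ => if d = 0 then 1 else 0
  | k + 1, d, i => ((i : ℝ) + 1) * pathSum c k (d - 1) (i + 1) + (i : ℝ) * pathSum c k d i +
      ∑ m ∈ Finset.range (k + 1 - d).toNat, c m * pathSum c k (d + m) (i - m)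

theorem pathSum_eq_zero_of_lt (c : ℕ → ℝ) {k : ℕ} {d : ℤ} (hd : (k : ℤ) < d) (i : ℤ) :
    pathSum c k d i = 0 := by
  induction k generalizing d i with
  | zero => rw [pathSum, if_neg]; simp at hd; omega
  | succ k ih =>
    push_cast at hd
    rw [pathSum, ih (by omega), ih (by omega), Finset.sum_eq_zero]
    · ring
    · intro m hm
      rw [ih (by omega), mul_zero]

/-- Paths cannot return from the negative half-line, because the upward step from `-1` has
weight zero. -/
theorem pathSum_eq_zero_of_neg (c : ℕ → ℝ) {k : ℕ} {d i : ℤ} (hi : i < 0) (hd : 0 ≤ i + d) :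
    pathSum c k d i = 0 := by
  induction k generalizing d i with
  | zero => rw [pathSum, if_neg]; omega
  | succ k ih =>
    rw [pathSum, ih hi hd, Finset.sum_eq_zero]
    · rcases (by omega : i = -1 ∨ i + 1 < 0) with rfl | h
      · simp
      · rw [ih h (by omega)]; ring
    · intro m _
      rw [ih (by omega) (by omega), mul_zero]

theorem conjVar_X_pow (b : ℕ → ℝ) (N r i : ℕ) :
    conjVar b N r (Polynomial.X ^ i) = ((i : ℝ) + 1) • Polynomial.X ^ (i + 1) +
      (i : ℝ) • Polynomial.X ^ i + ∑ m ∈ Finset.range (i + 1),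
        (∑ t ∈ Finset.range r, jumpCoeff (b (N + t)) m) • Polynomial.X ^ (i - m) := by
  rw [conjVar, LinearMap.add_apply, mulVar_X_pow, LinearMap.sum_apply]
  congr 1
  simp only [jumpOp_X_pow, Finset.sum_smul]
  rw [Finset.sum_comm, ← Finset.sum_range_reflect]
  refine Finset.sum_congr rfl fun m hm => Finset.sum_congr rfl fun t _ => ?_
  rw [Finset.mem_range] at hm
  rw [show i + 1 - 1 - m = i - m by omega, show i - (i - m) = m by omega]

/-- The matrix elements of a power of `conjVar`. Steps to negative indices, which the truncation
of polynomials excludes, are harmless by `pathSum_eq_zero_of_neg`. -/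
theorem coeff_conjVar_pow (b : ℕ → ℝ) (N r k i j : ℕ) :
    ((conjVar b N r ^ k) (Polynomial.X ^ i)).coeff j =
      pathSum (fun m => ∑ t ∈ Finset.range r, jumpCoeff (b (N + t)) m) k ((j : ℤ) - i) i := by
  set c : ℕ → ℝ := fun m => ∑ t ∈ Finset.range r, jumpCoeff (b (N + t)) m with hc
  induction k generalizing i with
  | zero =>
    rw [pow_zero, Module.End.one_apply, Polynomial.coeff_X_pow, pathSum]
    congr 1
    simp only [eq_iff_iff]; omega
  | succ k ih =>
    rw [pow_succ, Module.End.mul_apply, conjVar_X_pow]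
    simp only [map_add, map_smul, map_sum, Polynomial.coeff_add, Polynomial.coeff_smul,
      Polynomial.finsetSum_coeff, smul_eq_mul, ih]
    rw [pathSum]
    congr 1
    · congr 1
      push_cast
      rw [show (j : ℤ) - (i + 1) = j - i - 1 by ring]
    · -- both sums extend to a common range, the additional terms being zero
      have h1 : ∑ m ∈ Finset.range (i + 1),
            c m * pathSum c k ((j : ℤ) - ((i - m : ℕ) : ℤ)) ((i - m : ℕ) : ℤ) =
          ∑ m ∈ Finset.range (i + 1), c m * pathSum c k ((j : ℤ) - i + m) ((i : ℤ) - m) := by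
        refine Finset.sum_congr rfl fun m hm => ?_
        rw [Finset.mem_range] at hm
        rw [show ((i - m : ℕ) : ℤ) = (i : ℤ) - m by omega,
          show (j : ℤ) - ((i : ℤ) - m) = j - i + m by ring]
      refine h1.trans ?_
      have h2 : Finset.range (i + 1) ⊆ Finset.range (i + k + 2) := by
        intro x; simp only [Finset.mem_range]; omega
      have h3 : Finset.range ((k : ℤ) + 1 - ((j : ℤ) - i)).toNat ⊆ Finset.range (i + k + 2) := by
        intro x; simp only [Finset.mem_range]; omega
      rw [Finset.sum_subset h2, Finset.sum_subset h3]
      · intro m _ hm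
        rw [Finset.mem_range] at hm
        rw [pathSum_eq_zero_of_lt c (by omega), mul_zero]
      · intro m _ hm
        rw [Finset.mem_range] at hm
        rw [pathSum_eq_zero_of_neg c (by omega) (by omega), mul_zero]

/-- Path sums grow at most like the `k`-th power of the scale. -/
theorem exists_pathSum_bound (k : ℕ) (d : ℤ) (a : ℝ) : ∃ C : ℝ, 0 ≤ C ∧ ∀ (c : ℕ → ℝ) (R : ℝ),
    1 ≤ R → (∀ m, |c m| ≤ R) → ∀ i : ℤ, |(i : ℝ)| ≤ a * R → |pathSum c k d i| ≤ C * R ^ k := by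
  induction k generalizing d a with
  | zero =>
    refine ⟨1, zero_le_one, fun c R _ _ i _ => ?_⟩
    rw [pathSum]
    split_ifs <;> simp
  | succ k ih =>
    choose C hC0 hC using ih
    refine ⟨(|a| + 1) * C (d - 1) (a + 1) + |a| * C d a +
      ∑ m ∈ Finset.range (k + 1 - d).toNat, C (d + m) (a + m), ?_, ?_⟩
    · have := hC0 (d - 1) (a + 1)
      have := hC0 d a
      have := Finset.sum_nonneg (s := Finset.range (k + 1 - d).toNat)
        (f := fun m : ℕ => C (d + m) (a + m)) (fun m _ => hC0 _ _)
      positivity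
    · intro c R hR hc i hi
      have hR0 : 0 ≤ R := by linarith
      have haR : a * R ≤ |a| * R := mul_le_mul_of_nonneg_right (le_abs_self a) hR0
      have h1 : |((i : ℝ) + 1) * pathSum c k (d - 1) (i + 1)| ≤
          ((|a| + 1) * R) * (C (d - 1) (a + 1) * R ^ k) := by
        have h : |(i : ℝ) + 1| ≤ (a + 1) * R := by
          have := abs_add_le (i : ℝ) 1
          rw [abs_one] at this
          linarith
        rw [abs_mul]
        refine mul_le_mul (by linarith) (hC _ _ c R hR hc _ (by push_cast; exact h)) (abs_nonneg _)
          (by positivity)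
      have h2 : |(i : ℝ) * pathSum c k d i| ≤ (|a| * R) * (C d a * R ^ k) := by
        rw [abs_mul]
        exact mul_le_mul (by linarith) (hC _ _ c R hR hc _ hi) (abs_nonneg _) (by positivity)
      have h3 : |∑ m ∈ Finset.range (k + 1 - d).toNat, c m * pathSum c k (d + m) (i - m)| ≤
          ∑ m ∈ Finset.range (k + 1 - d).toNat, R * (C (d + m) (a + m) * R ^ k) := by
        refine (Finset.abs_sum_le_sum_abs _ _).trans (Finset.sum_le_sum fun m _ => ?_)
        rw [abs_mul]
        refine mul_le_mul (hc m) (hC _ _ c R hR hc _ ?_) (abs_nonneg _) hR0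
        push_cast
        have := abs_sub (i : ℝ) m
        rw [Nat.abs_cast] at this
        have : (m : ℝ) ≤ m * R := le_mul_of_one_le_right (Nat.cast_nonneg m) hR
        linarith
      rw [pathSum]
      refine (abs_add_le _ _).trans ((add_le_add (abs_add_le _ _) le_rfl).trans
        ((add_le_add (add_le_add h1 h2) h3).trans (le_of_eq ?_)))
      rw [← Finset.mul_sum, ← Finset.sum_mul]
      ring

/-- Path sums depend on the step weights in a Lipschitz way. -/
theorem exists_pathSum_lipschitz (k : ℕ) (d : ℤ) (a : ℝ) : ∃ C : ℝ, 0 ≤ C ∧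
    ∀ (c c' : ℕ → ℝ) (R δ : ℝ), 1 ≤ R → 0 ≤ δ → (∀ m, |c m| ≤ R) → (∀ m, |c' m| ≤ R) →
    (∀ m : ℕ, |c m - c' m| ≤ (2 * m + 1) * δ) → ∀ i : ℤ, |(i : ℝ)| ≤ a * R →
    R * |pathSum c k d i - pathSum c' k d i| ≤ C * R ^ k * δ := by
  induction k generalizing d a with
  | zero =>
    refine ⟨0, le_rfl, fun c c' R δ _ _ _ _ _ i _ => ?_⟩
    simp [pathSum]
  | succ k ih =>
    choose C hC0 hC using ih
    choose K hK0 hK using exists_pathSum_bound k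
    refine ⟨(|a| + 1) * C (d - 1) (a + 1) + |a| * C d a +
      ∑ m ∈ Finset.range (k + 1 - d).toNat,
        ((2 * m + 1) * K (d + m) (a + m) + C (d + m) (a + m)), ?_, ?_⟩
    · have := hC0 (d - 1) (a + 1)
      have := hC0 d a
      have := Finset.sum_nonneg (s := Finset.range (k + 1 - d).toNat)
        (f := fun m : ℕ => (2 * (m : ℝ) + 1) * K (d + m) (a + m) + C (d + m) (a + m))
        (fun m _ => by have := hC0 (d + m) (a + m); have := hK0 (d + m) (a + m); positivity)
      positivity
    · intro c c' R δ hR hδ hc hc' hcc i hi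
      have hR0 : 0 ≤ R := by linarith
      have haR : a * R ≤ |a| * R := mul_le_mul_of_nonneg_right (le_abs_self a) hR0
      have h1 : R * |((i : ℝ) + 1) * (pathSum c k (d - 1) (i + 1) - pathSum c' k (d - 1) (i + 1))| ≤
          ((|a| + 1) * R) * (C (d - 1) (a + 1) * R ^ k * δ) := by
        have h : |(i : ℝ) + 1| ≤ (a + 1) * R := by
          have := abs_add_le (i : ℝ) 1
          rw [abs_one] at this
          linarith
        rw [abs_mul, mul_left_comm]
        refine mul_le_mul (by linarith)
          (hC _ _ c c' R δ hR hδ hc hc' hcc _ (by push_cast; exact h)) (by positivity)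
          (by positivity)
      have h2 : R * |(i : ℝ) * (pathSum c k d i - pathSum c' k d i)| ≤
          (|a| * R) * (C d a * R ^ k * δ) := by
        rw [abs_mul, mul_left_comm]
        exact mul_le_mul (by linarith) (hC _ _ c c' R δ hR hδ hc hc' hcc _ hi) (by positivity)
          (by positivity)
      have h3 : R * |∑ m ∈ Finset.range (k + 1 - d).toNat,
            (c m * pathSum c k (d + m) (i - m) - c' m * pathSum c' k (d + m) (i - m))| ≤
          ∑ m ∈ Finset.range (k + 1 - d).toNat,
            (R * ((2 * m + 1) * δ * (K (d + m) (a + m) * R ^ k)) +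
              R * (C (d + m) (a + m) * R ^ k * δ)) := by
        refine (mul_le_mul_of_nonneg_left (Finset.abs_sum_le_sum_abs _ _) hR0).trans ?_
        rw [Finset.mul_sum]
        refine Finset.sum_le_sum fun m _ => ?_
        have him : |((i - m : ℤ) : ℝ)| ≤ (a + m) * R := by
          push_cast
          have := abs_sub (i : ℝ) m
          rw [Nat.abs_cast] at this
          have : (m : ℝ) ≤ m * R := le_mul_of_one_le_right (Nat.cast_nonneg m) hR
          linarith
        have e : c m * pathSum c k (d + m) (i - m) - c' m * pathSum c' k (d + m) (i - m) =
            (c m - c' m) * pathSum c k (d + m) (i - m) +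
              c' m * (pathSum c k (d + m) (i - m) - pathSum c' k (d + m) (i - m)) := by ring
        rw [e]
        refine (mul_le_mul_of_nonneg_left (abs_add_le _ _) hR0).trans ?_
        rw [mul_add, abs_mul, abs_mul]
        refine add_le_add ?_ ?_
        · refine mul_le_mul_of_nonneg_left ?_ hR0
          exact mul_le_mul (hcc m) (hK _ _ c R hR hc _ him) (abs_nonneg _) (by positivity)
        · rw [mul_left_comm]
          exact mul_le_mul (hc' m) (hC _ _ c c' R δ hR hδ hc hc' hcc _ him) (by positivity) hR0
      have e : pathSum c (k + 1) d i - pathSum c' (k + 1) d i =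
          ((i : ℝ) + 1) * (pathSum c k (d - 1) (i + 1) - pathSum c' k (d - 1) (i + 1)) +
          (i : ℝ) * (pathSum c k d i - pathSum c' k d i) +
          ∑ m ∈ Finset.range (k + 1 - d).toNat,
            (c m * pathSum c k (d + m) (i - m) - c' m * pathSum c' k (d + m) (i - m)) := by
        rw [pathSum, pathSum, Finset.sum_sub_distrib]; ring
      rw [e]
      refine (mul_le_mul_of_nonneg_left ((abs_add_le _ _).trans
        (add_le_add (abs_add_le _ _) le_rfl)) hR0).trans ?_
      rw [mul_add, mul_add]
      have e4 : ∑ m ∈ Finset.range (k + 1 - d).toNat,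
            (R * ((2 * m + 1) * δ * (K (d + m) (a + m) * R ^ k)) +
              R * (C (d + m) (a + m) * R ^ k * δ)) =
          (∑ m ∈ Finset.range (k + 1 - d).toNat,
            ((2 * m + 1) * K (d + m) (a + m) + C (d + m) (a + m))) * (R ^ (k + 1) * δ) := by
        rw [Finset.sum_mul]
        exact Finset.sum_congr rfl fun m _ => by ring
      refine (add_le_add (add_le_add h1 h2) h3).trans (le_of_eq ?_)
      rw [e4]
      ring

/-- The scaling limit of path sums. -/
noncomputable def pathLimit (γ : ℕ → ℝ) : ℕ → ℤ → ℝ → ℝ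
  | 0, d, _ => if d = 0 then 1 else 0
  | k + 1, d, x => x * pathLimit γ k (d - 1) x + x * pathLimit γ k d x +
      ∑ m ∈ Finset.range (k + 1 - d).toNat, γ m * pathLimit γ k (d + m) x

theorem tendsto_pathSum {c : ℕ → ℕ → ℝ} {γ : ℕ → ℝ}
    (hc : ∀ m, Tendsto (fun M : ℕ => c M m / M) atTop (𝓝 (γ m))) (k : ℕ) (d : ℤ) {i : ℕ → ℤ} {x : ℝ}
    (hi : Tendsto (fun M : ℕ => (i M : ℝ) / M) atTop (𝓝 x)) :
    Tendsto (fun M : ℕ => pathSum (c M) k d (i M) / (M : ℝ) ^ k) atTop (𝓝 (pathLimit γ k d x)) := by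
  have hconst : ∀ a : ℝ, Tendsto (fun M : ℕ => a / (M : ℝ)) atTop (𝓝 0) :=
    fun a => tendsto_const_div_atTop_nhds_zero_nat a
  induction k generalizing d i with
  | zero => simp [pathSum, pathLimit]
  | succ k ih =>
    have hi1 : Tendsto (fun M : ℕ => ((i M + 1 : ℤ) : ℝ) / M) atTop (𝓝 x) := by
      have := hi.add (hconst 1)
      rw [add_zero] at this
      refine this.congr fun M => ?_
      push_cast; ring
    have him : ∀ m : ℕ, Tendsto (fun M : ℕ => ((i M - m : ℤ) : ℝ) / M) atTop (𝓝 x) := by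
      intro m
      have := hi.sub (hconst m)
      rw [sub_zero] at this
      refine this.congr fun M => ?_
      push_cast; ring
    have h := ((hi1.mul (ih (d - 1) hi1)).add (hi.mul (ih d hi))).add
      (tendsto_finsetSum (Finset.range (k + 1 - d).toNat)
        fun m _ => (hc m).mul (ih (d + m) (him m)))
    rw [pathLimit]
    refine h.congr fun M => ?_
    rw [pathSum, add_div, add_div, Finset.sum_div, pow_succ']
    push_cast
    simp only [div_mul_div_comm]

/-! ### Second moment estimates -/

theorem jumpCoeff_abs_le {b : ℝ} (h0 : 0 ≤ b) (h1 : b ≤ 1) (m : ℕ) : |jumpCoeff b m| ≤ 1 := by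
  cases m with
  | zero => rw [jumpCoeff, abs_of_nonneg h0]; exact h1
  | succ m =>
    rw [jumpCoeff, abs_mul, abs_mul, abs_pow, abs_neg, abs_of_nonneg h0,
      abs_of_nonneg (sub_nonneg.2 h1)]
    have h2 : b * (1 - b) ≤ 1 := by nlinarith
    have h3 : b ^ m ≤ 1 := pow_le_one₀ h0 h1
    exact mul_le_one₀ h2 (pow_nonneg h0 m) h3

theorem jumpCoeff_lipschitz {b b' : ℝ} (h0 : 0 ≤ b) (h1 : b ≤ 1) (h0' : 0 ≤ b') (h1' : b' ≤ 1)
    (m : ℕ) : |jumpCoeff b m - jumpCoeff b' m| ≤ (2 * m + 1) * |b - b'| := by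
  have hpow : ∀ n : ℕ, |b ^ n - b' ^ n| ≤ n * |b - b'| := by
    intro n
    have h := abs_pow_sub_pow_le b b' n
    have h2 : max |b| |b'| ≤ 1 := by
      rw [abs_of_nonneg h0, abs_of_nonneg h0']; exact max_le h1 h1'
    have h3 : max |b| |b'| ^ (n - 1) ≤ 1 := pow_le_one₀ (le_max_of_le_left (abs_nonneg _)) h2
    calc |b ^ n - b' ^ n| ≤ |b - b'| * n * max |b| |b'| ^ (n - 1) := h
      _ ≤ |b - b'| * n * 1 := mul_le_mul_of_nonneg_left h3 (by positivity)
      _ = n * |b - b'| := by ring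
  cases m with
  | zero => simp [jumpCoeff]
  | succ m =>
    have e : jumpCoeff b (m + 1) - jumpCoeff b' (m + 1) =
        (-1) ^ m * ((b ^ (m + 1) - b' ^ (m + 1)) - (b ^ (m + 2) - b' ^ (m + 2))) := by
      rw [jumpCoeff, jumpCoeff, neg_pow b, neg_pow b']; ring
    rw [e, abs_mul, abs_pow, abs_neg, abs_one, one_pow, one_mul]
    refine (abs_sub _ _).trans ((add_le_add (hpow _) (hpow _)).trans (le_of_eq ?_))
    push_cast; ring

theorem trace_momentMatrix (b : ℕ → ℝ) (N r k n : ℕ) :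
    (momentMatrix b N r k n).trace = ∑ i ∈ Finset.range n,
      pathSum (fun m => ∑ t ∈ Finset.range r, jumpCoeff (b (N + t)) m) k 0 i := by
  rw [Matrix.trace, Finset.sum_range]
  refine Finset.sum_congr rfl fun i _ => ?_
  rw [Matrix.diag_apply, momentMatrix, Matrix.of_apply, coeff_conjVar_pow, sub_self]

/-- The variance of a power sum, as a boundary term: only the matrix elements close to the corner
`(n, n)` contribute. -/
theorem trace_momentMatrix_sub (b : ℕ → ℝ) (N r k n : ℕ) :
    (momentMatrix b N r (2 * k) n).trace - (momentMatrix b N r k n * momentMatrix b N r k n).trace =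
      ∑ i ∈ Finset.range n, ∑ j ∈ Finset.Ico n (n + k),
        ((conjVar b N r ^ k) (Polynomial.X ^ i)).coeff j *
          ((conjVar b N r ^ k) (Polynomial.X ^ j)).coeff i := by
  have h1 : ∀ i < n, ((conjVar b N r ^ (2 * k)) (Polynomial.X ^ i)).coeff i =
      ∑ j ∈ Finset.range (n + k), ((conjVar b N r ^ k) (Polynomial.X ^ i)).coeff j *
          ((conjVar b N r ^ k) (Polynomial.X ^ j)).coeff i := by
    intro i hi
    have h2 : (conjVar b N r ^ k) (Polynomial.X ^ i) = ∑ j ∈ Finset.range (n + k),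
        ((conjVar b N r ^ k) (Polynomial.X ^ i)).coeff j • Polynomial.X ^ j := by
      ext m
      rw [Polynomial.finsetSum_coeff]
      simp only [Polynomial.coeff_smul, Polynomial.coeff_X_pow, smul_eq_mul, mul_ite, mul_one,
        mul_zero, Finset.sum_ite_eq, Finset.mem_range]
      split_ifs with h
      · rfl
      · rw [coeff_conjVar_pow, pathSum_eq_zero_of_lt]; omega
    rw [two_mul, pow_add, Module.End.mul_apply]
    conv_lhs => rw [h2]
    simp only [map_sum, map_smul, Polynomial.finsetSum_coeff, Polynomial.coeff_smul, smul_eq_mul]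
  rw [Matrix.trace, Matrix.trace, ← Finset.sum_sub_distrib, Finset.sum_range]
  refine Finset.sum_congr rfl fun i _ => ?_
  rw [Matrix.diag_apply, Matrix.diag_apply, Matrix.mul_apply]
  simp only [momentMatrix, Matrix.of_apply]
  rw [h1 i i.2, Finset.range_eq_Ico, ← Finset.sum_Ico_consecutive _ (Nat.zero_le n)
    (Nat.le_add_right n k), ← Finset.range_eq_Ico, Finset.sum_range]
  ring

/-- The variance of a power sum is a sum of boundedly many products of matrix elements, each of them
at most of the order of the `k`-th power of the scale. -/
theorem exists_variance_bound (k : ℕ) : ∃ C : ℝ, 0 ≤ C ∧ ∀ (b : ℕ → ℝ) (N r : ℕ) (R : ℝ), 1 ≤ R →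
    (N : ℝ) ≤ R → (r : ℝ) ≤ R → (∀ t, 0 ≤ b t ∧ b t ≤ 1) →
    (momentMatrix b N r (2 * k) N).trace -
      (momentMatrix b N r k N * momentMatrix b N r k N).trace ≤ C * R ^ (2 * k) := by
  choose K hK0 hK using exists_pathSum_bound k
  -- a bound for all matrix elements at distance at most `k` from the diagonal
  let D : ℝ := ∑ d ∈ Finset.Icc (-(k : ℤ)) k, K d (k + 1)
  have hD0 : 0 ≤ D := Finset.sum_nonneg fun d _ => hK0 _ _
  have hKD : ∀ d : ℤ, -(k : ℤ) ≤ d → d ≤ k → K d (k + 1) ≤ D := fun d h1 h2 =>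
    Finset.single_le_sum (f := fun d => K d ((k : ℝ) + 1)) (fun d _ => hK0 _ _)
      (Finset.mem_Icc.2 ⟨h1, h2⟩)
  refine ⟨k * (k * D ^ 2), by positivity, fun b N r R hR hN hr hb => ?_⟩
  have hc : ∀ m, |∑ t ∈ Finset.range r, jumpCoeff (b (N + t)) m| ≤ R := by
    intro m
    refine (Finset.abs_sum_le_sum_abs _ _).trans ((Finset.sum_le_sum fun t _ =>
      jumpCoeff_abs_le (hb (N + t)).1 (hb (N + t)).2 m).trans ?_)
    simpa using hr
  have hentry : ∀ i j : ℕ, i < N + k → -(k : ℤ) ≤ (j : ℤ) - i → (j : ℤ) - i ≤ k →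
      |((conjVar b N r ^ k) (Polynomial.X ^ i)).coeff j| ≤ D * R ^ k := by
    intro i j hi h1 h2
    rw [coeff_conjVar_pow]
    refine (hK _ (k + 1) _ R hR hc i ?_).trans
      (mul_le_mul_of_nonneg_right (hKD _ h1 h2) (by positivity))
    have h3 : (i : ℝ) ≤ N + k := by exact_mod_cast hi.le
    have h4 : (k : ℝ) ≤ k * R := le_mul_of_one_le_right (Nat.cast_nonneg k) hR
    rw [Int.cast_natCast, abs_of_nonneg (Nat.cast_nonneg i)]
    linarith
  rw [trace_momentMatrix_sub, Finset.sum_comm]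
  have hinner : ∀ j ∈ Finset.Ico N (N + k), ∑ i ∈ Finset.range N,
      ((conjVar b N r ^ k) (Polynomial.X ^ i)).coeff j *
        ((conjVar b N r ^ k) (Polynomial.X ^ j)).coeff i ≤ k * (D ^ 2 * R ^ (2 * k)) := by
    intro j hj
    rw [Finset.mem_Ico] at hj
    have hsub : Finset.Ico (N - k) N ⊆ Finset.range N := by
      intro x; simp only [Finset.mem_Ico, Finset.mem_range]; omega
    rw [← Finset.sum_subset hsub]
    · refine (Finset.sum_le_card_nsmul _ _ (D ^ 2 * R ^ (2 * k)) fun i hi => ?_).trans ?_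
      · rw [Finset.mem_Ico] at hi
        by_cases hij : (j : ℤ) - i ≤ k
        · refine (le_abs_self _).trans ?_
          rw [abs_mul]
          refine (mul_le_mul (hentry i j (by omega) (by omega) hij)
            (hentry j i (by omega) (by omega) (by omega)) (abs_nonneg _)
            (by positivity)).trans (le_of_eq (by ring))
        · rw [coeff_conjVar_pow _ _ _ _ i j, pathSum_eq_zero_of_lt _ (by omega), zero_mul]
          positivity
      · rw [nsmul_eq_mul]
        refine mul_le_mul_of_nonneg_right ?_ (by positivity)
        rw [Nat.card_Ico]
        exact_mod_cast (by omega : N - (N - k) ≤ k)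
    · intro i hi hi'
      rw [Finset.mem_Ico] at hi'
      rw [Finset.mem_range] at hi
      rw [coeff_conjVar_pow _ _ _ _ i j, pathSum_eq_zero_of_lt _ (by omega), zero_mul]
  refine (Finset.sum_le_card_nsmul _ _ _ hinner).trans (le_of_eq ?_)
  rw [Nat.card_Ico, nsmul_eq_mul, Nat.add_sub_cancel_left]
  ring

/-- The mean of a power sum for constant parameters. -/
noncomputable def constMean (β : ℝ) (M N k : ℕ) : ℝ :=
  ∑ i ∈ Finset.range N, pathSum (fun m => ((M - N : ℕ) : ℝ) * jumpCoeff β m) k 0 i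

/-- The cost of replacing the parameters by a constant in the mean of a power sum. -/
theorem exists_mean_bound (k : ℕ) : ∃ C : ℝ, 0 ≤ C ∧ ∀ (b : ℕ → ℝ) (β : ℝ) (M N : ℕ),
    0 < M → N ≤ M → (∀ t, 0 ≤ b t ∧ b t ≤ 1) → 0 ≤ β → β ≤ 1 →
    |(momentMatrix b N (M - N) k N).trace - constMean β M N k| ≤
      C * (M : ℝ) ^ k * ∑ t ∈ Finset.range M, |b t - β| := by
  obtain ⟨C, hC0, hC⟩ := exists_pathSum_lipschitz k 0 1
  refine ⟨C, hC0, fun b β M N hM hN hb hβ0 hβ1 => ?_⟩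
  have hM1 : (1 : ℝ) ≤ M := by exact_mod_cast hM
  set δ := ∑ t ∈ Finset.range M, |b t - β| with hδ
  have hδ0 : 0 ≤ δ := Finset.sum_nonneg fun t _ => abs_nonneg _
  have hδ' : ∑ t ∈ Finset.range (M - N), |b (N + t) - β| ≤ δ := by
    have h1 : ∑ t ∈ Finset.range (M - N), |b (N + t) - β| = ∑ t ∈ Finset.Ico N M, |b t - β| := by
      rw [Finset.sum_Ico_eq_sum_range]
    rw [h1]
    refine Finset.sum_le_sum_of_subset_of_nonneg ?_ fun t _ _ => abs_nonneg _
    intro x; simp only [Finset.mem_Ico, Finset.mem_range]; omega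
  have hr : ((M - N : ℕ) : ℝ) ≤ M := by exact_mod_cast Nat.sub_le M N
  rw [trace_momentMatrix, constMean, ← Finset.sum_sub_distrib]
  have hterm : ∀ i ∈ Finset.range N,
      |pathSum (fun m => ∑ t ∈ Finset.range (M - N), jumpCoeff (b (N + t)) m) k 0 i -
        pathSum (fun m => ((M - N : ℕ) : ℝ) * jumpCoeff β m) k 0 i| ≤
      C * (M : ℝ) ^ k * δ / M := by
    intro i hi
    rw [Finset.mem_range] at hi
    rw [le_div_iff₀ (by linarith), mul_comm _ (M : ℝ)]
    refine hC _ _ M δ hM1 hδ0 ?_ ?_ ?_ i ?_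
    · intro m
      refine (Finset.abs_sum_le_sum_abs _ _).trans ((Finset.sum_le_sum fun t _ =>
        jumpCoeff_abs_le (hb (N + t)).1 (hb (N + t)).2 m).trans ?_)
      simp
    · intro m
      rw [abs_mul, Nat.abs_cast]
      have := jumpCoeff_abs_le hβ0 hβ1 m
      nlinarith [Nat.cast_nonneg (α := ℝ) (M - N), abs_nonneg (jumpCoeff β m)]
    · intro m
      have e : ((M - N : ℕ) : ℝ) * jumpCoeff β m = ∑ t ∈ Finset.range (M - N), jumpCoeff β m := by
        simp
      rw [e, ← Finset.sum_sub_distrib]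
      refine (Finset.abs_sum_le_sum_abs _ _).trans ((Finset.sum_le_sum fun t _ =>
        jumpCoeff_lipschitz (hb (N + t)).1 (hb (N + t)).2 hβ0 hβ1 m).trans ?_)
      rw [← Finset.mul_sum]
      exact mul_le_mul_of_nonneg_left hδ' (by positivity)
    · rw [Int.cast_natCast, Nat.abs_cast, one_mul]
      exact_mod_cast (by omega : i ≤ M)
  refine (Finset.abs_sum_le_sum_abs _ _).trans ((Finset.sum_le_card_nsmul _ _ _ hterm).trans ?_)
  rw [Finset.card_range, nsmul_eq_mul]
  have hNM : (N : ℝ) ≤ M := by exact_mod_cast hN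
  calc (N : ℝ) * (C * (M : ℝ) ^ k * δ / M) ≤ M * (C * (M : ℝ) ^ k * δ / M) :=
        mul_le_mul_of_nonneg_right hNM (by positivity)
    _ = C * (M : ℝ) ^ k * δ := by field_simp

theorem div_pow_sq_le {x C A Q m : ℝ} {k : ℕ} (hm : 0 < m) (hx : |x| ≤ C * m ^ k * A)
    (hA : A ^ 2 ≤ m * Q) : (x / m ^ (k + 1)) ^ 2 ≤ C ^ 2 * (Q / m) := by
  have h7 : |x / m ^ (k + 1)| ≤ C * (A / m) := by
    rw [abs_div, abs_of_pos (by positivity : 0 < m ^ (k + 1)), div_le_iff₀ (by positivity)]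
    refine hx.trans (le_of_eq ?_)
    field_simp
    ring
  calc (x / m ^ (k + 1)) ^ 2 = |x / m ^ (k + 1)| ^ 2 := (sq_abs _).symm
    _ ≤ (C * (A / m)) ^ 2 := pow_le_pow_left₀ (abs_nonneg _) h7 2
    _ = C ^ 2 * (A ^ 2 / m ^ 2) := by ring
    _ ≤ C ^ 2 * ((m * Q) / m ^ 2) := by gcongr
    _ = C ^ 2 * (Q / m) := by field_simp

namespace DominoTiling

/-- Quenched second moment estimate for a normalized power sum, uniform in the parameters. -/
theorem exists_quenchedExp_bound (k : ℕ) : ∃ C : ℝ, 0 ≤ C ∧ ∀ (M N : ℕ) (b : Fin M → ℝ) (β a : ℝ),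
    0 < N → N ≤ M → (∀ t, 0 < b t ∧ b t < 1) → 0 < β → β < 1 →
    quenchedExp b (fun T => (rowSum N k T / (M : ℝ) ^ (k + 1) - a) ^ 2) ≤
      C / (M : ℝ) ^ 2 + C * ((∑ t, (b t - β) ^ 2) / M) +
        2 * (constMean β M N k / (M : ℝ) ^ (k + 1) - a) ^ 2 := by
  obtain ⟨C1, hC10, hC1⟩ := exists_variance_bound k
  obtain ⟨C2, hC20, hC2⟩ := exists_mean_bound k
  refine ⟨C1 + 2 * C2 ^ 2, by positivity, fun M N b β a hN0 hN hb hβ0 hβ1 => ?_⟩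
  have hM : 0 < M := by omega
  have hM1 : (1 : ℝ) ≤ M := by exact_mod_cast hM
  have hM0 : (0 : ℝ) < M := by linarith
  set bb := extendParam b with hbb
  have hb' : ∀ t, 0 ≤ bb t ∧ bb t ≤ 1 := by
    intro t
    rw [hbb, extendParam]
    split_ifs with h
    · exact ⟨(hb _).1.le, (hb _).2.le⟩
    · exact ⟨le_rfl, zero_le_one⟩
  set μ := (momentMatrix bb N (M - N) k N).trace with hμ
  set V := (momentMatrix bb N (M - N) (2 * k) N).trace -
      (momentMatrix bb N (M - N) k N * momentMatrix bb N (M - N) k N).trace with hV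
  have hsum1 : quenchedExp b (fun _ => 1) = 1 := by
    have h := (quenchedExp_prod hb hN0 hN 0 0).1
    simpa using h
  have e1 : quenchedExp b (fun T => (rowSum N k T / (M : ℝ) ^ (k + 1) - a) ^ 2) =
      V / (M : ℝ) ^ (2 * (k + 1)) + (μ / (M : ℝ) ^ (k + 1) - a) ^ 2 := by
    have h1 : (fun T : DominoTiling M => (rowSum N k T / (M : ℝ) ^ (k + 1) - a) ^ 2) =
        fun T => (1 / (M : ℝ) ^ (2 * (k + 1))) * rowSum N k T ^ 2 +
          ((-(2 * a / (M : ℝ) ^ (k + 1))) * rowSum N k T + a ^ 2 * 1) := by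
      ext T
      rw [pow_mul' (M : ℝ) 2 (k + 1)]
      field_simp
      ring
    rw [h1, quenchedExp_add, quenchedExp_add, quenchedExp_const_mul, quenchedExp_const_mul,
      quenchedExp_const_mul, hsum1, quenchedExp_rowSum_sq hb hN0 hN, quenchedExp_rowSum hb hN0 hN,
      ← hbb, ← hμ]
    rw [hV, pow_mul' (M : ℝ) 2 (k + 1)]
    field_simp
    ring
  rw [e1]
  have h2 : V / (M : ℝ) ^ (2 * (k + 1)) ≤ C1 / (M : ℝ) ^ 2 := by
    have := hC1 bb N (M - N) M hM1 (by exact_mod_cast hN) (by exact_mod_cast Nat.sub_le M N) hb'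
    rw [div_le_div_iff₀ (by positivity) (by positivity)]
    calc V * (M : ℝ) ^ 2 ≤ C1 * (M : ℝ) ^ (2 * k) * (M : ℝ) ^ 2 :=
          mul_le_mul_of_nonneg_right this (by positivity)
      _ = C1 * (M : ℝ) ^ (2 * (k + 1)) := by ring
  have h4 := hC2 bb β M N hM hN hb' hβ0.le hβ1.le
  have h5 : ∑ t ∈ Finset.range M, |bb t - β| = ∑ t : Fin M, |b t - β| := by
    rw [Finset.sum_range]
    exact Finset.sum_congr rfl fun t _ => by rw [hbb, extendParam_val]
  have h6 : (∑ t : Fin M, |b t - β|) ^ 2 ≤ M * ∑ t, (b t - β) ^ 2 := by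
    have := sq_sum_le_card_mul_sum_sq (s := (Finset.univ : Finset (Fin M)))
      (f := fun t => |b t - β|)
    simpa using this
  have h9 : 0 ≤ (∑ t, (b t - β) ^ 2) / (M : ℝ) :=
    div_nonneg (Finset.sum_nonneg fun t _ => sq_nonneg _) hM0.le
  rw [h5, ← hμ] at h4
  clear_value μ V
  clear hV hμ e1 hC1 hC2
  generalize ∑ t : Fin M, |b t - β| = A at *
  generalize ∑ t, (b t - β) ^ 2 = Q at *
  have h3 : ((μ - constMean β M N k) / (M : ℝ) ^ (k + 1)) ^ 2 ≤ C2 ^ 2 * (Q / M) :=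
    div_pow_sq_le hM0 h4 h6
  have h8 : (μ / (M : ℝ) ^ (k + 1) - a) ^ 2 ≤
      2 * ((μ - constMean β M N k) / (M : ℝ) ^ (k + 1)) ^ 2 +
        2 * (constMean β M N k / (M : ℝ) ^ (k + 1) - a) ^ 2 := by
    have e : μ / (M : ℝ) ^ (k + 1) - a = (μ - constMean β M N k) / (M : ℝ) ^ (k + 1) +
        (constMean β M N k / (M : ℝ) ^ (k + 1) - a) := by ring
    rw [e]
    nlinarith [sq_nonneg ((μ - constMean β M N k) / (M : ℝ) ^ (k + 1) -
        (constMean β M N k / (M : ℝ) ^ (k + 1) - a))]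
  have h10 : C1 / (M : ℝ) ^ 2 ≤ (C1 + 2 * C2 ^ 2) / (M : ℝ) ^ 2 := by
    gcongr
    have := sq_nonneg C2
    linarith
  have h11 := mul_nonneg hC10 h9
  linarith

end DominoTiling

/-! ### Limits of the moments -/

/-- Convergence of Riemann-type sums, from convergence along all sequences of indices. -/
theorem tendsto_sum_div {F : ℕ → ℕ → ℝ} {f : ℝ → ℝ} {C α : ℝ} {N : ℕ → ℕ} (hα0 : 0 < α)
    (hα1 : α < 1) (hN : Tendsto (fun M : ℕ => (N M : ℝ) / M) atTop (𝓝 α))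
    (hC : ∀ M i, 0 < M → i < M → |F M i| ≤ C)
    (hF : ∀ (i : ℕ → ℕ) (x : ℝ), Tendsto (fun M : ℕ => (i M : ℝ) / M) atTop (𝓝 x) →
      Tendsto (fun M => F M (i M)) atTop (𝓝 (f x))) :
    Tendsto (fun M : ℕ => (∑ i ∈ Finset.range (N M), F M i) / M) atTop
      (𝓝 (∫ x in Set.Ioo 0 α, f x)) := by
  let I : ℕ → ℕ → Set ℝ := fun M i => Set.Ico ((i : ℝ) / M) (((i : ℝ) + 1) / M)
  let g : ℕ → ℝ → ℝ := fun M x => ∑ i ∈ Finset.range (N M), (I M i).indicator (fun _ => F M i) x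
  have hmemI : ∀ (M i : ℕ) (x : ℝ), 0 < M → (x ∈ I M i ↔ 0 ≤ x ∧ ⌊x * M⌋₊ = i) := by
    intro M i x hM
    have hM' : (0 : ℝ) < M := by exact_mod_cast hM
    simp only [I, Set.mem_Ico, div_le_iff₀ hM', lt_div_iff₀ hM']
    constructor
    · rintro ⟨h1, h2⟩
      have hx : 0 ≤ x * M := le_trans (Nat.cast_nonneg i) h1
      exact ⟨nonneg_of_mul_nonneg_left hx hM', (Nat.floor_eq_iff hx).2 ⟨h1, h2⟩⟩
    · rintro ⟨h1, h2⟩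
      exact (Nat.floor_eq_iff (mul_nonneg h1 hM'.le)).1 h2
  have hg : ∀ (M : ℕ) (x : ℝ), 0 < M →
      g M x = if 0 ≤ x ∧ ⌊x * M⌋₊ < N M then F M ⌊x * M⌋₊ else 0 := by
    intro M x hM
    simp only [g, Set.indicator_apply, hmemI M _ x hM]
    by_cases hx : 0 ≤ x
    · simp [hx]
    · simp [hx]
  have hint : ∀ M : ℕ, 0 < M → ∫ x, g M x = (∑ i ∈ Finset.range (N M), F M i) / M := by
    intro M hM
    have hM' : (0 : ℝ) < M := by exact_mod_cast hM
    simp only [g]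
    rw [integral_finsetSum, Finset.sum_div]
    · refine Finset.sum_congr rfl fun i _ => ?_
      rw [integral_indicator_const _ measurableSet_Ico, Real.volume_real_Ico_of_le, smul_eq_mul]
      · field_simp; ring
      · gcongr; linarith
    · intro i _
      exact (integrable_indicator_iff measurableSet_Ico).2 (integrableOn_const (by simp))
  have hNM : ∀ᶠ M : ℕ in atTop, 0 < M ∧ N M ≤ M := by
    filter_upwards [hN.eventually (gt_mem_nhds hα1), eventually_gt_atTop 0] with M h1 h2
    have hM' : (0 : ℝ) < M := by exact_mod_cast h2
    rw [div_lt_one hM'] at h1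
    exact ⟨h2, by exact_mod_cast h1.le⟩
  have hlim : Tendsto (fun M => ∫ x, g M x) atTop
      (𝓝 (∫ x, (Set.Ioo 0 α).indicator f x)) := by
    refine tendsto_integral_filter_of_dominated_convergence
      ((Set.Ico (0 : ℝ) 1).indicator fun _ => C) ?_ ?_ ?_ ?_
    · refine Eventually.of_forall fun M => Measurable.aestronglyMeasurable ?_
      refine Finset.measurable_sum _ fun i _ => ?_
      exact measurable_const.indicator measurableSet_Ico
    · filter_upwards [hNM] with M hM
      refine Eventually.of_forall fun x => ?_
      have hM' : (0 : ℝ) < M := by exact_mod_cast hM.1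
      rw [hg M x hM.1, Real.norm_eq_abs]
      split_ifs with h
      · have h1 : ⌊x * M⌋₊ < M := lt_of_lt_of_le h.2 hM.2
        have h2 : x < 1 := by
          rw [Nat.floor_lt (mul_nonneg h.1 hM'.le)] at h1
          exact lt_of_mul_lt_mul_right (by linarith) hM'.le
        rw [Set.indicator_of_mem (show x ∈ Set.Ico (0 : ℝ) 1 from ⟨h.1, h2⟩)]
        exact hC M _ hM.1 h1
      · rw [abs_zero]
        refine Set.indicator_nonneg (fun _ _ => ?_) _
        exact (abs_nonneg _).trans (hC 1 0 one_pos one_pos)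
    · exact (integrable_indicator_iff measurableSet_Ico).2 (integrableOn_const (by simp))
    · have hae : ∀ᵐ x : ℝ, x ≠ 0 ∧ x ≠ α := by
        have h1 : ∀ᵐ x : ℝ, x ≠ 0 := by simp [ae_iff]
        have h2 : ∀ᵐ x : ℝ, x ≠ α := by simp [ae_iff]
        filter_upwards [h1, h2] with x h1 h2 using ⟨h1, h2⟩
      filter_upwards [hae] with x hx
      have hfloor : Tendsto (fun M : ℕ => ((⌊x * M⌋₊ : ℕ) : ℝ) / M) atTop (𝓝 (max x 0)) := by
        rcases le_total 0 x with h | h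
        · rw [max_eq_left h]
          exact (tendsto_nat_floor_mul_div_atTop h).comp tendsto_natCast_atTop_atTop
        · rw [max_eq_right h]
          refine tendsto_const_nhds.congr fun M => ?_
          rw [Nat.floor_of_nonpos (mul_nonpos_of_nonpos_of_nonneg h (Nat.cast_nonneg M))]
          simp
      by_cases hx0 : 0 < x
      · rw [max_eq_left hx0.le] at hfloor
        rcases lt_or_gt_of_ne hx.2 with h | h
        · rw [Set.indicator_of_mem (show x ∈ Set.Ioo 0 α from ⟨hx0, h⟩)]
          refine (hF _ x hfloor).congr' ?_
          filter_upwards [hNM, hfloor.eventually_lt hN h] with M hM h1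
          have hM' : (0 : ℝ) < M := by exact_mod_cast hM.1
          rw [hg M x hM.1, if_pos]
          refine ⟨hx0.le, ?_⟩
          rw [div_lt_div_iff_of_pos_right hM'] at h1
          exact_mod_cast h1
        · rw [Set.indicator_of_notMem (fun hh => absurd hh.2 (not_lt.2 h.le))]
          refine tendsto_const_nhds.congr' ?_
          filter_upwards [hNM, hN.eventually_lt hfloor h] with M hM h1
          have hM' : (0 : ℝ) < M := by exact_mod_cast hM.1
          rw [hg M x hM.1, if_neg]
          rintro ⟨-, h2⟩
          rw [div_lt_div_iff_of_pos_right hM'] at h1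
          have : N M < ⌊x * M⌋₊ := by exact_mod_cast h1
          omega
      · rw [Set.indicator_of_notMem (fun hh => hx0 hh.1)]
        refine tendsto_const_nhds.congr' ?_
        filter_upwards [hNM] with M hM
        rw [hg M x hM.1, if_neg]
        rintro ⟨h2, -⟩
        exact hx0 (lt_of_le_of_ne h2 (Ne.symm hx.1))
  rw [integral_indicator measurableSet_Ioo] at hlim
  refine hlim.congr' ?_
  filter_upwards [eventually_gt_atTop 0] with M hM using hint M hM

/-- The limit of the normalized power sums of the particle positions in the rows `N ~ α M`. -/
noncomputable def momentLimit (β α : ℝ) (k : ℕ) : ℝ :=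
  ∫ x in Set.Ioo 0 α, pathLimit (fun m => (1 - α) * jumpCoeff β m) k 0 x

theorem tendsto_constMean {β α : ℝ} (hβ0 : 0 < β) (hβ1 : β < 1) (hα0 : 0 < α) (hα1 : α < 1)
    {N : ℕ → ℕ} (hN : Tendsto (fun M : ℕ => (N M : ℝ) / M) atTop (𝓝 α)) (k : ℕ) :
    Tendsto (fun M : ℕ => constMean β M (N M) k / (M : ℝ) ^ (k + 1)) atTop
      (𝓝 (momentLimit β α k)) := by
  obtain ⟨C, hC0, hC⟩ := exists_pathSum_bound k 0 1
  have hγ : ∀ m, Tendsto (fun M : ℕ => ((M - N M : ℕ) : ℝ) * jumpCoeff β m / M) atTop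
      (𝓝 ((1 - α) * jumpCoeff β m)) := by
    intro m
    refine ((tendsto_const_nhds.sub hN).mul_const _).congr' ?_
    filter_upwards [hN.eventually (gt_mem_nhds hα1), eventually_gt_atTop 0] with M h1 h2
    have hM' : (0 : ℝ) < M := by exact_mod_cast h2
    rw [div_lt_one hM'] at h1
    rw [Nat.cast_sub (by exact_mod_cast h1.le)]
    field_simp
  have h := tendsto_sum_div (C := C) (f := pathLimit (fun m => (1 - α) * jumpCoeff β m) k 0)
    (F := fun M i => pathSum (fun m => ((M - N M : ℕ) : ℝ) * jumpCoeff β m) k 0 i / (M : ℝ) ^ k)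
    hα0 hα1 hN ?_ ?_
  · refine h.congr fun M => ?_
    rw [constMean, ← Finset.sum_div, div_div, pow_succ]
  · intro M i hM hi
    have hM1 : (1 : ℝ) ≤ M := by exact_mod_cast hM
    rw [abs_div, abs_of_pos (by positivity : (0 : ℝ) < (M : ℝ) ^ k), div_le_iff₀ (by positivity)]
    refine hC _ M hM1 (fun m => ?_) i ?_
    · rw [abs_mul, Nat.abs_cast]
      have h1 := jumpCoeff_abs_le hβ0.le hβ1.le m
      have h2 : ((M - N M : ℕ) : ℝ) ≤ M := by exact_mod_cast Nat.sub_le M (N M)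
      nlinarith [Nat.cast_nonneg (α := ℝ) (M - N M), abs_nonneg (jumpCoeff β m)]
    · rw [Int.cast_natCast, Nat.abs_cast, one_mul]
      exact_mod_cast hi.le
  · intro i x hi
    exact tendsto_pathSum hγ k 0 (i := fun M => (i M : ℤ)) (by simpa using hi)

/-! ### Empirical measures of the rows -/

namespace DominoTiling

variable {M : ℕ}

theorem finite_setOf_hasParticle (T : DominoTiling M) (N : ℕ) :
    (Set.ofPred (T.HasParticle N)).Finite :=
  (T.particles N).finite_toSet.subset fun _ hp => T.mem_particles.2 hp

theorem toFinset_hasParticle (T : DominoTiling M) (N : ℕ) :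
    (T.finite_setOf_hasParticle N).toFinset = T.particles N := by
  ext p
  rw [Set.Finite.mem_toFinset, mem_particles]
  rfl

/-- The shifted entries `λ_i + N - i` of the signature are the particle positions. -/
theorem signature_add (T : DominoTiling M) {N : ℕ} (hN : N ≤ M) (i : Fin N) :
    T.signature N i + (N - 1 - i) = Nat.nth (T.HasParticle N) (N - 1 - i) := by
  classical
  have h1 := Nat.count_nth_of_lt_card_finite (T.finite_setOf_hasParticle N) (n := N - 1 - i)
    (by rw [toFinset_hasParticle, T.card_particles hN]; have := i.2; omega)
  rw [Nat.count_eq_card_filter_range] at h1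
  have h2 := Finset.card_filter_add_card_filter_not
    (s := Finset.range (Nat.nth (T.HasParticle N) (N - 1 - i))) (T.HasParticle N)
  rw [h1, Finset.card_range, add_comm] at h2
  rw [← h2]
  congr 1

theorem sum_nth_hasParticle {E : Type*} [AddCommMonoid E] (T : DominoTiling M) {N : ℕ}
    (hN : N ≤ M) (f : ℕ → E) :
    ∑ i : Fin N, f (Nat.nth (T.HasParticle N) (N - 1 - i)) = ∑ p ∈ T.particles N, f p := by
  have hf := T.finite_setOf_hasParticle N
  have hc : hf.toFinset.card = N := by rw [toFinset_hasParticle, T.card_particles hN]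
  have h1 : ∀ i : Fin N, N - 1 - (i : ℕ) < hf.toFinset.card := fun i => by
    rw [hc]; have := i.2; omega
  refine Finset.sum_bij (fun i _ => Nat.nth (T.HasParticle N) (N - 1 - i)) ?_ ?_ ?_ ?_
  · exact fun i _ => T.mem_particles.2 (Nat.nth_mem_of_lt_card hf (h1 i))
  · intro i _ j _ hij
    have := Nat.nth_injOn hf (h1 i) (h1 j) hij
    have := i.2
    have := j.2
    exact Fin.ext (by omega)
  · intro p hp
    obtain ⟨n, hn, rfl⟩ := Nat.exists_lt_card_finite_nth_eq hf (T.mem_particles.1 hp)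
    rw [hc] at hn
    refine ⟨⟨N - 1 - n, by omega⟩, Finset.mem_univ _, ?_⟩
    congr 1
    simp only
    omega
  · intros; rfl

theorem empiricalMeasure_eq (T : DominoTiling M) {N : ℕ} (hN : N ≤ M) :
    T.empiricalMeasure N =
      (N : ENNReal)⁻¹ • ∑ p ∈ T.particles N, Measure.dirac ((p : ℝ) / N) := by
  rw [empiricalMeasure, ← T.sum_nth_hasParticle hN fun p => Measure.dirac ((p : ℝ) / N)]
  congr 1
  refine Finset.sum_congr rfl fun i _ => ?_
  have h := T.signature_add hN i
  have hi := i.2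
  have h' : (T.signature N i : ℝ) + N - ((i : ℕ) + 1) =
      (Nat.nth (T.HasParticle N) (N - 1 - i) : ℝ) := by
    rw [← h]
    push_cast [Nat.cast_sub (show (i : ℕ) ≤ N - 1 by omega), Nat.cast_sub (show 1 ≤ N by omega)]
    ring
  rw [h']

theorem integral_empiricalMeasure (T : DominoTiling M) {N : ℕ} (hN : N ≤ M) (f : ℝ → ℝ) :
    ∫ x, f x ∂(T.empiricalMeasure N) = (∑ p ∈ T.particles N, f ((p : ℝ) / N)) / N := by
  rw [empiricalMeasure_eq T hN, integral_smul_measure, integral_finsetSum_measure]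
  · simp [div_eq_inv_mul]
  · exact fun p _ => integrable_dirac (by simp)

theorem integral_pow_empiricalMeasure (T : DominoTiling M) {N : ℕ} (hN : N ≤ M) (k : ℕ) :
    ∫ x, x ^ k ∂(T.empiricalMeasure N) = rowSum N k T / (N : ℝ) ^ (k + 1) := by
  rw [integral_empiricalMeasure T hN (fun x => x ^ k), rowSum]
  simp only [div_pow]
  rw [← Finset.sum_div, div_div, pow_succ]

/-! ### Convergence in probability of the moments -/

/-- The case `M = 0`, where the only tiling is the empty one, is included. -/
theorem sum_weight_pos {b : Fin M → ℝ} (hb : ∀ t, 0 < b t ∧ b t < 1) :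
    0 < ∑ T : DominoTiling M, weight b T := by
  rcases Nat.eq_zero_or_pos M with rfl | hM
  · have hcell : IsEmpty (aztecCells 0) := by
      refine ⟨fun c => ?_⟩
      have h := (mem_aztecCells).1 c.2
      have h1 := abs_nonneg (2 * c.1.1 + 1)
      have h2 := abs_nonneg (2 * c.1.2 + 1)
      have h3 := abs_pos.2 (show 2 * c.1.1 + 1 ≠ 0 by omega)
      simp only [Nat.cast_zero, mul_zero] at h
      omega
    exact Finset.sum_pos (fun T _ => weight_pos hb T)
      ⟨⟨fun c => c, fun c => (hcell.false c).elim⟩, Finset.mem_univ _⟩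
  · exact (quenchedExp_prod hb hM le_rfl 0 0).2

theorem quenchedProb_nonneg {b : Fin M → ℝ} (hb : ∀ t, 0 < b t ∧ b t < 1)
    (A : Set (DominoTiling M)) : 0 ≤ quenchedProb b A :=
  Finset.sum_nonneg fun _ _ => Set.indicator_nonneg
    (fun T' _ => div_nonneg (weight_pos hb T').le (sum_weight_pos hb).le) _

theorem quenchedProb_mono {b : Fin M → ℝ} (hb : ∀ t, 0 < b t ∧ b t < 1)
    {A A' : Set (DominoTiling M)} (h : A ⊆ A') : quenchedProb b A ≤ quenchedProb b A' :=
  Finset.sum_le_sum fun _ _ => Set.indicator_le_indicator_of_subset h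
    (fun T' => div_nonneg (weight_pos hb T').le (sum_weight_pos hb).le) _

theorem quenchedProb_univ {b : Fin M → ℝ} (hb : ∀ t, 0 < b t ∧ b t < 1) :
    quenchedProb b (Set.univ : Set (DominoTiling M)) = 1 := by
  simp only [quenchedProb, Set.indicator_univ]
  rw [← Finset.sum_div, div_self (sum_weight_pos hb).ne']

theorem quenchedProb_union_le {b : Fin M → ℝ} (hb : ∀ t, 0 < b t ∧ b t < 1)
    (A A' : Set (DominoTiling M)) :
    quenchedProb b (A ∪ A') ≤ quenchedProb b A + quenchedProb b A' := by
  rw [quenchedProb, quenchedProb, quenchedProb, ← Finset.sum_add_distrib]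
  refine Finset.sum_le_sum fun T _ => ?_
  have h : 0 ≤ weight b T / ∑ T', weight b T' :=
    div_nonneg (weight_pos hb T).le (sum_weight_pos hb).le
  by_cases h1 : T ∈ A <;> by_cases h2 : T ∈ A' <;> simp [h1, h2, h]

theorem quenchedProb_le_div {b : Fin M → ℝ} (hb : ∀ t, 0 < b t ∧ b t < 1)
    (A : Set (DominoTiling M)) (Y : DominoTiling M → ℝ) {δ : ℝ} (hδ : 0 < δ)
    (hA : ∀ T ∈ A, δ ≤ |Y T|) :
    quenchedProb b A ≤ quenchedExp b (fun T => Y T ^ 2) / δ ^ 2 := by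
  rw [quenchedProb, quenchedExp, Finset.sum_div]
  refine Finset.sum_le_sum fun T _ => ?_
  have h : 0 ≤ weight b T / ∑ T', weight b T' :=
    div_nonneg (weight_pos hb T).le (sum_weight_pos hb).le
  by_cases hT : T ∈ A
  · rw [Set.indicator_of_mem hT, mul_div_assoc]
    refine le_mul_of_one_le_right h ?_
    rw [one_le_div (by positivity), ← sq_abs (Y T)]
    exact pow_le_pow_left₀ hδ.le (hA T hT) 2
  · rw [Set.indicator_of_notMem hT]
    exact div_nonneg (mul_nonneg h (sq_nonneg _)) (sq_nonneg _)

/-- Chebyshev bound for the moments of the empirical measures, uniform in the parameters. -/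
theorem exists_quenchedProb_moment_bound {β α : ℝ} (hβ0 : 0 < β) (hβ1 : β < 1) (hα0 : 0 < α)
    (hα1 : α < 1) {N : ℕ → ℕ} (hN : Tendsto (fun M : ℕ => (N M : ℝ) / M) atTop (𝓝 α)) (k : ℕ)
    {ε : ℝ} (hε : 0 < ε) :
    ∃ (C : ℝ) (e : ℕ → ℝ), 0 ≤ C ∧ Tendsto e atTop (𝓝 0) ∧ ∀ᶠ M in atTop, ∀ b : Fin M → ℝ,
      (∀ t, 0 < b t ∧ b t < 1) →
      quenchedProb b {T : DominoTiling M |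
        ε ≤ |∫ x, x ^ k ∂(T.empiricalMeasure (N M)) - momentLimit β α k / α ^ (k + 1)|} ≤
      C * ((∑ t, (b t - β) ^ 2) / M) + e M := by
  obtain ⟨C, hC0, hC⟩ := exists_quenchedExp_bound k
  set x := momentLimit β α k / α ^ (k + 1) with hx
  set δ := ε * (α / 2) ^ (k + 1) with hδ
  have hδ0 : 0 < δ := by positivity
  have hxα : x * α ^ (k + 1) = momentLimit β α k := by
    rw [hx]; field_simp
  have hNk : Tendsto (fun M : ℕ => x * ((N M : ℝ) / M) ^ (k + 1)) atTop
      (𝓝 (momentLimit β α k)) := by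
    rw [← hxα]
    exact (hN.pow _).const_mul _
  have hmean := tendsto_constMean hβ0 hβ1 hα0 hα1 hN k
  have hd : Tendsto (fun M : ℕ => constMean β M (N M) k / (M : ℝ) ^ (k + 1) -
      x * ((N M : ℝ) / M) ^ (k + 1)) atTop (𝓝 0) := by
    simpa using hmean.sub hNk
  have hM2 : Tendsto (fun M : ℕ => C / (M : ℝ) ^ 2) atTop (𝓝 0) :=
    tendsto_const_nhds.div_atTop
      ((tendsto_pow_atTop (two_ne_zero)).comp tendsto_natCast_atTop_atTop)
  refine ⟨C / δ ^ 2, fun M => (C / (M : ℝ) ^ 2 + 2 * (constMean β M (N M) k / (M : ℝ) ^ (k + 1) -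
      x * ((N M : ℝ) / M) ^ (k + 1)) ^ 2) / δ ^ 2, by positivity, ?_, ?_⟩
  · have := (hM2.add ((hd.pow 2).const_mul 2)).div_const (δ ^ 2)
    simpa using this
  filter_upwards [eventually_gt_atTop 0, hN.eventually (gt_mem_nhds hα1),
    hN.eventually (lt_mem_nhds (half_lt_self hα0))] with M hM h1 h2 b hb
  have hM' : (0 : ℝ) < M := by exact_mod_cast hM
  have hNM : N M ≤ M := by
    rw [div_lt_one hM'] at h1
    exact_mod_cast h1.le
  have hN0' : (0 : ℝ) < N M := by
    have : 0 < (N M : ℝ) / M := (half_pos hα0).trans h2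
    exact (div_pos_iff_of_pos_right hM').1 this
  have hN0 : 0 < N M := by exact_mod_cast hN0'
  refine (quenchedProb_le_div hb _ (fun T => rowSum (N M) k T / (M : ℝ) ^ (k + 1) -
    x * ((N M : ℝ) / M) ^ (k + 1)) hδ0 ?_).trans ?_
  · intro T hT
    rw [Set.mem_ofPred_eq, integral_pow_empiricalMeasure T hNM] at hT
    have e1 : rowSum (N M) k T / (M : ℝ) ^ (k + 1) - x * ((N M : ℝ) / M) ^ (k + 1) =
        (rowSum (N M) k T / (N M : ℝ) ^ (k + 1) - x) * ((N M : ℝ) / M) ^ (k + 1) := by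
      rw [div_pow]; field_simp
    rw [e1, abs_mul, abs_of_pos (by positivity : 0 < ((N M : ℝ) / M) ^ (k + 1)), hδ]
    gcongr
  · have h3 := hC M (N M) b β (x * ((N M : ℝ) / M) ^ (k + 1)) hN0 hNM hb hβ0 hβ1
    refine (div_le_div_of_nonneg_right h3 (sq_nonneg δ)).trans_eq ?_
    ring

theorem convergesInProb_moment_quenched {β α : ℝ} (hβ0 : 0 < β) (hβ1 : β < 1) (hα0 : 0 < α)
    (hα1 : α < 1) {N : ℕ → ℕ} (hN : Tendsto (fun M : ℕ => (N M : ℝ) / M) atTop (𝓝 α)) (k : ℕ) :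
    ConvergesInProb (fun M => quenchedProb (fun _ : Fin M => β))
      (fun M T => ∫ x, x ^ k ∂(T.empiricalMeasure (N M))) (momentLimit β α k / α ^ (k + 1)) := by
  intro ε hε
  obtain ⟨C, e, hC, he, h⟩ := exists_quenchedProb_moment_bound hβ0 hβ1 hα0 hα1 hN k hε
  refine tendsto_of_tendsto_of_tendsto_of_le_of_le' tendsto_const_nhds he ?_ ?_
  · exact Eventually.of_forall fun M => quenchedProb_nonneg (fun _ => ⟨hβ0, hβ1⟩) _
  · filter_upwards [h] with M hM
    simpa using hM (fun _ => β) (fun _ => ⟨hβ0, hβ1⟩)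

/-! ### Random parameters -/

theorem measurable_quenchedProb (A : Set (DominoTiling M)) :
    Measurable fun b : Fin M → ℝ => quenchedProb b A := by
  have hw : ∀ T : DominoTiling M, Measurable fun b : Fin M → ℝ => weight b T := by
    intro T
    unfold weight
    refine Finset.measurable_prod _ fun t _ => Finset.measurable_prod _ fun _ _ => ?_
    exact (measurable_pi_apply t).div (measurable_const.sub (measurable_pi_apply t))
  unfold quenchedProb
  refine Finset.measurable_sum _ fun T _ => ?_
  by_cases hT : T ∈ A
  · simp only [Set.indicator_of_mem hT]
    exact (hw T).div (Finset.measurable_sum _ fun T' _ => hw T')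
  · simp only [Set.indicator_of_notMem hT]
    exact measurable_const

section annealed

variable {B : Measure ℝ} [IsProbabilityMeasure B] (hB : ∀ᵐ b ∂B, 0 < b ∧ b < 1)

include hB in
theorem ae_pi_mem : ∀ᵐ b ∂(Measure.pi fun _ : Fin M => B), ∀ t, 0 < b t ∧ b t < 1 := by
  rw [ae_all_iff]
  intro t
  exact (measurePreserving_eval (fun _ : Fin M => B) t).quasiMeasurePreserving.ae hB

include hB in
theorem integrable_quenchedProb (A : Set (DominoTiling M)) :
    Integrable (fun b => quenchedProb b A) (Measure.pi fun _ : Fin M => B) := by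
  refine Integrable.of_bound (measurable_quenchedProb A).aestronglyMeasurable 1 ?_
  filter_upwards [ae_pi_mem hB] with b hb
  rw [Real.norm_eq_abs, abs_of_nonneg (quenchedProb_nonneg hb A), ← quenchedProb_univ hb]
  exact quenchedProb_mono hb (Set.subset_univ _)

include hB in
theorem annealedProb_nonneg (A : Set (DominoTiling M)) : 0 ≤ annealedProb B A := by
  refine integral_nonneg_of_ae ?_
  filter_upwards [ae_pi_mem hB] with b hb using quenchedProb_nonneg hb A

include hB in
theorem annealedProb_mono {A A' : Set (DominoTiling M)} (h : A ⊆ A') :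
    annealedProb B A ≤ annealedProb B A' := by
  refine integral_mono_ae (integrable_quenchedProb hB A) (integrable_quenchedProb hB A') ?_
  filter_upwards [ae_pi_mem hB] with b hb using quenchedProb_mono hb h

include hB in
theorem annealedProb_union_le (A A' : Set (DominoTiling M)) :
    annealedProb B (A ∪ A') ≤ annealedProb B A + annealedProb B A' := by
  rw [annealedProb, annealedProb, annealedProb,
    ← integral_add (integrable_quenchedProb hB A) (integrable_quenchedProb hB A')]
  refine integral_mono_ae (integrable_quenchedProb hB _)
    ((integrable_quenchedProb hB A).add (integrable_quenchedProb hB A')) ?_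
  filter_upwards [ae_pi_mem hB] with b hb using quenchedProb_union_le hb A A'

include hB in
theorem integrable_pow_of_ae_mem (k : ℕ) : Integrable (fun b : ℝ => b ^ k) B := by
  refine Integrable.of_bound (by fun_prop) 1 ?_
  filter_upwards [hB] with b hb
  rw [norm_pow, Real.norm_eq_abs, abs_of_pos hb.1]
  exact pow_le_one₀ hb.1.le hb.2.le

include hB in
theorem integral_sub_sq (β : ℝ) :
    ∫ b, (b - β) ^ 2 ∂B = variance (fun b : ℝ => b) B + ((∫ b, b ∂B) - β) ^ 2 := by
  have h1 : Integrable (fun b : ℝ => b) B := by simpa using integrable_pow_of_ae_mem hB 1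
  have h2 := integrable_pow_of_ae_mem hB 2
  have hLp : MemLp (fun b : ℝ => b) 2 B :=
    (memLp_two_iff_integrable_sq h1.aestronglyMeasurable).2 h2
  have hv := variance_eq_sub hLp
  have e : (fun b : ℝ => (b - β) ^ 2) = fun b => b ^ 2 + ((-(2 * β)) * b + β ^ 2) := by
    ext b; ring
  have e2 : ∫ b, ((fun b : ℝ => b) ^ 2) b ∂B = ∫ b, b ^ 2 ∂B := rfl
  rw [e2] at hv
  have h3 : Integrable (fun b : ℝ => (-(2 * β)) * b + β ^ 2) B :=
    (h1.const_mul _).add (integrable_const _)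
  rw [e, integral_add h2 h3, integral_add (h1.const_mul _) (integrable_const _), integral_const_mul,
    hv]
  simp
  ring

end annealed

theorem convergesInProb_moment_annealed {β α : ℝ} (hβ0 : 0 < β) (hβ1 : β < 1) (hα0 : 0 < α)
    (hα1 : α < 1) {N : ℕ → ℕ} (hN : Tendsto (fun M : ℕ => (N M : ℝ) / M) atTop (𝓝 α)) (k : ℕ)
    {σ : ℝ} {B : ℕ → Measure ℝ} (hP : ∀ M, IsProbabilityMeasure (B M))
    (hB : ∀ M, ∀ᵐ b ∂(B M), 0 < b ∧ b < 1)
    (hE : Tendsto (fun M => ∫ b, b ∂(B M)) atTop (𝓝 β))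
    (hV : Tendsto (fun M : ℕ => (M : ℝ) * variance (fun b : ℝ => b) (B M)) atTop (𝓝 (σ ^ 2))) :
    ConvergesInProb (fun M => annealedProb (B M))
      (fun M T => ∫ x, x ^ k ∂(T.empiricalMeasure (N M))) (momentLimit β α k / α ^ (k + 1)) := by
  intro ε hε
  obtain ⟨C, e, hC, he, h⟩ := exists_quenchedProb_moment_bound hβ0 hβ1 hα0 hα1 hN k hε
  have hV0 : Tendsto (fun M : ℕ => variance (fun b : ℝ => b) (B M)) atTop (𝓝 0) := by
    have h1 := hV.mul (tendsto_inv_atTop_nhds_zero_nat (𝕜 := ℝ))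
    rw [mul_zero] at h1
    refine h1.congr' ?_
    filter_upwards [eventually_gt_atTop 0] with M hM
    have : (M : ℝ) ≠ 0 := by exact_mod_cast hM.ne'
    field_simp
  have hQ : Tendsto (fun M : ℕ => ∫ b, (b - β) ^ 2 ∂(B M)) atTop (𝓝 0) := by
    have h2 : Tendsto (fun M => ((∫ b, b ∂(B M)) - β) ^ 2) atTop (𝓝 0) := by
      simpa using (hE.sub_const β).pow 2
    have h3 := hV0.add h2
    rw [add_zero] at h3
    refine h3.congr fun M => ?_
    have := hP M
    exact (integral_sub_sq (hB M) β).symm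
  refine tendsto_of_tendsto_of_tendsto_of_le_of_le' tendsto_const_nhds
    (h := fun M => C * ∫ b, (b - β) ^ 2 ∂(B M) + e M) ?_ ?_ ?_
  · simpa using (hQ.const_mul C).add he
  · exact Eventually.of_forall fun M => by have := hP M; exact annealedProb_nonneg (hB M) _
  · filter_upwards [h, eventually_gt_atTop 0] with M hM hM0
    have := hP M
    have hM' : (M : ℝ) ≠ 0 := by exact_mod_cast hM0.ne'
    have hi1 : Integrable (fun x : ℝ => (x - β) ^ 2) (B M) := by
      have h1 := integrable_pow_of_ae_mem (hB M) 1
      have h2 := integrable_pow_of_ae_mem (hB M) 2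
      have e : (fun b : ℝ => (b - β) ^ 2) = fun b => b ^ 2 + ((-(2 * β)) * b ^ 1 + β ^ 2) := by
        ext b; ring
      rw [e]
      exact h2.add ((h1.const_mul _).add (integrable_const _))
    have hi : ∀ t : Fin M, Integrable (fun b : Fin M → ℝ => (b t - β) ^ 2)
        (Measure.pi fun _ : Fin M => B M) := fun t =>
      integrable_comp_eval (μ := fun _ : Fin M => B M) (i := t) (f := fun x : ℝ => (x - β) ^ 2) hi1
    have hint : Integrable (fun b : Fin M → ℝ => C * ((∑ t, (b t - β) ^ 2) / M) + e M)
        (Measure.pi fun _ : Fin M => B M) :=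
      ((((integrable_finsetSum _ fun t _ => hi t).div_const _).const_mul C).add
        (integrable_const _))
    refine (integral_mono_ae (integrable_quenchedProb (hB M) _) hint ?_).trans_eq ?_
    · filter_upwards [ae_pi_mem (hB M)] with b hb using hM b hb
    · rw [integral_add (((integrable_finsetSum _ fun t _ => hi t).div_const _).const_mul C)
        (integrable_const _), integral_const_mul, integral_div,
        integral_finsetSum _ fun t _ => hi t]
      have h5 : ∀ t : Fin M, ∫ b : Fin M → ℝ, (b t - β) ^ 2 ∂(Measure.pi fun _ : Fin M => B M) =
          ∫ x, (x - β) ^ 2 ∂(B M) := fun t =>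
        integral_comp_eval (μ := fun _ : Fin M => B M) (i := t)
          (f := fun x : ℝ => (x - β) ^ 2) hi1.aestronglyMeasurable
      simp only [h5, Finset.sum_const, Finset.card_univ, Fintype.card_fin, integral_const]
      simp only [nsmul_eq_mul, mul_div_cancel_left₀ _ hM', probReal_univ, one_smul]

end DominoTiling

/-! ### The height function along a row -/

namespace DominoTiling

variable {M : ℕ}

/-- Around a cell of the diamond the height changes add up to zero, because exactly one of its four
sides is interior to a domino. -/
theorem heightStep_closed (T : DominoTiling M) {x y : ℤ} (h : (x, y) ∈ aztecCells M) :
    T.heightStepEast x y + T.heightStepNorth (x + 1) y =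
      T.heightStepNorth x y + T.heightStepEast x (y + 1) := by
  obtain ⟨d, hd, hadj⟩ := T.exists_isDomino h
  have key : ∀ e, T.IsDomino (x, y) e ↔ e = d := fun e =>
    ⟨fun he => he.eq_right hd, fun he => he ▸ hd⟩
  have h1 := T.isDomino_comm (c := (x - 1, y)) (d := (x, y))
  have h2 := T.isDomino_comm (c := (x, y + 1)) (d := (x, y))
  simp only [heightStepEast, heightStepNorth, heightStep, add_sub_cancel_right, h1, h2, key]
  have c1 : IsBlack M (x - 1, y) ↔ ¬ IsBlack M (x, y) := by
    simp only [IsBlack, Int.even_iff]; omega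
  have c2 : IsBlack M (x, y + 1) ↔ ¬ IsBlack M (x, y) := by
    simp only [IsBlack, Int.even_iff]; omega
  simp only [c1, c2]
  obtain ⟨d1, d2⟩ := d
  have hd' : (d1 = x ∧ (d2 = y - 1 ∨ d2 = y + 1)) ∨ (d2 = y ∧ (d1 = x - 1 ∨ d1 = x + 1)) := by
    simp only [CellAdj] at hadj
    rcases abs_cases (x - d1) with h5 | h5 <;> rcases abs_cases (y - d2) with h6 | h6 <;> omega
  clear hadj
  simp only [Prod.mk.injEq]
  by_cases hb : IsBlack M (x, y) <;> simp only [hb, not_true, not_false_iff, if_true, if_false] <;>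
    split_ifs <;> omega

theorem height_add_one_right (T : DominoTiling M) (x y : ℤ) :
    T.height x (y + 1) = T.height x y + T.heightStepNorth x y := by
  unfold height
  rcases le_or_gt 0 y with hy | hy
  · rw [Finset.Ico_eq_empty (show ¬ y + 1 < 0 by omega), Finset.Ico_eq_empty (show ¬ y < 0 by omega),
      ← Finset.insert_Ico_right_eq_Ico_add_one hy, Finset.sum_insert (by simp)]
    ring
  · rw [Finset.Ico_eq_empty (show ¬ 0 < y + 1 by omega), Finset.Ico_eq_empty (show ¬ 0 < y by omega),
      ← Finset.insert_Ico_add_one_left_eq_Ico hy, Finset.sum_insert (by simp)]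
    ring

/-- The height changes to the east are as prescribed also off the axis `y = 0`, along which the
definition of the height sums them, if the column of cells in between lies in the diamond. -/
theorem height_add_one_left (T : DominoTiling M) {x y : ℤ} (hx : -(M : ℤ) ≤ x)
    (h : ∀ j, (0 ≤ j ∧ j < y) ∨ (y ≤ j ∧ j < 0) → (x, j) ∈ aztecCells M) :
    T.height (x + 1) y = T.height x y + T.heightStepEast x y := by
  have h0 : T.height (x + 1) 0 = T.height x 0 + T.heightStepEast x 0 := by
    simp only [height, Finset.Ico_self, Finset.sum_empty, add_zero, sub_zero]
    rw [← Finset.insert_Ico_right_eq_Ico_add_one hx, Finset.sum_insert (by simp)]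
    ring
  induction y using Int.induction_on with
  | zero => exact h0
  | succ n ih =>
    have h1 := ih fun j hj => h j (by omega)
    have h2 := T.heightStep_closed (h n (by omega))
    rw [T.height_add_one_right, T.height_add_one_right, h1]
    linarith
  | pred n ih =>
    have h1 := ih fun j hj => h j (by omega)
    have h2 := T.heightStep_closed (h (-n - 1) (by omega))
    have h3 := T.height_add_one_right (x + 1) (-n - 1)
    have h4 := T.height_add_one_right x (-n - 1)
    rw [sub_add_cancel] at h2 h3 h4
    linarith

theorem height_boundary (T : DominoTiling M) {N : ℕ} (hN : N ≤ M) :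
    T.height ((N : ℤ) - M) N = 2 * N := by
  induction N with
  | zero => simp [height]
  | succ N ih =>
    have h1 := T.height_add_one_right ((N : ℤ) - M) N
    have h2 := T.height_add_one_left (x := (N : ℤ) - M) (y := N + 1) (by omega) (by
      intro j hj
      rw [mem_aztecCells, abs_of_neg (by omega), abs_of_pos (by omega)]
      omega)
    have h3 : T.heightStepNorth ((N : ℤ) - M) N = 1 := by
      have hn : ¬ T.IsDomino ((N : ℤ) - M - 1, (N : ℤ)) ((N : ℤ) - M, (N : ℤ)) := by
        rintro ⟨h, -⟩
        rw [mem_aztecCells, abs_of_neg (by omega), abs_of_pos (by omega)] at h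
        omega
      have hb : IsBlack M ((N : ℤ) - M - 1, (N : ℤ)) := ⟨N, by ring⟩
      rw [heightStepNorth, heightStep, if_neg hn, if_pos hb, mul_one]
    have h4 : T.heightStepEast ((N : ℤ) - M) (N + 1) = 1 := by
      have hn : ¬ T.IsDomino ((N : ℤ) - M, (N : ℤ) + 1) ((N : ℤ) - M, (N : ℤ) + 1 - 1) := by
        rintro ⟨h, -⟩
        rw [mem_aztecCells, abs_of_neg (by omega), abs_of_pos (by omega)] at h
        omega
      have hb : IsBlack M ((N : ℤ) - M, (N : ℤ) + 1) := ⟨N + 1, by ring⟩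
      rw [heightStepEast, heightStep, if_neg hn, if_pos hb, mul_one]
    have h5 := ih (by omega)
    push_cast
    rw [show (N : ℤ) + 1 - M = (N : ℤ) - M + 1 by ring]
    linarith

/-- Passing south-west of a black cell, the height changes by `-2` if the position is occupied, and
by `2` otherwise. -/
theorem height_rowCell_step (T : DominoTiling M) {N p : ℕ} (hN : N ≤ M) (hp : p < M) :
    T.height ((N : ℤ) + (p + 1 : ℕ) - M) ((N : ℤ) - (p + 1 : ℕ)) =
      T.height ((N : ℤ) + p - M) ((N : ℤ) - p) + 2 - 4 * (if T.HasParticle N p then 1 else 0) := by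
  classical
  have hc : rowCell M N p ∈ aztecCells M := rowCell_mem.2 ⟨hN, hp⟩
  have hc' := mem_aztecCells.1 hc
  simp only [rowCell] at hc hc'
  set x : ℤ := (N : ℤ) + p - M with hx
  set y : ℤ := (N : ℤ) - p - 1 with hy
  have h1 := T.height_add_one_right x y
  have h2 := T.height_add_one_left (x := x) (y := y) (by omega) (by
    intro j hj
    rw [mem_aztecCells]
    have : |2 * j + 1| ≤ |2 * y + 1| := by
      rcases hj with hj | hj
      · rw [abs_of_pos (by omega), abs_of_pos (by omega)]; omega
      · rw [abs_of_neg (by omega), abs_of_neg (by omega)]; omega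
    linarith)
  rw [show (N : ℤ) + (p + 1 : ℕ) - M = x + 1 by push_cast; ring,
    show (N : ℤ) - (p + 1 : ℕ) = y by push_cast; ring, h2,
    show (N : ℤ) - p = y + 1 by ring, h1]
  have hb : IsBlack M (x, y) := ⟨N, by simp only [hx, hy]; ring⟩
  have hb' : ¬ IsBlack M (x - 1, y) := by
    rw [IsBlack, Int.not_even_iff_odd]
    exact ⟨N - 1, by simp only [hx, hy]; ring⟩
  have hW := T.isDomino_comm (c := (x - 1, y)) (d := (x, y))
  have hP : T.HasParticle N p ↔ T.IsDomino (x, y) (x - 1, y) ∨ T.IsDomino (x, y) (x, y - 1) :=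
    Iff.rfl
  have hno : T.IsDomino (x, y) (x - 1, y) → ¬ T.IsDomino (x, y) (x, y - 1) := by
    intro ha hb
    have := congrArg Prod.fst (ha.eq_right hb)
    simp only at this
    omega
  simp only [heightStepEast, heightStepNorth, heightStep, hb, hb', if_true, if_false, hW, hP]
  by_cases e1 : T.IsDomino (x, y) (x - 1, y)
  · simp only [e1, hno e1, true_or, if_true, if_false]; ring
  · by_cases e2 : T.IsDomino (x, y) (x, y - 1)
    · simp only [e1, e2, or_true, if_true, if_false]; ring
    · simp only [e1, e2, or_self, if_false]; ring

/-- The height at the lattice points on the row `N` counts particles. -/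
theorem height_row (T : DominoTiling M) {N p : ℕ} (hN : N ≤ M) (hp : p ≤ M) :
    T.height ((N : ℤ) + p - M) ((N : ℤ) - p) =
      2 * N + 2 * p - 4 * ((T.particles N).filter (· < p)).card := by
  induction p with
  | zero => simpa using T.height_boundary hN
  | succ p ih =>
    rw [T.height_rowCell_step hN (by omega), ih (by omega)]
    have h : ((T.particles N).filter (· < p + 1)).card =
        ((T.particles N).filter (· < p)).card + if T.HasParticle N p then 1 else 0 := by
      rw [Finset.card_filter, Finset.card_filter]
      have e : ∀ q, (if q < p + 1 then 1 else 0) = (if q < p then 1 else 0) +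
          if q = p then 1 else 0 := by
        intro q; split_ifs <;> omega
      simp only [e, Finset.sum_add_distrib, Finset.sum_ite_eq', mem_particles]
    rw [h]
    push_cast
    ring

/-- The height at an arbitrary lattice point, up to one step. -/
theorem abs_height_sub_le (T : DominoTiling M) {x y : ℤ} {N p : ℕ} (hN : N ≤ M) (hp : p ≤ M)
    (hNx : (N : ℤ) = (x + y + M + 1) / 2) (hpx : (p : ℤ) = (x - y + M) / 2) :
    |T.height x y - (2 * N + 2 * p - 4 * ((T.particles N).filter (· < p)).card)| ≤ 3 := by
  rw [← T.height_row hN hp]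
  rcases Int.even_or_odd (x + y + M) with h | h
  · obtain ⟨a, ha⟩ := h
    rw [show (N : ℤ) + p - M = x by omega, show (N : ℤ) - p = y by omega, sub_self, abs_zero]
    norm_num
  · obtain ⟨a, ha⟩ := h
    rw [show (N : ℤ) + p - M = x by omega, show (N : ℤ) - p = y + 1 by omega,
      T.height_add_one_right, sub_add_cancel_left, abs_neg]
    unfold heightStepNorth heightStep
    split_ifs <;> norm_num

end DominoTiling

/-! ### The limiting measures of the rows -/

namespace DominoTiling

theorem quenchedExp_const_rowSum {β : ℝ} (hβ0 : 0 < β) (hβ1 : β < 1) {M N : ℕ} (hN0 : 0 < N)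
    (hN : N ≤ M) (k : ℕ) :
    quenchedExp (fun _ : Fin M => β) (rowSum N k) = constMean β M N k := by
  have hb : ∀ _ : Fin M, 0 < β ∧ β < 1 := fun _ => ⟨hβ0, hβ1⟩
  obtain ⟨C, -, hC⟩ := exists_mean_bound k
  rw [quenchedExp_rowSum hb hN0 hN]
  have h := hC (extendParam fun _ : Fin M => β) β M N (by omega) hN (fun t => by
    rw [extendParam]
    split_ifs
    · exact ⟨hβ0.le, hβ1.le⟩
    · exact ⟨le_rfl, zero_le_one⟩) hβ0.le hβ1.le
  have h0 : ∑ t ∈ Finset.range M, |extendParam (fun _ : Fin M => β) t - β| = 0 := by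
    refine Finset.sum_eq_zero fun t ht => ?_
    rw [extendParam, dif_pos (Finset.mem_range.1 ht), sub_self, abs_zero]
  rw [h0, mul_zero] at h
  exact sub_eq_zero.1 (abs_nonpos_iff.1 h)

/-- Mixtures of uniform measures on finite families of points. -/
theorem exists_probabilityMeasure_mixture {Ω E : Type*} [Fintype Ω] [MeasurableSpace E]
    [MeasurableSingletonClass E] {w : Ω → ℝ} (hw0 : ∀ ω, 0 ≤ w ω) (hw1 : ∑ ω, w ω = 1)
    {S : Ω → Finset ℕ} {N : ℕ} (hN : N ≠ 0) (hS : ∀ ω, (S ω).card = N) (f : ℕ → E) :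
    ∃ ν : ProbabilityMeasure E, ∀ g : E → ℝ,
      ∫ x, g x ∂(ν : Measure E) = ∑ ω, w ω * ((∑ p ∈ S ω, g (f p)) / N) := by
  have hprob : IsProbabilityMeasure (∑ ω, ENNReal.ofReal (w ω) •
      ((N : ENNReal)⁻¹ • ∑ p ∈ S ω, Measure.dirac (f p))) := by
    constructor
    have h1 : ∀ ω, ((N : ENNReal)⁻¹ • ∑ p ∈ S ω, Measure.dirac (f p)) Set.univ = 1 := by
      intro ω
      simp only [Measure.smul_apply, Measure.finsetSum_apply, measure_univ, Finset.sum_const,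
        hS, smul_eq_mul, nsmul_eq_mul, mul_one]
      exact ENNReal.inv_mul_cancel (by exact_mod_cast hN) (ENNReal.natCast_ne_top N)
    rw [Measure.finsetSum_apply]
    simp only [Measure.smul_apply (ENNReal.ofReal _), h1, smul_eq_mul, mul_one]
    rw [← ENNReal.ofReal_sum_of_nonneg fun ω _ => hw0 ω, hw1, ENNReal.ofReal_one]
  refine ⟨⟨_, hprob⟩, fun g => ?_⟩
  have hd : ∀ p, Integrable g (Measure.dirac (f p)) := fun p => integrable_dirac (by simp)
  have hfin : ∀ ω, Integrable g ((N : ENNReal)⁻¹ • ∑ p ∈ S ω, Measure.dirac (f p)) := fun ω =>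
    Integrable.smul_measure (integrable_finsetSum_measure.2 fun p _ => hd p) (by simpa using hN)
  rw [ProbabilityMeasure.coe_mk, integral_finsetSum_measure fun ω _ =>
    (hfin ω).smul_measure ENNReal.ofReal_ne_top]
  refine Finset.sum_congr rfl fun ω _ => ?_
  rw [integral_smul_measure, integral_smul_measure, integral_finsetSum_measure fun p _ => hd p,
    ENNReal.toReal_ofReal (hw0 ω), smul_eq_mul, div_eq_inv_mul]
  simp only [integral_dirac, smul_eq_mul, ENNReal.toReal_inv, ENNReal.toReal_natCast]

/-- The expected empirical measure of a row, on an interval containing the rescaled positions. -/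
theorem exists_expected_empiricalMeasure {β : ℝ} (hβ0 : 0 < β) (hβ1 : β < 1) {R : ℝ} (hR : 0 ≤ R)
    {M N : ℕ} (hN0 : 0 < N) (hN : N ≤ M) (hMR : (M : ℝ) ≤ R * N) :
    ∃ ν : ProbabilityMeasure (Set.Icc 0 R), ∀ k : ℕ,
      ∫ x : Set.Icc 0 R, (x : ℝ) ^ k ∂(ν : Measure (Set.Icc 0 R)) =
        constMean β M N k / (N : ℝ) ^ (k + 1) := by
  have hb : ∀ _ : Fin M, 0 < β ∧ β < 1 := fun _ => ⟨hβ0, hβ1⟩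
  have hN' : (0 : ℝ) < N := by exact_mod_cast hN0
  have hfv : ∀ p < M, (Set.projIcc 0 R hR ((p : ℝ) / N) : ℝ) = (p : ℝ) / N := by
    intro p hpM
    have hpR : (p : ℝ) ≤ R * N := le_trans (by exact_mod_cast hpM.le) hMR
    have : (p : ℝ) / N ∈ Set.Icc 0 R :=
      Set.mem_Icc.2 ⟨div_nonneg p.cast_nonneg hN'.le, (div_le_iff₀ hN').2 hpR⟩
    rw [Set.projIcc_of_mem hR this]
  obtain ⟨ν, hν⟩ := exists_probabilityMeasure_mixture
    (w := fun T : DominoTiling M =>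
      weight (fun _ => β) T / ∑ T' : DominoTiling M, weight (fun _ => β) T')
    (fun T => div_nonneg (weight_pos hb T).le (sum_weight_pos hb).le)
    (by rw [← Finset.sum_div, div_self (sum_weight_pos hb).ne'])
    hN0.ne' (fun T => T.card_particles hN) (fun p => Set.projIcc 0 R hR ((p : ℝ) / N))
  refine ⟨ν, fun k => ?_⟩
  have hs : ∀ T : DominoTiling M, ∑ p ∈ T.particles N,
      (Set.projIcc 0 R hR ((p : ℝ) / N) : ℝ) ^ k = rowSum N k T / (N : ℝ) ^ k := by
    intro T
    rw [rowSum, Finset.sum_div]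
    refine Finset.sum_congr rfl fun p hp => ?_
    rw [hfv p (Finset.mem_range.1 (T.particles_subset N hp)), div_pow]
  rw [hν, ← quenchedExp_const_rowSum hβ0 hβ1 hN0 hN, quenchedExp, Finset.sum_div]
  refine Finset.sum_congr rfl fun T _ => ?_
  rw [hs, mul_div_assoc, div_div, ← pow_succ]

/-- A probability measure with compact support and the limiting moments, obtained as a limit point
of the expected empirical measures. -/
theorem exists_limit_measure {β α : ℝ} (hβ0 : 0 < β) (hβ1 : β < 1) (hα0 : 0 < α) (hα1 : α < 1) :
    ∃ m : Measure ℝ, IsProbabilityMeasure m ∧ (∀ᵐ x ∂m, x ∈ Set.Icc 0 (2 / α)) ∧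
      ∀ k : ℕ, ∫ x, x ^ k ∂m = momentLimit β α k / α ^ (k + 1) := by
  have hR : 0 ≤ 2 / α := by positivity
  have hN : Tendsto (fun M : ℕ => (⌊α * M⌋₊ : ℝ) / M) atTop (𝓝 α) :=
    (tendsto_nat_floor_mul_div_atTop hα0.le).comp tendsto_natCast_atTop_atTop
  have hev : ∀ᶠ M : ℕ in atTop, ∃ ν : ProbabilityMeasure (Set.Icc 0 (2 / α)), ∀ k : ℕ,
      ∫ x : Set.Icc 0 (2 / α), (x : ℝ) ^ k ∂(ν : Measure (Set.Icc 0 (2 / α))) =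
        constMean β M ⌊α * M⌋₊ k / (⌊α * M⌋₊ : ℝ) ^ (k + 1) := by
    filter_upwards [eventually_gt_atTop 0, hN.eventually (gt_mem_nhds hα1),
      hN.eventually (lt_mem_nhds (half_lt_self hα0))] with M hM h1 h2
    have hM' : (0 : ℝ) < M := by exact_mod_cast hM
    rw [div_lt_one hM'] at h1
    rw [lt_div_iff₀ hM'] at h2
    have h3 : (0 : ℝ) < ⌊α * M⌋₊ := lt_of_le_of_lt (by positivity) h2
    refine exists_expected_empiricalMeasure hβ0 hβ1 hR (by exact_mod_cast h3)
      (by exact_mod_cast h1.le) ?_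
    rw [div_mul_eq_mul_div, le_div_iff₀ hα0]
    linarith
  have : Nonempty (ProbabilityMeasure (Set.Icc 0 (2 / α))) := by
    obtain ⟨M, ν, -⟩ := hev.exists
    exact ⟨ν⟩
  obtain ⟨ν, hν⟩ := hev.choice
  set U : Ultrafilter ℕ := Filter.hyperfilter ℕ with hU
  have hUle : (U : Filter ℕ) ≤ atTop := Nat.hyperfilter_le_atTop
  set ρ := (U.map ν).lim with hρ
  have hlim : Tendsto ν (U : Filter ℕ) (𝓝 ρ) := (U.map ν).le_nhds_lim
  have hmom : ∀ k : ℕ, ∫ x : Set.Icc 0 (2 / α), (x : ℝ) ^ k ∂(ρ : Measure (Set.Icc 0 (2 / α))) =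
      momentLimit β α k / α ^ (k + 1) := by
    intro k
    have h1 := (ProbabilityMeasure.tendsto_iff_forall_integral_tendsto.1 hlim)
      (BoundedContinuousFunction.mkOfCompact
        ⟨fun x : Set.Icc 0 (2 / α) => (x : ℝ) ^ k, by fun_prop⟩)
    simp only [BoundedContinuousFunction.mkOfCompact_apply, ContinuousMap.coe_mk] at h1
    refine tendsto_nhds_unique h1 (Tendsto.congr'
      (f₁ := fun M : ℕ => constMean β M ⌊α * M⌋₊ k / (⌊α * M⌋₊ : ℝ) ^ (k + 1)) ?_ ?_)
    · filter_upwards [hUle hν] with M hM using (hM k).symm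
    · refine Tendsto.mono_left ?_ hUle
      have h2 := (tendsto_constMean hβ0 hβ1 hα0 hα1 hN k).div (hN.pow (k + 1)) (by positivity)
      refine h2.congr' ?_
      filter_upwards [eventually_gt_atTop 0] with M hM
      have hM' : (M : ℝ) ≠ 0 := by exact_mod_cast hM.ne'
      rw [Pi.div_apply, div_pow]
      field_simp
  refine ⟨(ρ : Measure (Set.Icc 0 (2 / α))).map Subtype.val,
    Measure.isProbabilityMeasure_map measurable_subtype_coe.aemeasurable, ?_, fun k => ?_⟩
  · exact (ae_map_iff (p := fun x => x ∈ Set.Icc 0 (2 / α))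
      measurable_subtype_coe.aemeasurable measurableSet_Icc).2 (Eventually.of_forall fun x => x.2)
  · rw [integral_map measurable_subtype_coe.aemeasurable (by fun_prop), hmom]

end DominoTiling

/-! ### From moments to the height function -/

/-- A polynomial close to `1` on the left of `x₀` and close to `0` on the right of `x₀ + η`. -/
theorem exists_polynomial_near_step (R x₀ : ℝ) {η δ : ℝ} (hη : 0 < η) (hδ : 0 < δ) :
    ∃ Q : Polynomial ℝ, ∀ x ∈ Set.Icc 0 R, (x ≤ x₀ → |Q.eval x - 1| ≤ δ) ∧
      (x₀ + η ≤ x → |Q.eval x| ≤ δ) ∧ -δ ≤ Q.eval x ∧ Q.eval x ≤ 1 + δ := by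
  obtain ⟨Q, hQ⟩ := exists_polynomial_near_of_continuousOn 0 R
    (fun x => max 0 (min 1 (1 - (x - x₀) / η))) (by fun_prop) δ hδ
  refine ⟨Q, fun x hx => ?_⟩
  have h := (hQ x hx).le
  refine ⟨fun hx0 => ?_, fun hx0 => ?_, ?_⟩
  · have h1 : (x - x₀) / η ≤ 0 := div_nonpos_of_nonpos_of_nonneg (by linarith) hη.le
    rwa [min_eq_left (by linarith), max_eq_right zero_le_one] at h
  · have h1 : 1 ≤ (x - x₀) / η := (one_le_div hη).2 (by linarith)
    rwa [min_eq_right (by linarith), max_eq_left (by linarith), sub_zero] at h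
  · have h1 : 0 ≤ max 0 (min 1 (1 - (x - x₀) / η)) := le_max_left _ _
    have h2 : max 0 (min 1 (1 - (x - x₀) / η)) ≤ 1 := max_le zero_le_one (min_le_left _ _)
    rw [abs_le] at h
    constructor <;> linarith [h.1, h.2]

theorem card_filter_abs_sub_le (S : Finset ℕ) (y : ℝ) {s : ℝ} (hs : 0 ≤ s) :
    ((S.filter fun q : ℕ => |(q : ℝ) - y| ≤ s).card : ℝ) ≤ 2 * s + 1 := by
  have h1 : (S.filter fun q : ℕ => |(q : ℝ) - y| ≤ s).card ≤ (Finset.Icc ⌈y - s⌉ ⌊y + s⌋).card := by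
    refine Finset.card_le_card_of_injOn (fun q => (q : ℤ)) ?_ fun a _ b _ h => by simpa using h
    intro q hq
    have hq2 := abs_le.1 (Finset.mem_filter.1 hq).2
    simp only [Finset.coe_Icc, Set.mem_Icc]
    rw [Int.ceil_le, Int.le_floor]
    push_cast
    constructor <;> linarith [hq2.1, hq2.2]
  rw [Int.card_Icc] at h1
  have h2 : ((⌊y + s⌋ + 1 - ⌈y - s⌉).toNat : ℝ) ≤ 2 * s + 1 := by
    have h3 : (((⌊y + s⌋ + 1 - ⌈y - s⌉).toNat : ℤ) : ℝ) =
        max ((⌊y + s⌋ : ℝ) + 1 - ⌈y - s⌉) 0 := by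
      rw [Int.toNat_eq_max]; push_cast; rfl
    have h4 := Int.floor_le (y + s)
    have h5 := Int.le_ceil (y - s)
    have h6 : ((⌊y + s⌋ + 1 - ⌈y - s⌉).toNat : ℝ) =
        (((⌊y + s⌋ + 1 - ⌈y - s⌉).toNat : ℤ) : ℝ) := by push_cast; rfl
    rw [h6, h3]
    exact max_le (by linarith) (by linarith)
  exact le_trans (by exact_mod_cast h1) h2

namespace DominoTiling

/-- Monotone and subadditive set functions, the common features of the quenched and of the annealed
probabilities that matter for convergence in probability. -/
structure IsSubadditive (P : ∀ M, Set (DominoTiling M) → ℝ) : Prop where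
  nonneg : ∀ M A, 0 ≤ P M A
  mono : ∀ M A A', A ⊆ A' → P M A ≤ P M A'
  union_le : ∀ M A A', P M (A ∪ A') ≤ P M A + P M A'

variable {P : ∀ M, Set (DominoTiling M) → ℝ}

theorem ConvergesInProb.of_forall_exists (hP : IsSubadditive P) {Y : ∀ M, DominoTiling M → ℝ}
    {y : ℝ} (h : ∀ ε : ℝ, 0 < ε → ∃ (X : ∀ M, DominoTiling M → ℝ) (x δ : ℝ), 0 < δ ∧
      ConvergesInProb P X x ∧ ∀ᶠ M in atTop, ∀ T, ε ≤ |Y M T - y| → δ ≤ |X M T - x|) :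
    ConvergesInProb P Y y := by
  intro ε hε
  obtain ⟨X, x, δ, hδ, hX, hev⟩ := h ε hε
  refine tendsto_of_tendsto_of_tendsto_of_le_of_le' tendsto_const_nhds (hX δ hδ)
    (Eventually.of_forall fun M => hP.nonneg M _) ?_
  filter_upwards [hev] with M hM using hP.mono M _ _ fun T hT => hM T hT

theorem ConvergesInProb.const_mul (hP : IsSubadditive P) {X : ∀ M, DominoTiling M → ℝ} {x : ℝ}
    (hX : ConvergesInProb P X x) (c : ℝ) : ConvergesInProb P (fun M T => c * X M T) (c * x) := by
  refine .of_forall_exists hP fun ε hε => ⟨X, x, ε / (|c| + 1), by positivity, hX, ?_⟩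
  refine Eventually.of_forall fun M T hT => ?_
  rw [← mul_sub, abs_mul] at hT
  rw [div_le_iff₀ (by positivity)]
  nlinarith [abs_nonneg (X M T - x)]

theorem ConvergesInProb.add (hP : IsSubadditive P) {X Y : ∀ M, DominoTiling M → ℝ} {x y : ℝ}
    (hX : ConvergesInProb P X x) (hY : ConvergesInProb P Y y) :
    ConvergesInProb P (fun M T => X M T + Y M T) (x + y) := by
  intro ε hε
  have h := (hX (ε / 2) (half_pos hε)).add (hY (ε / 2) (half_pos hε))
  rw [add_zero] at h
  refine squeeze_zero (fun M => hP.nonneg M _) (fun M => ?_) h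
  refine (hP.mono M _ _ fun T hT => ?_).trans (hP.union_le M _ _)
  by_contra hcon
  have h1 : ¬ (ε / 2 ≤ |X M T - x| ∨ ε / 2 ≤ |Y M T - y|) := hcon
  have h2 : ε ≤ |X M T + Y M T - (x + y)| := hT
  push Not at h1
  have h3 := abs_add_le (X M T - x) (Y M T - y)
  rw [show X M T - x + (Y M T - y) = X M T + Y M T - (x + y) by ring] at h3
  linarith [h1.1, h1.2]

theorem convergesInProb_zero (hP : IsSubadditive P) {X : ∀ M, DominoTiling M → ℝ} {x : ℝ}
    (hX : ConvergesInProb P X x) : ConvergesInProb P (fun _ _ => 0) 0 := by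
  simpa using hX.const_mul hP 0

theorem ConvergesInProb.sum (hP : IsSubadditive P) {X : ℕ → ∀ M, DominoTiling M → ℝ} {x : ℕ → ℝ}
    (hX : ∀ k, ConvergesInProb P (X k) (x k)) (s : Finset ℕ) :
    ConvergesInProb P (fun M T => ∑ k ∈ s, X k M T) (∑ k ∈ s, x k) := by
  classical
  induction s using Finset.induction_on with
  | empty => simpa using convergesInProb_zero hP (hX 0)
  | insert a s ha ih =>
    simp only [Finset.sum_insert ha]
    exact (hX a).add hP ih

theorem integrable_empiricalMeasure {M : ℕ} (T : DominoTiling M) (N : ℕ) (f : ℝ → ℝ) :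
    Integrable f (T.empiricalMeasure N) := by
  unfold empiricalMeasure
  rcases Nat.eq_zero_or_pos N with rfl | hN
  · simp
  · exact Integrable.smul_measure
      (integrable_finsetSum_measure.2 fun p _ => integrable_dirac (by simp))
      (by simpa using hN.ne')

theorem ConvergesInProb.polynomial (hP : IsSubadditive P) {N : ℕ → ℕ} {m : Measure ℝ}
    (hm : ∀ k : ℕ, Integrable (fun x : ℝ => x ^ k) m)
    (h : ∀ k : ℕ, ConvergesInProb P (fun M T => ∫ x, x ^ k ∂(T.empiricalMeasure (N M)))
      (∫ x, x ^ k ∂m)) (Q : Polynomial ℝ) :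
    ConvergesInProb P (fun M T => ∫ x, Q.eval x ∂(T.empiricalMeasure (N M)))
      (∫ x, Q.eval x ∂m) := by
  have h1 := ConvergesInProb.sum hP (fun k => (h k).const_mul hP (Q.coeff k))
    (Finset.range (Q.natDegree + 1))
  have e : ∀ μ : Measure ℝ, (∀ k : ℕ, Integrable (fun x : ℝ => x ^ k) μ) →
      ∫ x, Q.eval x ∂μ = ∑ k ∈ Finset.range (Q.natDegree + 1), Q.coeff k * ∫ x, x ^ k ∂μ := by
    intro μ hμ
    simp only [Polynomial.eval_eq_sum_range]
    rw [integral_finsetSum _ fun k _ => (hμ k).const_mul _]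
    simp only [integral_const_mul]
  rw [e m hm]
  have e2 : (fun M (T : DominoTiling M) => ∫ x, Q.eval x ∂(T.empiricalMeasure (N M))) =
      fun M T => ∑ k ∈ Finset.range (Q.natDegree + 1),
        Q.coeff k * ∫ x, x ^ k ∂(T.empiricalMeasure (N M)) := by
    funext M T
    exact e _ fun k => T.integrable_empiricalMeasure _ _
  rw [e2]
  exact h1

/-- Counting particles with a polynomial instead of a step function costs little, because at most
one particle occupies each position. -/
theorem abs_card_sub_integral_le {M : ℕ} (T : DominoTiling M) {N p : ℕ} (hN0 : 0 < N) (hN : N ≤ M)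
    {R x₀ η δ : ℝ} (hη : 0 < η) (hMR : (M : ℝ) ≤ R * N) {Q : Polynomial ℝ}
    (hQ : ∀ x ∈ Set.Icc 0 R, (x ≤ x₀ → |Q.eval x - 1| ≤ δ) ∧
      (x₀ + η ≤ x → |Q.eval x| ≤ δ) ∧ -δ ≤ Q.eval x ∧ Q.eval x ≤ 1 + δ) :
    |(((T.particles N).filter (· < p)).card : ℝ) / N - ∫ x, Q.eval x ∂(T.empiricalMeasure N)| ≤
      δ + 2 * (η + |(p : ℝ) / N - x₀|) + 1 / N := by
  have hN' : (0 : ℝ) < N := by exact_mod_cast hN0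
  set r := η + |(p : ℝ) / N - x₀| with hr
  have hr0 : 0 ≤ r := by positivity
  rw [T.integral_empiricalMeasure hN (fun x => Q.eval x), ← sub_div, abs_div, abs_of_pos hN',
    div_le_iff₀ hN', Finset.card_filter]
  push_cast
  rw [← Finset.sum_sub_distrib]
  have hpt : ∀ q ∈ T.particles N, |(if q < p then (1 : ℝ) else 0) - Q.eval ((q : ℝ) / N)| ≤
      δ + if |(q : ℝ) - N * x₀| ≤ N * r then 1 else 0 := by
    intro q hq
    have hqM : q < M := Finset.mem_range.1 (T.particles_subset N hq)
    have hqR : (q : ℝ) ≤ R * N := le_trans (by exact_mod_cast hqM.le) hMR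
    obtain ⟨h1, h2, h3, h4⟩ := hQ ((q : ℝ) / N)
      (Set.mem_Icc.2 ⟨div_nonneg q.cast_nonneg hN'.le, (div_le_iff₀ hN').2 hqR⟩)
    have hp1 := le_abs_self ((p : ℝ) / N - x₀)
    have hp2 := neg_abs_le ((p : ℝ) / N - x₀)
    by_cases hc : |(q : ℝ) - N * x₀| ≤ N * r
    · rw [if_pos hc, abs_le]
      split_ifs <;> constructor <;> linarith
    · rw [if_neg hc, add_zero]
      have hqN : (q : ℝ) - N * x₀ = N * ((q : ℝ) / N - x₀) := by field_simp
      rw [hqN, abs_mul, abs_of_pos hN', not_le, mul_lt_mul_iff_right₀ hN', lt_abs] at hc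
      rcases hc with hc | hc
      · have h5 : (p : ℝ) / N < (q : ℝ) / N := by linarith
        rw [div_lt_div_iff_of_pos_right hN'] at h5
        rw [if_neg (by have : p < q := by exact_mod_cast h5
                       omega), zero_sub, abs_neg]
        exact h2 (by linarith [abs_nonneg ((p : ℝ) / N - x₀)])
      · have h5 : (q : ℝ) / N < (p : ℝ) / N := by linarith
        rw [div_lt_div_iff_of_pos_right hN'] at h5
        rw [if_pos (by exact_mod_cast h5), abs_sub_comm]
        exact h1 (by linarith)
  refine (Finset.abs_sum_le_sum_abs _ _).trans ((Finset.sum_le_sum hpt).trans ?_)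
  rw [Finset.sum_add_distrib, Finset.sum_const, T.card_particles hN, ← Finset.sum_filter,
    Finset.sum_const, nsmul_eq_mul, nsmul_eq_mul, mul_one]
  have h := card_filter_abs_sub_le (T.particles N) (N * x₀) (s := N * r) (by positivity)
  have e : (δ + 2 * r + 1 / N) * N = N * δ + (2 * (N * r) + 1) := by field_simp; ring
  rw [e]
  linarith

/-- The fraction of the particles of a row which lie to the left of a point converges to the
distribution function of the limiting measure. The point itself may carry an atom: distinctness of
the particle positions makes the one-sided approximation sufficient. -/
theorem convergesInProb_card (hP : IsSubadditive P) {m : Measure ℝ} [IsProbabilityMeasure m]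
    {R x₀ : ℝ} (hR : ∀ᵐ x ∂m, x ∈ Set.Icc 0 R)
    (hm : ∀ k : ℕ, Integrable (fun x : ℝ => x ^ k) m) {N p : ℕ → ℕ}
    (hN : ∀ᶠ M in atTop, 0 < N M ∧ N M ≤ M ∧ (M : ℝ) ≤ R * N M)
    (hNinf : Tendsto (fun M => 1 / (N M : ℝ)) atTop (𝓝 0))
    (hp : Tendsto (fun M => (p M : ℝ) / N M) atTop (𝓝 x₀))
    (h : ∀ k : ℕ, ConvergesInProb P (fun M T => ∫ x, x ^ k ∂(T.empiricalMeasure (N M)))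
      (∫ x, x ^ k ∂m)) :
    ConvergesInProb P (fun M T => (((T.particles (N M)).filter (· < p M)).card : ℝ) / N M)
      (m.real (Set.Iic x₀)) := by
  refine .of_forall_exists hP fun ε hε => ?_
  obtain ⟨η, hη, hηε, hcdf⟩ : ∃ η > 0, η ≤ ε / 16 ∧
      m.real (Set.Iic (x₀ + η)) ≤ m.real (Set.Iic x₀) + ε / 8 := by
    have hc := ((cdf m).right_continuous x₀).eventually
      (gt_mem_nhds (show cdf m x₀ < cdf m x₀ + ε / 8 by linarith))
    obtain ⟨y, hy, hsub⟩ := mem_nhdsGE_iff_exists_Icc_subset.1 hc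
    refine ⟨min (y - x₀) (ε / 16), lt_min (by linarith) (by linarith), min_le_right _ _, ?_⟩
    have h1 := min_le_left (y - x₀) (ε / 16)
    have h2 : 0 ≤ min (y - x₀) (ε / 16) := le_min (by linarith) (by linarith)
    have h3 : cdf m (x₀ + min (y - x₀) (ε / 16)) < cdf m x₀ + ε / 8 :=
      hsub (Set.mem_Icc.2 ⟨by linarith, by linarith⟩)
    rw [cdf_eq_real, cdf_eq_real] at h3
    exact h3.le
  have hδ : 0 < ε / 16 := by linarith
  obtain ⟨Q, hQ⟩ := exists_polynomial_near_step R x₀ hη hδ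
  refine ⟨_, _, ε / 4, by linarith, ConvergesInProb.polynomial hP hm h Q, ?_⟩
  have hQint : Integrable (fun x => Q.eval x) m := by
    simp only [Polynomial.eval_eq_sum_range]
    exact integrable_finsetSum _ fun k _ => (hm k).const_mul _
  have hind : ∀ y : ℝ, Integrable ((Set.Iic y).indicator (1 : ℝ → ℝ)) m := fun y =>
    (integrable_const (1 : ℝ)).indicator measurableSet_Iic
  have hlow : m.real (Set.Iic x₀) - ε / 16 ≤ ∫ x, Q.eval x ∂m := by
    have h1 := integral_mono_ae ((hind x₀).sub (integrable_const (ε / 16))) hQint (by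
      filter_upwards [hR] with x hx
      obtain ⟨h1, -, h3, -⟩ := hQ x hx
      rw [Pi.sub_apply]
      by_cases hxx : x ≤ x₀
      · rw [Set.indicator_of_mem (Set.mem_Iic.2 hxx), Pi.one_apply]
        linarith [(abs_le.1 (h1 hxx)).1]
      · rw [Set.indicator_of_notMem (by simpa using hxx)]
        linarith)
    have h2 := integral_sub (hind x₀) (integrable_const (μ := m) (ε / 16))
    simp only [Pi.sub_apply] at h1
    rw [h2, integral_indicator_one measurableSet_Iic, integral_const] at h1
    simpa using h1
  have hup : ∫ x, Q.eval x ∂m ≤ m.real (Set.Iic (x₀ + η)) + ε / 16 := by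
    have h1 := integral_mono_ae hQint ((hind (x₀ + η)).add (integrable_const (ε / 16))) (by
      filter_upwards [hR] with x hx
      obtain ⟨-, h2, -, h4⟩ := hQ x hx
      rw [Pi.add_apply]
      by_cases hxx : x ≤ x₀ + η
      · rw [Set.indicator_of_mem (Set.mem_Iic.2 hxx), Pi.one_apply]
        linarith
      · rw [Set.indicator_of_notMem (by simpa using hxx)]
        linarith [(abs_le.1 (h2 (le_of_not_ge hxx))).2])
    have h2 := integral_add (hind (x₀ + η)) (integrable_const (μ := m) (ε / 16))
    simp only [Pi.add_apply] at h1
    rw [h2, integral_indicator_one measurableSet_Iic, integral_const] at h1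
    simpa using h1
  have hp' : Tendsto (fun M => |(p M : ℝ) / N M - x₀|) atTop (𝓝 0) := by
    simpa using (hp.sub_const x₀).abs
  filter_upwards [hN, hNinf.eventually (gt_mem_nhds hδ), hp'.eventually (gt_mem_nhds hδ)]
    with M hM h1 h2 T hT
  have h3 := T.abs_card_sub_integral_le (p := p M) hM.1 hM.2.1 hη hM.2.2 hQ
  generalize ((T.particles (N M)).filter (· < p M)).card / (N M : ℝ) = c at *
  generalize ∫ x, Q.eval x ∂(T.empiricalMeasure (N M)) = I at *
  generalize ∫ x, Q.eval x ∂m = J at *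
  have h4 : |J - m.real (Set.Iic x₀)| ≤ ε / 16 + ε / 8 := by
    rw [abs_le]; constructor <;> linarith
  have h5 := abs_sub_le c I (m.real (Set.Iic x₀))
  have h6 := abs_sub_le I J (m.real (Set.Iic x₀))
  linarith

theorem tendsto_floor_mul_div (u : ℝ) :
    Tendsto (fun M : ℕ => (⌊(M : ℝ) * u⌋ : ℝ) / M) atTop (𝓝 u) := by
  have h1 : Tendsto (fun M : ℕ => u - 1 / (M : ℝ)) atTop (𝓝 u) := by
    simpa using tendsto_const_nhds.sub (tendsto_one_div_atTop_nhds_zero_nat (𝕜 := ℝ))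
  refine tendsto_of_tendsto_of_tendsto_of_le_of_le' h1 tendsto_const_nhds ?_ ?_
  · filter_upwards [eventually_gt_atTop 0] with M hM
    have hM' : (0 : ℝ) < M := by exact_mod_cast hM
    rw [le_div_iff₀ hM', sub_mul, one_div, inv_mul_cancel₀ hM'.ne', mul_comm]
    exact (Int.sub_one_lt_floor _).le
  · filter_upwards [eventually_gt_atTop 0] with M hM
    have hM' : (0 : ℝ) < M := by exact_mod_cast hM
    rw [div_le_iff₀ hM', mul_comm u]
    exact Int.floor_le _

/-- Halving an integer sequence does not disturb its rescaled limit. -/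
theorem tendsto_ediv_two_div {a : ℕ → ℤ} {x : ℝ}
    (ha : Tendsto (fun M : ℕ => (a M : ℝ) / M) atTop (𝓝 x)) :
    Tendsto (fun M : ℕ => ((a M / 2 : ℤ) : ℝ) / M) atTop (𝓝 (x / 2)) := by
  have h0 := tendsto_one_div_atTop_nhds_zero_nat (𝕜 := ℝ)
  have h1 : Tendsto (fun M : ℕ => (a M : ℝ) / M / 2 - 1 / (M : ℝ)) atTop (𝓝 (x / 2)) := by
    simpa using (ha.div_const 2).sub h0
  refine tendsto_of_tendsto_of_tendsto_of_le_of_le' h1 (ha.div_const 2) ?_ ?_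
  · refine Eventually.of_forall fun M => ?_
    have h2 : (a M : ℝ) ≤ 2 * ((a M / 2 : ℤ) : ℝ) + 2 := by
      exact_mod_cast (by omega : a M ≤ 2 * (a M / 2) + 2)
    rw [show (a M : ℝ) / M / 2 - 1 / (M : ℝ) = ((a M : ℝ) / 2 - 1) / M by ring]
    exact div_le_div_of_nonneg_right (by linarith) M.cast_nonneg
  · refine Eventually.of_forall fun M => ?_
    have h2 : 2 * ((a M / 2 : ℤ) : ℝ) ≤ a M := by
      exact_mod_cast (by omega : 2 * (a M / 2) ≤ a M)
    rw [show (a M : ℝ) / M / 2 = ((a M : ℝ) / 2) / M by ring]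
    exact div_le_div_of_nonneg_right (by linarith) M.cast_nonneg

/-- Convergence of the moments of the rows implies convergence of the height function. -/
theorem convergesInProb_height (hP : IsSubadditive P) {u v : ℝ} (huv : |u| + |v| < 1)
    {m : Measure ℝ} [IsProbabilityMeasure m]
    (hR : ∀ᵐ x ∂m, x ∈ Set.Icc 0 (2 / ((1 + u + v) / 2)))
    (hm : ∀ k : ℕ, Integrable (fun x : ℝ => x ^ k) m)
    (h : ∀ N : ℕ → ℕ, Tendsto (fun M : ℕ => (N M : ℝ) / M) atTop (𝓝 ((1 + u + v) / 2)) →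
      ∀ k : ℕ, ConvergesInProb P (fun M T => ∫ x, x ^ k ∂(T.empiricalMeasure (N M)))
        (∫ x, x ^ k ∂m)) :
    ConvergesInProb P (fun M T => (T.height ⌊M * u⌋ ⌊M * v⌋ : ℝ) / M)
      (2 * (1 + u) - 2 * (1 + u + v) * m.real (Set.Iic ((1 + u - v) / (1 + u + v)))) := by
  have hu1 := le_abs_self u
  have hu2 := neg_abs_le u
  have hv1 := le_abs_self v
  have hv2 := neg_abs_le v
  set α := (1 + u + v) / 2 with hα
  have hα0 : 0 < α := by rw [hα]; linarith
  have hα1 : α < 1 := by rw [hα]; linarith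
  set a : ℕ → ℤ := fun M => (⌊(M : ℝ) * u⌋ + ⌊(M : ℝ) * v⌋ + M + 1) / 2 with ha
  set b : ℕ → ℤ := fun M => (⌊(M : ℝ) * u⌋ - ⌊(M : ℝ) * v⌋ + M) / 2 with hb
  have h0 := tendsto_one_div_atTop_nhds_zero_nat (𝕜 := ℝ)
  have hone : Tendsto (fun M : ℕ => (M : ℝ) / M) atTop (𝓝 1) := by
    refine tendsto_const_nhds.congr' ?_
    filter_upwards [eventually_gt_atTop 0] with M hM
    rw [div_self (by exact_mod_cast hM.ne')]
  have hta : Tendsto (fun M : ℕ => (a M : ℝ) / M) atTop (𝓝 α) := by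
    have h1 := (((tendsto_floor_mul_div u).add (tendsto_floor_mul_div v)).add hone).add h0
    have h2 := tendsto_ediv_two_div (a := fun M => ⌊(M : ℝ) * u⌋ + ⌊(M : ℝ) * v⌋ + M + 1)
      (x := u + v + 1 + 0) (h1.congr fun M => by push_cast; ring)
    rwa [show (u + v + 1 + 0) / 2 = α by rw [hα]; ring] at h2
  have htb : Tendsto (fun M : ℕ => (b M : ℝ) / M) atTop (𝓝 ((1 + u - v) / 2)) := by
    have h1 := ((tendsto_floor_mul_div u).sub (tendsto_floor_mul_div v)).add hone
    have h2 := tendsto_ediv_two_div (a := fun M => ⌊(M : ℝ) * u⌋ - ⌊(M : ℝ) * v⌋ + M)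
      (x := u - v + 1) (h1.congr fun M => by push_cast; ring)
    rwa [show (u - v + 1) / 2 = (1 + u - v) / 2 by ring] at h2
  have hpos : ∀ (s : ℕ → ℤ) (y : ℝ), 0 < y → y < 1 →
      Tendsto (fun M : ℕ => (s M : ℝ) / M) atTop (𝓝 y) →
      ∀ᶠ M : ℕ in atTop, 0 < s M ∧ s M ≤ M := by
    intro s y hy0 hy1 hs
    filter_upwards [eventually_gt_atTop 0, hs.eventually (lt_mem_nhds hy0),
      hs.eventually (gt_mem_nhds hy1)] with M hM h1 h2
    have hM' : (0 : ℝ) < M := by exact_mod_cast hM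
    rw [div_lt_one hM'] at h2
    have h3 := (div_pos_iff_of_pos_right hM').1 h1
    exact ⟨by exact_mod_cast h3, by exact_mod_cast h2.le⟩
  have hea := hpos a α hα0 hα1 hta
  have heb := hpos b ((1 + u - v) / 2) (by linarith) (by linarith) htb
  set N : ℕ → ℕ := fun M => (a M).toNat with hNdef
  set p : ℕ → ℕ := fun M => (b M).toNat with hpdef
  have hcast : ∀ s : ℤ, 0 < s → ((s.toNat : ℕ) : ℝ) = s := fun s hs => by
    exact_mod_cast congrArg (Int.cast : ℤ → ℝ) (Int.toNat_of_nonneg hs.le)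
  have hN : Tendsto (fun M : ℕ => (N M : ℝ) / M) atTop (𝓝 α) := by
    refine hta.congr' ?_
    filter_upwards [hea] with M hM
    rw [hNdef]; simp only [hcast _ hM.1]
  have hp : Tendsto (fun M : ℕ => (p M : ℝ) / M) atTop (𝓝 ((1 + u - v) / 2)) := by
    refine htb.congr' ?_
    filter_upwards [heb] with M hM
    rw [hpdef]; simp only [hcast _ hM.1]
  have hNev : ∀ᶠ M : ℕ in atTop, 0 < N M ∧ N M ≤ M ∧ (M : ℝ) ≤ 2 / α * N M := by
    filter_upwards [hea, hN.eventually (lt_mem_nhds (half_lt_self hα0)), eventually_gt_atTop 0]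
      with M hM h2 hM0
    have hM' : (0 : ℝ) < M := by exact_mod_cast hM0
    rw [lt_div_iff₀ hM'] at h2
    refine ⟨by simp only [hNdef]; omega, by simp only [hNdef]; omega, ?_⟩
    rw [div_mul_eq_mul_div, le_div_iff₀ hα0]
    linarith
  have hpN : Tendsto (fun M => (p M : ℝ) / N M) atTop (𝓝 ((1 + u - v) / (1 + u + v))) := by
    have h1 := hp.div hN hα0.ne'
    rw [show (1 + u - v) / 2 / α = (1 + u - v) / (1 + u + v) by rw [hα]; field_simp] at h1
    refine h1.congr' ?_
    filter_upwards [eventually_gt_atTop 0] with M hM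
    have hM' : (M : ℝ) ≠ 0 := by exact_mod_cast hM.ne'
    rw [Pi.div_apply, div_div_div_cancel_right₀ hM']
  have hNinf : Tendsto (fun M => 1 / (N M : ℝ)) atTop (𝓝 0) := by
    have h1 := h0.div hN hα0.ne'
    rw [zero_div] at h1
    refine h1.congr' ?_
    filter_upwards [eventually_gt_atTop 0] with M hM
    have hM' : (M : ℝ) ≠ 0 := by exact_mod_cast hM.ne'
    rw [Pi.div_apply, div_div_div_cancel_right₀ hM']
  have hcard := convergesInProb_card hP hR hm hNev hNinf hpN (h N hN)
  set F := m.real (Set.Iic ((1 + u - v) / (1 + u + v))) with hF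
  refine .of_forall_exists hP fun ε hε => ⟨_, F, ε / 8, by linarith, hcard, ?_⟩
  have herr : Tendsto (fun M : ℕ => 3 * (1 / (M : ℝ)) +
      |2 * ((N M : ℝ) / M) + 2 * ((p M : ℝ) / M) - 2 * (1 + u)| + 4 * |(N M : ℝ) / M - α|)
      atTop (𝓝 0) := by
    have h1 := ((h0.const_mul 3).add
      ((((hN.const_mul 2).add (hp.const_mul 2)).sub_const (2 * (1 + u))).abs)).add
      (((hN.sub_const α).abs).const_mul 4)
    rwa [show 3 * (0 : ℝ) + |2 * α + 2 * ((1 + u - v) / 2) - 2 * (1 + u)| + 4 * |α - α| = 0 by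
      rw [show 2 * α + 2 * ((1 + u - v) / 2) - 2 * (1 + u) = 0 by rw [hα]; ring]; simp] at h1
  filter_upwards [hNev, heb, hea, eventually_gt_atTop 0,
    herr.eventually (gt_mem_nhds (half_pos hε))] with M hM hbM haM hM0 hMe T hT
  have hM' : (0 : ℝ) < M := by exact_mod_cast hM0
  have hN' : (0 : ℝ) < N M := by exact_mod_cast hM.1
  have hheight := T.abs_height_sub_le (x := ⌊(M : ℝ) * u⌋) (y := ⌊(M : ℝ) * v⌋) (N := N M)
    (p := p M) hM.2.1 (by simp only [hpdef]; omega)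
    (by simp only [hNdef]; rw [Int.toNat_of_nonneg haM.1.le])
    (by simp only [hpdef]; rw [Int.toNat_of_nonneg hbM.1.le])
  have hcle : ((T.particles (N M)).filter (· < p M)).card ≤ N M :=
    (Finset.card_filter_le _ _).trans_eq (T.card_particles hM.2.1)
  have hheight' : |(T.height ⌊(M : ℝ) * u⌋ ⌊(M : ℝ) * v⌋ : ℝ) - (2 * N M + 2 * p M -
      4 * ((T.particles (N M)).filter (· < p M)).card)| ≤ 3 := by exact_mod_cast hheight
  have hcle' : (((T.particles (N M)).filter (· < p M)).card : ℝ) / N M ≤ 1 :=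
    (div_le_one hN').2 (by exact_mod_cast hcle)
  have hc0 : 0 ≤ (((T.particles (N M)).filter (· < p M)).card : ℝ) / N M := by positivity
  set c := (((T.particles (N M)).filter (· < p M)).card : ℝ) / N M with hc
  have hcc : (((T.particles (N M)).filter (· < p M)).card : ℝ) = c * N M := by
    rw [hc]; field_simp
  rw [hcc] at hheight'
  set ht := (T.height ⌊(M : ℝ) * u⌋ ⌊(M : ℝ) * v⌋ : ℝ)
  have e : ht / M - (2 * (1 + u) - 2 * (1 + u + v) * F) =
      (ht - (2 * N M + 2 * p M - 4 * (c * N M))) / M +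
      ((2 * ((N M : ℝ) / M) + 2 * ((p M : ℝ) / M) - 2 * (1 + u)) +
      ((-4) * (c * ((N M : ℝ) / M - α)) + (-4) * (α * (c - F)))) := by
    rw [show 1 + u + v = 2 * α by rw [hα]; ring]
    field_simp
    ring
  have h1 : |(ht - (2 * N M + 2 * p M - 4 * (c * N M))) / M| ≤ 3 * (1 / (M : ℝ)) := by
    rw [abs_div, abs_of_pos hM', mul_one_div]
    exact div_le_div_of_nonneg_right hheight' hM'.le
  have h2 : |(-4) * (c * ((N M : ℝ) / M - α))| ≤ 4 * |(N M : ℝ) / M - α| := by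
    rw [abs_mul, abs_mul, abs_of_nonneg hc0]
    norm_num
    exact mul_le_of_le_one_left (abs_nonneg _) hcle'
  have h3 : |(-4) * (α * (c - F))| ≤ 4 * |c - F| := by
    rw [abs_mul, abs_mul, abs_of_pos hα0]
    norm_num
    exact mul_le_of_le_one_left (abs_nonneg _) hα1.le
  rw [e] at hT
  have h4 := abs_add_le ((ht - (2 * N M + 2 * p M - 4 * (c * N M))) / M)
    ((2 * ((N M : ℝ) / M) + 2 * ((p M : ℝ) / M) - 2 * (1 + u)) +
      ((-4) * (c * ((N M : ℝ) / M - α)) + (-4) * (α * (c - F))))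
  have h5 := abs_add_le (2 * ((N M : ℝ) / M) + 2 * ((p M : ℝ) / M) - 2 * (1 + u))
      ((-4) * (c * ((N M : ℝ) / M - α)) + (-4) * (α * (c - F)))
  have h6 := abs_add_le ((-4) * (c * ((N M : ℝ) / M - α))) ((-4) * (α * (c - F)))
  linarith

end DominoTiling

/-! ### The limit shape -/

namespace DominoTiling

theorem isSubadditive_quenchedProb {β : ℝ} (hβ0 : 0 < β) (hβ1 : β < 1) :
    IsSubadditive (fun M => quenchedProb (fun _ : Fin M => β)) where
  nonneg _ A := quenchedProb_nonneg (fun _ => ⟨hβ0, hβ1⟩) A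
  mono _ _ _ h := quenchedProb_mono (fun _ => ⟨hβ0, hβ1⟩) h
  union_le _ A A' := quenchedProb_union_le (fun _ => ⟨hβ0, hβ1⟩) A A'

theorem isSubadditive_annealedProb {B : ℕ → Measure ℝ} (hP : ∀ M, IsProbabilityMeasure (B M))
    (hB : ∀ M, ∀ᵐ b ∂(B M), 0 < b ∧ b < 1) : IsSubadditive (fun M => annealedProb (B M)) where
  nonneg M A := have := hP M; annealedProb_nonneg (hB M) A
  mono M _ _ h := have := hP M; annealedProb_mono (hB M) h
  union_le M A A' := have := hP M; annealedProb_union_le (hB M) A A'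

/-- The limit of the empirical measures of the rows `N ~ α M`, for `0 < α < 1`; it is set to zero for
other values of `α`. -/
noncomputable def limitMeasure {β : ℝ} (hβ0 : 0 < β) (hβ1 : β < 1) (α : ℝ) : Measure ℝ :=
  if h : 0 < α ∧ α < 1 then (exists_limit_measure hβ0 hβ1 h.1 h.2).choose else 0

theorem limitMeasure_spec {β α : ℝ} (hβ0 : 0 < β) (hβ1 : β < 1) (hα0 : 0 < α) (hα1 : α < 1) :
    IsProbabilityMeasure (limitMeasure hβ0 hβ1 α) ∧
      (∀ᵐ x ∂(limitMeasure hβ0 hβ1 α), x ∈ Set.Icc 0 (2 / α)) ∧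
      ∀ k : ℕ, ∫ x, x ^ k ∂(limitMeasure hβ0 hβ1 α) = momentLimit β α k / α ^ (k + 1) := by
  rw [limitMeasure, dif_pos ⟨hα0, hα1⟩]
  exact (exists_limit_measure hβ0 hβ1 hα0 hα1).choose_spec

theorem integrable_pow_limitMeasure {β α : ℝ} (hβ0 : 0 < β) (hβ1 : β < 1) (hα0 : 0 < α)
    (hα1 : α < 1) (k : ℕ) : Integrable (fun x : ℝ => x ^ k) (limitMeasure hβ0 hβ1 α) := by
  obtain ⟨hp, hR, -⟩ := limitMeasure_spec hβ0 hβ1 hα0 hα1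
  refine Integrable.of_bound (by fun_prop) ((2 / α) ^ k) ?_
  filter_upwards [hR] with x hx
  rw [norm_pow, Real.norm_eq_abs, abs_of_nonneg hx.1]
  exact pow_le_pow_left₀ hx.1 hx.2 k

/-- Convergence of the moments of the rows determines the limit shape; the moments, and hence the
limit, do not depend on the probabilities `P`. -/
theorem convergesToLimitShape {β : ℝ} (hβ0 : 0 < β) (hβ1 : β < 1)
    {P : ∀ M, Set (DominoTiling M) → ℝ} (hP : IsSubadditive P)
    (h : ∀ α : ℝ, 0 < α → α < 1 → ∀ N : ℕ → ℕ,
      Tendsto (fun M => (N M : ℝ) / M) atTop (𝓝 α) → ∀ k : ℕ,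
      ConvergesInProb P (fun M T => ∫ x, x ^ k ∂(T.empiricalMeasure (N M)))
        (momentLimit β α k / α ^ (k + 1))) :
    ConvergesToLimitShape P
      (fun u v => 2 * (1 + u) - 2 * (1 + u + v) *
        (limitMeasure hβ0 hβ1 ((1 + u + v) / 2)).real (Set.Iic ((1 + u - v) / (1 + u + v))))
      (limitMeasure hβ0 hβ1) := by
  have hmom : ∀ α : ℝ, 0 < α → α < 1 → ∀ N : ℕ → ℕ,
      Tendsto (fun M => (N M : ℝ) / M) atTop (𝓝 α) → ∀ k : ℕ,
      ConvergesInProb P (fun M T => ∫ x, x ^ k ∂(T.empiricalMeasure (N M)))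
        (∫ x, x ^ k ∂(limitMeasure hβ0 hβ1 α)) := by
    intro α hα0 hα1 N hN k
    rw [(limitMeasure_spec hβ0 hβ1 hα0 hα1).2.2 k]
    exact h α hα0 hα1 N hN k
  refine ⟨fun u v huv => ?_, hmom⟩
  have hα0 : 0 < (1 + u + v) / 2 := by linarith [neg_abs_le u, neg_abs_le v]
  have hα1 : (1 + u + v) / 2 < 1 := by linarith [le_abs_self u, le_abs_self v]
  obtain ⟨hp, hR, -⟩ := limitMeasure_spec hβ0 hβ1 hα0 hα1
  exact convergesInProb_height hP huv hR (integrable_pow_limitMeasure hβ0 hβ1 hα0 hα1)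
    (hmom _ hα0 hα1)

end DominoTiling

theorem mainTheorem7 (β : ℝ) (hβ0 : 0 < β) (hβ1 : β < 1) :
    -- the limit shape `H` and the limiting slice measures `m α` depend only on `β`
    ∃ (H : ℝ → ℝ → ℝ) (m : ℝ → Measure ℝ),
      (∀ α : ℝ, 0 < α → α < 1 →
        IsProbabilityMeasure (m α) ∧ ∀ k : ℕ, Integrable (fun x : ℝ => x ^ k) (m α)) ∧
      -- `H` is encoded on its slices by the distribution functions of `m α`, `α = (1 + u + v) / 2`
      (∀ u v : ℝ, |u| + |v| < 1 →
        H u v = 2 * (1 + u) -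
          2 * (1 + u + v) * (m ((1 + u + v) / 2)).real (Set.Iic ((1 + u - v) / (1 + u + v)))) ∧
      -- deterministic parameters `b_i = β`
      DominoTiling.ConvergesToLimitShape
        (fun M => DominoTiling.quenchedProb (fun _ : Fin M => β)) H m ∧
      -- random parameters with law `B M`
      ∀ (σ : ℝ) (B : ℕ → Measure ℝ), 0 < σ →
        (∀ M, IsProbabilityMeasure (B M)) →
        (∀ M, ∀ᵐ b ∂(B M), 0 < b ∧ b < 1) →
        Tendsto (fun M => ∫ b, b ∂(B M)) atTop (𝓝 β) →
        Tendsto (fun M : ℕ => (M : ℝ) * variance (fun b : ℝ => b) (B M)) atTop (𝓝 (σ ^ 2)) →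
        DominoTiling.ConvergesToLimitShape
          (fun M => DominoTiling.annealedProb (B M)) H m := by
  refine ⟨_, limitMeasure hβ0 hβ1, fun α hα0 hα1 => ⟨(limitMeasure_spec hβ0 hβ1 hα0 hα1).1,
      integrable_pow_limitMeasure hβ0 hβ1 hα0 hα1⟩, fun u v _ => rfl,
    convergesToLimitShape hβ0 hβ1 (isSubadditive_quenchedProb hβ0 hβ1)
      fun α hα0 hα1 N hN k => convergesInProb_moment_quenched hβ0 hβ1 hα0 hα1 hN k, ?_⟩
  intro σ B _ hP hB hE hV
  exact convergesToLimitShape hβ0 hβ1 (isSubadditive_annealedProb hP hB)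
    fun α hα0 hα1 N hN k => convergesInProb_moment_annealed hβ0 hβ1 hα0 hα1 hN k hP hB hE hV
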